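/- **Setting.** An instance of the generalized assignment problem (GAP) has $n$ bins and $m$ items, weights $w_{ij}\ge 0$, capacities $C_i\ge 0$ (public) and values $v_{ij}\ge 0$ (reported by the bidders). Let $\mathcal F_i$ be the family of sets $S$ of items with $\sum_{j\in S}w_{ij}\le C_i$. An allocation $(S_1,\dots,S_n)$ is feasible if $S_i\in\mathcal F_i$ for all $i$ and the $S_i$ are mutually disjoint. Its social welfare is $\sum_i g_i(S_i)$, where $g_i(S)=\sum_{j\in S}v_{ij}$ for $S\in\mathcal F_i$ and $g_i(S)=0$ otherwise. An allocation rule maps values to a law of allocations. It is *$(1-\epsilon)$-maximal in distributional range* ($(1-\epsilon)$-MIDR) with range $\mathcal D$, a set of laws of feasible allocations that does not depend on $v$, if for all $v$ the law it outputs lies in $\mathcal D$ and has expected welfare at least $(1-\epsilon)$ times that of every $D\in\mathcal D$. Let $\mathcal R$ be the polytope of all $x=(x_{i,S})$ with $x_{i,S}\ge 0$, $x_{i,S}=0$ for $S\notin\mathcal F_i$, and $\sum_S x_{i,S}\le 1$ for all $i$, and let $\phi(x)_{ij}=\sum_{S\ni j}x_{i,S}$. *Rounding* $x\in\mathcal R$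 with permutations $\pi_j$ of the bins (one for each item $j$) means: take some $x'\in\mathcal R$ with $\phi(x')_{ij}=1-e^{-\phi(x)_{ij}}$ for all $i,j$; independently for all bins $i$ draw the set $S$ with probability $x'_{i,S}$ (and $\emptyset$ with the remaining probability); give each item $j$ to the bin that comes first in $\pi_j$ among the bins whose set contains $j$. The rounding is *greedy* if each $\pi_j$ sorts the bins by non-increasing $v_{ij}$. Let $$F(y)=\sum_{j=1}^m\sum_{i=1}^n\bigl(v_{\sigma_j(i),j}-v_{\sigma_j(i+1),j}\bigr)\Bigl(1-\exp\bigl(-\textstyle\sum_{k=1}^i y_{\sigma_j(k),j}\bigr)\Bigr),$$ where $\sigma_j$ sorts the bins by non-increasing $v_{ij}$ and $v_{\sigma_j(n+1),j}=0$. *Fractional local search* with accuracy $\eta$: let $K=\lceil 6mn^2/\eta\rceil$, $\delta=1/K$ and $M=\max_{i,j}g_i(\{j\})$. A store $\mathcal Z$ (a multiset, initially empty) of vectors $z=(z_1,\dots,z_n)$ with $z_i\in\mathcal F_i$ represents the point $x\in\mathcal R$ with $x_{i,S}=\delta\cdot\#\{z\in\mathcal Z: z_i=S\}$; put $y=\phi(x)$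 and $u=\nabla F(y)$. In each iteration, for each bin $i$ a knapsack approximation scheme with accuracy $\eta$ returns $z_i\in\mathcal F_i$ with $\sum_{j\in z_i}u_{ij}\ge(1-\eta)\max_{S\in\mathcal F_i}\sum_{j\in S}u_{ij}$. Identify $z$ with its indicator vector. If $(z-y)\cdot u\le\eta M$, the search stops with the outcome $x$. Otherwise $z$ is added to $\mathcal Z$, and if $\mathcal Z$ already had $K$ elements, an element $z'$ of $\mathcal Z$ with least $z'\cdot u$ is removed. **Theorem.** There are one randomized program and one polynomial $p$ such that for all $n,m$, all public data $(w,C)$ and all $\epsilon\in(0,1]$, with $T=p(n+m+\lceil1/\epsilon\rceil)$, the following holds. (In particular, for $\epsilon=1/\mathrm{poly}(n)$ the time bound $T$ is polynomial in $n$ and $m$.) 1. On input $(n,m,\epsilon,w,C,v)$ the program always halts within $T$ steps. The cost model is the uniform randomized real-number machine: unit-cost addition, subtraction, multiplication, division, exponential and comparison of reals, natural-number indices with addition and subtraction, and biased coins. 2. The allocation rule that the program computes is $(1-\epsilon)$-MIDR. Its range is the set of the laws of all roundings of all $x\in\mathcal R$ with all permutations, which depends only on $(w,C)$. 3. For all $v$,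 its expected welfare is at least $(1-1/e-\epsilon)$ times the welfare of every feasible allocation. 4. For every $x\in\mathcal R$ there is $x'\in\mathcal R$ with $\phi(x')=1-e^{-\phi(x)}$ (coordinatewise). For all $v$, $F$ is concave, and the expected welfare of every greedy rounding of $x\in\mathcal R$ is exactly $F(\phi(x))$. 5. For all $v$, every run of the fractional local search with accuracy $\epsilon/4$ has at most $T$ iterations and stays in $\mathcal R$, and its outcome $x^*$ satisfies $F(\phi(x^*))\ge(1-\epsilon)F(\phi(x))$ for all $x\in\mathcal R$. 6. For all $v$, the law that the program outputs is a greedy rounding of the outcome of some run of this local search. -/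

import Mathlib

/-! ## Programs for a uniform randomized real-number machine

The machine has natural-number cells (used for indices and counters) and real cells. A cell is
addressed by a fixed array name and three computed indices. One step performs one assignment, one
test or one biased coin flip; all expressions occurring in a program have a fixed size. Naturals can
only be added, subtracted and compared, reals can be added, subtracted, multiplied, divided,
exponentiated and compared; there is no rounding of a real to a natural number. -/

namespace RealRAM

/-- Natural-number expressions; `sub` is truncated subtraction. -/
inductive NExpr : Type
  | const (k : ℕ)
  | read (a : ℕ) (i j k : NExpr)
  | add (e₁ e₂ : NExpr)
  | sub (e₁ e₂ : NExpr)

/-- Real expressions. The only constants are natural numbers. -/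
inductive RExpr : Type
  | ofNat (e : NExpr)
  | read (a : ℕ) (i j k : NExpr)
  | add (e₁ e₂ : RExpr)
  | sub (e₁ e₂ : RExpr)
  | mul (e₁ e₂ : RExpr)
  | div (e₁ e₂ : RExpr)
  | exp (e : RExpr)

/-- Tests. -/
inductive Test : Type
  | natLt (e₁ e₂ : NExpr)
  | realLt (e₁ e₂ : RExpr)
  | not (t : Test)
  | and (t₁ t₂ : Test)

/-- Programs. `flip a i j k p` tosses a coin of bias `p` (clamped to `[0,1]`) and stores the outcome
`1` or `0` in the natural-number cell `a[i,j,k]`. -/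
inductive Prog : Type
  | setNat (a : ℕ) (i j k e : NExpr)
  | setReal (a : ℕ) (i j k : NExpr) (e : RExpr)
  | flip (a : ℕ) (i j k : NExpr) (p : RExpr)
  | seq (P Q : Prog)
  | ite (t : Test) (P Q : Prog)
  | while (t : Test) (P : Prog)

/-- The memory: the contents of all natural-number and of all real cells. -/
structure Memory : Type where
  nat : ℕ → ℕ → ℕ → ℕ → ℕ
  real : ℕ → ℕ → ℕ → ℕ → ℝ

noncomputable section

namespace Memory

/-- Write `x` into the natural-number cell `a[i,j,k]`. -/
def writeNat (s : Memory) (a i j k x : ℕ) : Memory where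
  nat := fun a' i' j' k' => if a' = a ∧ i' = i ∧ j' = j ∧ k' = k then x else s.nat a' i' j' k'
  real := s.real

/-- Write `x` into the real cell `a[i,j,k]`. -/
def writeReal (s : Memory) (a i j k : ℕ) (x : ℝ) : Memory where
  nat := s.nat
  real := fun a' i' j' k' => if a' = a ∧ i' = i ∧ j' = j ∧ k' = k then x else s.real a' i' j' k'

end Memory

def NExpr.eval (s : Memory) : NExpr → ℕ
  | const k => k
  | read a i j k => s.nat a (i.eval s) (j.eval s) (k.eval s)
  | add e₁ e₂ => e₁.eval s + e₂.eval s
  | sub e₁ e₂ => e₁.eval s - e₂.eval s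

def RExpr.eval (s : Memory) : RExpr → ℝ
  | ofNat e => (e.eval s : ℝ)
  | read a i j k => s.real a (i.eval s) (j.eval s) (k.eval s)
  | add e₁ e₂ => e₁.eval s + e₂.eval s
  | sub e₁ e₂ => e₁.eval s - e₂.eval s
  | mul e₁ e₂ => e₁.eval s * e₂.eval s
  | div e₁ e₂ => e₁.eval s / e₂.eval s
  | exp e => Real.exp (e.eval s)

def Test.Holds (s : Memory) : Test → Prop
  | natLt e₁ e₂ => e₁.eval s < e₂.eval s
  | realLt e₁ e₂ => e₁.eval s < e₂.eval s
  | not t => ¬ t.Holds s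
  | and t₁ t₂ => t₁.Holds s ∧ t₂.Holds s

/-- The law of a coin of bias `p` (clamped to `[0,1]`). -/
def coin (p : ℝ) : PMF Bool :=
  PMF.ofFintype (fun b => ENNReal.ofReal (if b then max 0 (min 1 p) else 1 - max 0 (min 1 p))) (by
    have h0 : 0 ≤ max 0 (min 1 p) := le_max_left _ _
    have h1 : max 0 (min 1 p) ≤ 1 := max_le zero_le_one (min_le_left _ _)
    rw [Fintype.sum_bool, ← ENNReal.ofReal_add (by simp) (by simp)]
    simp)

/-- A configuration: the list of programs still to be executed, and the memory. The machine has
halted when the list is empty. -/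
abbrev Config : Type := List Prog × Memory

open Classical in
/-- One step of the machine. -/
def step : Config → PMF Config
  | ([], s) => PMF.pure ([], s)
  | (.setNat a i j k e :: L, s) =>
      PMF.pure (L, s.writeNat a (i.eval s) (j.eval s) (k.eval s) (e.eval s))
  | (.setReal a i j k e :: L, s) =>
      PMF.pure (L, s.writeReal a (i.eval s) (j.eval s) (k.eval s) (e.eval s))
  | (.flip a i j k p :: L, s) =>
      (coin (p.eval s)).map fun b =>
        (L, s.writeNat a (i.eval s) (j.eval s) (k.eval s) (if b then 1 else 0))
  | (.seq P Q :: L, s) => PMF.pure (P :: Q :: L, s)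
  | (.ite t P Q :: L, s) => PMF.pure (if t.Holds s then (P :: L, s) else (Q :: L, s))
  | (.while t P :: L, s) => PMF.pure (if t.Holds s then (P :: .while t P :: L, s) else (L, s))

/-- The law of the configuration after `T` steps. -/
def runFor : ℕ → Config → PMF Config
  | 0, c => PMF.pure c
  | T + 1, c => (step c).bind (runFor T)

/-- Whatever the outcomes of the coins, `P` halts within `T` steps on the initial memory `s`. -/
def HaltsWithin (P : Prog) (s : Memory) (T : ℕ) : Prop :=
  ∀ c ∈ (runFor T ([P], s)).support, c.1 = []

end

end RealRAM

/-! ## The generalized assignment problem -/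

namespace GAP

/-- The public data of an instance with `n` bins and `m` items. -/
structure PublicData (n m : ℕ) : Type where
  weight : Fin n → Fin m → ℝ
  capacity : Fin n → ℝ
  weight_nonneg : ∀ i j, 0 ≤ weight i j
  capacity_nonneg : ∀ i, 0 ≤ capacity i

/-- Reported values: `v i j` is the value of bin `i` for item `j`. -/
abbrev Values (n m : ℕ) : Type := Fin n → Fin m → ℝ

/-- An allocation: `S i` is the set of items given to bin `i`. -/
abbrev Alloc (n m : ℕ) : Type := Fin n → Finset (Fin m)

noncomputable section

variable {n m : ℕ}

namespace PublicData

variable (G : PublicData n m)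

/-- `S` fits into bin `i`. -/
def Fits (i : Fin n) (S : Finset (Fin m)) : Prop := ∑ j ∈ S, G.weight i j ≤ G.capacity i

/-- Feasible allocations: every set fits into its bin, and the sets are mutually disjoint. -/
def Feasible (S : Alloc n m) : Prop :=
  (∀ i, G.Fits i (S i)) ∧ ∀ i k, i ≠ k → Disjoint (S i) (S k)

open Classical in
/-- The valuation `g_i` of bin `i`. -/
def binValue (v : Values n m) (i : Fin n) (S : Finset (Fin m)) : ℝ :=
  if G.Fits i S then ∑ j ∈ S, v i j else 0

/-- Social welfare. -/
def welfare (v : Values n m) (S : Alloc n m) : ℝ := ∑ i, G.binValue v i (S i)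

/-- Expected social welfare of a random allocation. -/
def expWelfare (v : Values n m) (D : PMF (Alloc n m)) : ℝ := ∑ S, (D S).toReal * G.welfare v S

/-- `A` is a `(1 - ε)`-maximal-in-distributional-range rule with distributional range `R`. The range
is a set of laws of feasible allocations that does not depend on the reported values. -/
def IsApproxMIDR (ε : ℝ) (R : Set (PMF (Alloc n m))) (A : Values n m → PMF (Alloc n m)) : Prop :=
  (∀ D ∈ R, ∀ S ∈ D.support, G.Feasible S) ∧
  ∀ v : Values n m, 0 ≤ v → A v ∈ R ∧ ∀ D ∈ R, (1 - ε) * G.expWelfare v D ≤ G.expWelfare v (A v)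

/-! ### The configuration polytope and greedy rounding -/

/-- The relaxed feasible set: one randomized feasible set for each bin. -/
def polytope : Set (Fin n → Finset (Fin m) → ℝ) :=
  {x | (∀ i S, 0 ≤ x i S) ∧ (∀ i S, ¬ G.Fits i S → x i S = 0) ∧ ∀ i, ∑ S, x i S ≤ 1}

end PublicData

/-- `φ(x)`: the fractional amount of item `j` that `x` gives to bin `i`. -/
def marginal (x : Fin n → Finset (Fin m) → ℝ) : Fin n → Fin m → ℝ :=
  fun i j => ∑ S with j ∈ S, x i S

/-- `x'` has the marginals `1 - exp (-y i j)`, where `y` are those of `x`. -/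
def IsDamping (x x' : Fin n → Finset (Fin m) → ℝ) : Prop :=
  ∀ i j, marginal x' i j = 1 - Real.exp (-marginal x i j)

namespace PublicData

variable (G : PublicData n m)

/-- The law of the set drawn by bin `i`: the set `S` with probability `x i S`, and the empty set
with the remaining probability. -/
def binLaw (x : G.polytope) (i : Fin n) : PMF (Finset (Fin m)) :=
  PMF.ofFintype
    (fun S => ENNReal.ofReal (if S = ∅ then 1 - ∑ T with T ≠ ∅, x.1 i T else x.1 i S)) (by
    obtain ⟨x, h0, -, h1⟩ := x
    have hle : ∑ T with T ≠ ∅, x i T ≤ 1 :=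
      (Finset.sum_le_univ_sum_of_nonneg (h0 i)).trans (h1 i)
    rw [← ENNReal.ofReal_sum_of_nonneg, ENNReal.ofReal_eq_one]
    · rw [Finset.sum_ite]
      simp [Finset.filter_eq']
    · intro S _
      split_ifs
      · linarith
      · exact h0 i S)

/-- The joint law of independently drawn sets. -/
def jointLaw (x : G.polytope) : PMF (Alloc n m) :=
  PMF.ofFintype (fun T => ∏ i, G.binLaw x i (T i)) (by
    rw [← Fintype.piFinset_univ, Finset.sum_prod_piFinset]
    refine Finset.prod_eq_one fun i _ => ?_
    rw [← tsum_fintype (L := .unconditional _)]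
    exact (G.binLaw x i).tsum_coe)

end PublicData

/-- Conflict resolution: each item goes to the bin that comes first in the order `π j`, among the
bins whose set contains it. Here `π j` maps positions to bins. -/
def resolve (π : Fin m → Equiv.Perm (Fin n)) (T : Alloc n m) : Alloc n m :=
  fun i => {j ∈ T i | ∀ k, j ∈ T k → (π j).symm i ≤ (π j).symm k}

/-- The order `π j` sorts the bins by non-increasing value for item `j`, for every item `j`. -/
def IsGreedyOrder (v : Values n m) (π : Fin m → Equiv.Perm (Fin n)) : Prop :=
  ∀ j, Antitone fun k => v (π j k) j

/-- The sorting permutations `σ_j`. -/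
def greedyOrder (v : Values n m) (j : Fin m) : Equiv.Perm (Fin n) := Tuple.sort fun i => -v i j

theorem isGreedyOrder_greedyOrder (v : Values n m) : IsGreedyOrder v (greedyOrder v) := by
  intro j a b hab
  have h := Tuple.monotone_sort (fun i => -v i j) hab
  simpa [greedyOrder] using h

namespace PublicData

variable (G : PublicData n m)

/-- Draw the sets independently for all bins, and resolve conflicts by the orders `π j`. -/
def roundLaw (x' : G.polytope) (π : Fin m → Equiv.Perm (Fin n)) : PMF (Alloc n m) :=
  (G.jointLaw x').map (resolve π)

/-- `D` is the law of the rounding of `x` with the orders `π`. -/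
def IsRounding (x : Fin n → Finset (Fin m) → ℝ) (π : Fin m → Equiv.Perm (Fin n))
    (D : PMF (Alloc n m)) : Prop :=
  ∃ x' : G.polytope, IsDamping x x'.1 ∧ D = G.roundLaw x' π

/-- The distributional range: all roundings of all points of the polytope, with arbitrary orders. -/
def roundingRange : Set (PMF (Alloc n m)) :=
  {D | ∃ x ∈ G.polytope, ∃ π, G.IsRounding x π D}

end PublicData

/-- The `k`-th largest value for item `j`, and `0` when there is no bin left. -/
def sortedValue (v : Values n m) (j : Fin m) (k : ℕ) : ℝ :=
  if h : k < n then v (greedyOrder v j ⟨k, h⟩) j else 0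

/-- The objective function `F`. -/
def objective (v : Values n m) (y : Fin n → Fin m → ℝ) : ℝ :=
  ∑ j, ∑ i : Fin n, (sortedValue v j i - sortedValue v j (i + 1)) *
    (1 - Real.exp (-∑ k ∈ Finset.Iic i, y (greedyOrder v j k) j))

/-- The gradient of the objective function. -/
def gradient (v : Values n m) (y : Fin n → Fin m → ℝ) : Fin n → Fin m → ℝ :=
  fun i j => fderiv ℝ (objective v) y (Pi.single i (Pi.single j 1))

/-! ### Fractional local search

The state is the multiset `Z` of the stored vectors. A stored vector assigns a set that fits to each
bin, so it is an element of `Alloc n m` (in general not a feasible allocation). -/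

/-- The scalar product of (the indicator vector of) `z` with `u`. -/
def dot (z : Alloc n m) (u : Fin n → Fin m → ℝ) : ℝ := ∑ i, ∑ j ∈ z i, u i j

/-- The capacity `1/δ` of the store, for the accuracy `η`. -/
def storeSize (n m : ℕ) (η : ℝ) : ℕ := ⌈6 * m * n ^ 2 / η⌉₊

/-- The point `x` represented by the store: each stored vector has weight `δ`. -/
def storePoint (η : ℝ) (Z : Multiset (Alloc n m)) : Fin n → Finset (Fin m) → ℝ :=
  fun i S => (1 / storeSize n m η) * (Z.countP fun z => z i = S)

namespace PublicData

variable (G : PublicData n m)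

/-- Bin by bin, `z` is a possible answer of a knapsack approximation scheme for the values `u` with
accuracy `η`. -/
def IsKnapsackApprox (η : ℝ) (u : Fin n → Fin m → ℝ) (z : Alloc n m) : Prop :=
  ∀ i, G.Fits i (z i) ∧ ∀ S, G.Fits i S → (1 - η) * ∑ j ∈ S, u i j ≤ ∑ j ∈ z i, u i j

/-- The largest value of a single item for a bin. -/
def maxValue (v : Values n m) : ℝ := ⨆ p : Fin n × Fin m, G.binValue v p.1 {p.2}

/-- The test `(z - y) ⬝ ∇F(y) > η M`, at the point `y` represented by the store `Z`. -/
def Improves (η : ℝ) (v : Values n m) (Z : Multiset (Alloc n m)) (z : Alloc n m) : Prop :=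
  η * G.maxValue v <
    dot z (gradient v (marginal (storePoint η Z))) -
      ∑ i, ∑ j, marginal (storePoint η Z) i j * gradient v (marginal (storePoint η Z)) i j

/-- One iteration of the local search: an improving vector `z`, found by the knapsack approximation
for the current gradient, is stored; if the store is full, it replaces a stored vector of least
value with respect to the current gradient. -/
def SearchStep (η : ℝ) (v : Values n m) (Z Z' : Multiset (Alloc n m)) : Prop :=
  ∃ z, G.IsKnapsackApprox η (gradient v (marginal (storePoint η Z))) z ∧ G.Improves η v Z z ∧
    ((Z.card < storeSize n m η ∧ Z' = z ::ₘ Z) ∨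
      (Z.card = storeSize n m η ∧ ∃ zmin ∈ Z,
        (∀ z' ∈ Z, dot zmin (gradient v (marginal (storePoint η Z))) ≤
          dot z' (gradient v (marginal (storePoint η Z)))) ∧
        Z' = z ::ₘ Z.erase zmin))

/-- `SearchRun η v t Z`: some run of the local search, started with the empty store, has the store
`Z` after `t` iterations. -/
inductive SearchRun (η : ℝ) (v : Values n m) : ℕ → Multiset (Alloc n m) → Prop
  | start : SearchRun η v 0 0
  | next {t : ℕ} {Z Z' : Multiset (Alloc n m)} :
      SearchRun η v t Z → G.SearchStep η v Z Z' → SearchRun η v (t + 1) Z'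

/-- The local search may stop with the store `Z`: the vector found by the knapsack approximation is
not improving. -/
def SearchStops (η : ℝ) (v : Values n m) (Z : Multiset (Alloc n m)) : Prop :=
  ∃ z, G.IsKnapsackApprox η (gradient v (marginal (storePoint η Z))) z ∧ ¬ G.Improves η v Z z

/-! ### Allocation rules computed by programs -/

/-- The initial memory: `n` and `m` in the natural-number cells `0` and `1`; `ε`, the weights, the
capacities and the values in the real arrays `0`, `1`, `2` and `3`. All other cells are `0`. -/
def input (ε : ℝ) (v : Values n m) : RealRAM.Memory where
  nat := fun a i j k =>
    if i = 0 ∧ j = 0 ∧ k = 0 then (if a = 0 then n else if a = 1 then m else 0) else 0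
  real := fun a i j k =>
    if a = 0 then (if i = 0 ∧ j = 0 ∧ k = 0 then ε else 0)
    else if a = 1 then
      (if h : (i < n ∧ j < m) ∧ k = 0 then G.weight ⟨i, h.1.1⟩ ⟨j, h.1.2⟩ else 0)
    else if a = 2 then (if h : i < n ∧ j = 0 ∧ k = 0 then G.capacity ⟨i, h.1⟩ else 0)
    else if a = 3 then (if h : (i < n ∧ j < m) ∧ k = 0 then v ⟨i, h.1.1⟩ ⟨j, h.1.2⟩ else 0)
    else 0

/-- The allocation described by a memory: bin `i` gets item `j` if the natural-number cell `2[i,j]`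
contains `1`. -/
def output (s : RealRAM.Memory) : Alloc n m := fun i => {j | s.nat 2 i j 0 = 1}

/-- The allocation rule computed by the program `P` in `T` steps, with the parameter `ε`. -/
def ruleOf (P : RealRAM.Prog) (T : ℕ) (ε : ℝ) (v : Values n m) : PMF (Alloc n m) :=
  (RealRAM.runFor T ([P], G.input ε v)).map fun c => output c.2

end PublicData

end

end GAP

open GAP

/-! The proof has a mathematical half and a program with a total-correctness proof.

**The objective.** For each item the objective `F` is a nonnegative combination of functions
`1 - exp (-s)` of partial sums of `y` along the greedy order, so it is concave, lies below its
tangents (`objective_le_tangent`), and differs from them by at most a quadratic error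
(`le_objective_add`). With independently drawn sets and inclusion probabilities `1 - exp (-y i j)`,
the term `exp (-s)` is the probability that none of the first bins has drawn the item; Abel
summation turns the expected value of the first successful bin into `F`
(`PublicData.expWelfare_eq_objective`). For every outcome of the draws greedy conflict resolution is
optimal, so any other rounding has expected welfare at most `F`
(`PublicData.expWelfare_le_objective`). Hence a `(1 - ε)`-approximate maximizer of `F`, rounded
greedily, is a `(1 - ε)`-MIDR rule. As `1 - exp (-1) = 1 - 1/e`, the value of `F` at an integral
feasible point is at least `1 - 1/e` times the welfare (`PublicData.welfare_le_objective`).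

**Local search.** The first-order gain of an improving step exceeds `δ η M`, and the capacity of the
store is chosen such that the quadratic error is at most a sixth of that
(`PublicData.searchStep_gain`). As `F ≤ m M`, the number of iterations is polynomial
(`PublicData.searchRun_le`). When the search stops, concavity bounds the distance to the optimum in
terms of `M`, and `M` itself is at most `8/5` times the optimum
(`PublicData.objective_le_of_searchStops`).

**Rounding.** The required damped point of the polytope is obtained by thinning: draw a set with the
marginals `y`, then keep each of its items with probability `(1 - exp (-y)) / y`
(`PublicData.isRounding_of_thinLaw`). This is also how the program draws its sets: a uniformly
random slot of the store comes from reservoir sampling with biased coins, and each item costs one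
more coin.

**The program.** The machine cannot round reals or sort. Ceilings and the rounded values of the
knapsack scheme are found by counting, and the gradient and the conflict resolution only need a test
whether one bin precedes another in the greedy order (`precedes_iff`, `gradient_eq_precedes`). The
knapsack scheme is the dynamic program over rounded values (`knapsack_approx`). The deterministic
parts are verified with the total-correctness assertions `RealRAM.Wp`, the randomized ones with
`RealRAM.Samples`, a coupling of the final memory with a sample of a given law. Step bounds are
written for an arbitrary semiring, so that the same expression is a number of steps and the
polynomial of the time bound. -/

namespace RealRAM

noncomputable section

/-! ### Program logic for the real-number machine -/

/-- From the configuration `c` the machine halts within `B` steps, and `μ` is the law of the final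
memory. -/
def Runs (c : Config) (B : ℕ) (μ : PMF Memory) : Prop :=
  ∀ t, B ≤ t → runFor t c = μ.map fun s => (([] : List Prog), s)

/-- Total correctness of a run without coin flips: from `s`, the program `P` takes at most `B` steps
to a memory that satisfies `Q`. -/
def Wp (P : Prog) (s : Memory) (B : ℕ) (Q : Memory → Prop) : Prop :=
  ∃ s', Q s' ∧ ∃ k ≤ B, ∀ L t, runFor (t + k) (P :: L, s) = runFor t (L, s')

/-- Total correctness of a randomized run: from `s`, the program `P` takes at most `B` steps, and
there is a coupling of the final memory with a sample `a` of the law `D` under which the two are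
related by `R`. The remaining program `L` is treated as a continuation. -/
def Samples {α : Type} (P : Prog) (s : Memory) (B : ℕ) (D : PMF α) (R : α → Memory → Prop) : Prop :=
  ∃ μ : PMF (α × Memory), μ.map Prod.fst = D ∧ (∀ p ∈ μ.support, R p.1 p.2) ∧
    ∀ L B' (ν : α × Memory → PMF Memory), (∀ p ∈ μ.support, Runs (L, p.2) B' (ν p)) →
      Runs (P :: L, s) (B + B') (μ.bind ν)

theorem _root_.PMF.bind_congr_support {α β : Type*} (p : PMF α) {f g : α → PMF β}
    (h : ∀ a ∈ p.support, f a = g a) : p.bind f = p.bind g := by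
  ext b
  simp only [PMF.bind_apply]
  refine tsum_congr fun a => ?_
  by_cases ha : a ∈ p.support
  · rw [h a ha]
  · rw [PMF.mem_support_iff, not_not] at ha
    simp [ha]

theorem Wp.mono {P : Prog} {s : Memory} {B B' : ℕ} {Q Q' : Memory → Prop} (h : Wp P s B Q)
    (hB : B ≤ B') (hQ : ∀ s', Q s' → Q' s') : Wp P s B' Q' := by
  obtain ⟨s', hs, k, hk, h⟩ := h
  exact ⟨s', hQ _ hs, k, hk.trans hB, h⟩

theorem Wp.imp {P : Prog} {s : Memory} {B : ℕ} {Q Q' : Memory → Prop} (h : Wp P s B Q)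
    (hQ : ∀ s', Q s' → Q' s') : Wp P s B Q' := h.mono le_rfl hQ

theorem runFor_succ (t : ℕ) (c : Config) : runFor (t + 1) c = (step c).bind (runFor t) := rfl

theorem Wp.setNat {a : ℕ} {i j k e : NExpr} {s : Memory} {Q : Memory → Prop}
    (h : Q (s.writeNat a (i.eval s) (j.eval s) (k.eval s) (e.eval s))) :
    Wp (.setNat a i j k e) s 1 Q :=
  ⟨_, h, 1, le_rfl, fun L t => by rw [runFor_succ, step, PMF.pure_bind]⟩

theorem Wp.setReal {a : ℕ} {i j k : NExpr} {e : RExpr} {s : Memory} {Q : Memory → Prop}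
    (h : Q (s.writeReal a (i.eval s) (j.eval s) (k.eval s) (e.eval s))) :
    Wp (.setReal a i j k e) s 1 Q :=
  ⟨_, h, 1, le_rfl, fun L t => by rw [runFor_succ, step, PMF.pure_bind]⟩

theorem Wp.seq {P P' : Prog} {s : Memory} {B B' : ℕ} {Q Q' : Memory → Prop} (h : Wp P s B Q)
    (h' : ∀ s', Q s' → Wp P' s' B' Q') : Wp (.seq P P') s (B + B' + 1) Q' := by
  obtain ⟨s₁, hs₁, k₁, hk₁, h₁⟩ := h
  obtain ⟨s₂, hs₂, k₂, hk₂, h₂⟩ := h' s₁ hs₁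
  refine ⟨s₂, hs₂, k₂ + k₁ + 1, by omega, fun L t => ?_⟩
  rw [← add_assoc, ← add_assoc, runFor_succ, step, PMF.pure_bind, h₁, h₂]

theorem Wp.ite {t : Test} {P P' : Prog} {s : Memory} {B : ℕ} {Q : Memory → Prop}
    (h : t.Holds s → Wp P s B Q) (h' : ¬ t.Holds s → Wp P' s B Q) :
    Wp (.ite t P P') s (B + 1) Q := by
  by_cases ht : t.Holds s
  · obtain ⟨s', hs, k, hk, h⟩ := h ht
    refine ⟨s', hs, k + 1, by omega, fun L n => ?_⟩
    rw [← add_assoc, runFor_succ, step, PMF.pure_bind, if_pos ht, h]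
  · obtain ⟨s', hs, k, hk, h⟩ := h' ht
    refine ⟨s', hs, k + 1, by omega, fun L n => ?_⟩
    rw [← add_assoc, runFor_succ, step, PMF.pure_bind, if_neg ht, h]

/-- A loop with an invariant that is indexed by the number of finished iterations. -/
theorem Wp.while {t : Test} {P : Prog} {B N : ℕ} {I : ℕ → Memory → Prop}
    (h : ∀ k s, I k s → t.Holds s → k < N ∧ Wp P s B (I (k + 1))) {s : Memory} (h0 : I 0 s) :
    Wp (.while t P) s (N * (B + 1) + 1) fun s' => ∃ k, I k s' ∧ ¬ t.Holds s' := by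
  suffices H : ∀ r k s, I k s → N ≤ k + r →
      Wp (.while t P) s (r * (B + 1) + 1) fun s' => ∃ k, I k s' ∧ ¬ t.Holds s' from
    H N 0 s h0 (by omega)
  intro r
  induction r with
  | zero =>
    intro k s hI hN
    have ht : ¬ t.Holds s := fun ht => by have := (h k s hI ht).1; omega
    refine ⟨s, ⟨k, hI, ht⟩, 1, by omega, fun L n => ?_⟩
    rw [runFor_succ, step, PMF.pure_bind, if_neg ht]
  | succ r ih =>
    intro k s hI hN
    by_cases ht : t.Holds s
    · obtain ⟨s₁, hs₁, k₁, hk₁, h₁⟩ := (h k s hI ht).2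
      obtain ⟨s₂, hs₂, k₂, hk₂, h₂⟩ := ih (k + 1) s₁ hs₁ (by omega)
      refine ⟨s₂, hs₂, k₂ + k₁ + 1, ?_, fun L n => ?_⟩
      · rw [add_mul]; omega
      · rw [← add_assoc, ← add_assoc, runFor_succ, step, PMF.pure_bind, if_pos ht, h₁, h₂]
    · refine ⟨s, ⟨k, hI, ht⟩, 1, by omega, fun L n => ?_⟩
      rw [runFor_succ, step, PMF.pure_bind, if_neg ht]

theorem Runs.step {c : Config} {B : ℕ} {μ : PMF Memory} {c' : Config} (h : Runs c' B μ)
    {k : ℕ} (hc : ∀ t, runFor (t + k) c = runFor t c') : Runs c (B + k) μ := by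
  intro t ht
  obtain ⟨t, rfl⟩ := Nat.exists_eq_add_of_le' (show k ≤ t by omega)
  rw [hc, h t (by omega)]

theorem Runs.mono {c : Config} {B B' : ℕ} {μ : PMF Memory} (h : Runs c B μ) (hB : B ≤ B') :
    Runs c B' μ := fun t ht => h t (hB.trans ht)

theorem Wp.samples {α : Type} {P : Prog} {s : Memory} {B : ℕ} {a : α} {R : α → Memory → Prop}
    (h : Wp P s B (R a)) : Samples P s B (PMF.pure a) R := by
  obtain ⟨s', hs, k, hk, h⟩ := h
  refine ⟨PMF.pure (a, s'), by simp [PMF.pure_map], by simpa using hs, fun L B' ν hν => ?_⟩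
  rw [PMF.pure_bind]
  refine (Runs.step (hν _ (by simp)) fun t => h L t).mono (by omega)

theorem Samples.mono {α : Type} {P : Prog} {s : Memory} {B B' : ℕ} {D : PMF α}
    {R R' : α → Memory → Prop} (h : Samples P s B D R) (hB : B ≤ B')
    (hR : ∀ a s, R a s → R' a s) : Samples P s B' D R' := by
  obtain ⟨μ, h1, h2, h3⟩ := h
  exact ⟨μ, h1, fun p hp => hR _ _ (h2 p hp), fun L B'' ν hν => (h3 L B'' ν hν).mono (by omega)⟩

theorem Samples.map {α β : Type} {P : Prog} {s : Memory} {B : ℕ} {D : PMF α} {f : α → β}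
    {R : β → Memory → Prop} (h : Samples P s B D fun a => R (f a)) : Samples P s B (D.map f) R := by
  obtain ⟨μ, h1, h2, h3⟩ := h
  refine ⟨μ.map fun p => (f p.1, p.2), ?_, ?_, fun L B' ν hν => ?_⟩
  · rw [← h1, PMF.map_comp, PMF.map_comp]; rfl
  · intro p hp
    rw [PMF.mem_support_map_iff] at hp
    obtain ⟨q, hq, rfl⟩ := hp
    exact h2 q hq
  · rw [PMF.bind_map]
    refine h3 L B' _ fun p hp => hν (f p.1, p.2) ?_
    rw [PMF.mem_support_map_iff]
    exact ⟨p, hp, rfl⟩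

theorem Samples.seq {α β : Type} {P P' : Prog} {s : Memory} {B B' : ℕ} {D : PMF α} {E : α → PMF β}
    {R : α → Memory → Prop} {R' : β → Memory → Prop} (h : Samples P s B D R)
    (h' : ∀ a s', R a s' → Samples P' s' B' (E a) R') :
    Samples (.seq P P') s (B + B' + 1) (D.bind E) R' := by
  obtain ⟨μ, h1, h2, h3⟩ := h
  have h4 : ∀ p : α × Memory, p ∈ μ.support → ∃ μ' : PMF (β × Memory),
      μ'.map Prod.fst = E p.1 ∧ (∀ q ∈ μ'.support, R' q.1 q.2) ∧
      ∀ L B'' (ν : β × Memory → PMF Memory), (∀ q ∈ μ'.support, Runs (L, q.2) B'' (ν q)) →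
        Runs (P' :: L, p.2) (B' + B'') (μ'.bind ν) := fun p hp => h' p.1 p.2 (h2 p hp)
  obtain ⟨p₀, hp₀⟩ := μ.support_nonempty
  have : Nonempty (PMF (β × Memory)) := ⟨(h4 p₀ hp₀).choose⟩
  choose! μ' g1 g2 g3 using h4
  refine ⟨μ.bind μ', ?_, ?_, fun L B'' ν hν => ?_⟩
  · rw [PMF.map_bind, PMF.bind_congr_support μ g1, ← h1, PMF.bind_map]
    rfl
  · intro q hq
    rw [PMF.mem_support_bind_iff] at hq
    obtain ⟨p, hp, hq⟩ := hq
    exact g2 p hp q hq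
  · rw [PMF.bind_bind]
    have := h3 (P' :: L) (B' + B'') (fun p => (μ' p).bind ν) fun p hp =>
      g3 p hp L B'' ν fun q hq => hν q ((PMF.mem_support_bind_iff _ _ _).2 ⟨p, hp, hq⟩)
    refine (Runs.step this (k := 1) fun t => ?_).mono (by omega)
    rw [runFor_succ, RealRAM.step, PMF.pure_bind]

theorem Wp.seq_samples {α : Type} {P P' : Prog} {s : Memory} {B B' : ℕ} {D : PMF α}
    {Q : Memory → Prop} {R : α → Memory → Prop} (h : Wp P s B Q)
    (h' : ∀ s', Q s' → Samples P' s' B' D R) : Samples (.seq P P') s (B + B' + 1) D R := by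
  have := Samples.seq (α := Unit) (E := fun _ => D) (h.samples (a := ()) (R := fun _ => Q))
    fun _ s' hs => h' s' hs
  rwa [PMF.pure_bind] at this

theorem Samples.flip {a : ℕ} {i j k : NExpr} {p : RExpr} {s : Memory} {R : Bool → Memory → Prop}
    (h : ∀ b, R b (s.writeNat a (i.eval s) (j.eval s) (k.eval s) (if b then 1 else 0))) :
    Samples (.flip a i j k p) s 1 (coin (p.eval s)) R := by
  let f : Bool → Bool × Memory := fun b =>
    (b, s.writeNat a (i.eval s) (j.eval s) (k.eval s) (if b then 1 else 0))
  refine ⟨(coin (p.eval s)).map f, ?_, ?_, fun L B' ν hν => ?_⟩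
  · rw [PMF.map_comp]; exact PMF.map_id _
  · intro q hq
    rw [PMF.mem_support_map_iff] at hq
    obtain ⟨b, -, rfl⟩ := hq
    exact h b
  · intro t ht
    obtain ⟨t, rfl⟩ := Nat.exists_eq_add_of_le' (show 1 ≤ t by omega)
    rw [runFor_succ, RealRAM.step, PMF.bind_map, PMF.bind_map, PMF.map_bind]
    refine PMF.bind_congr_support _ fun b hb => ?_
    exact hν (f b) (by rw [PMF.mem_support_map_iff]; exact ⟨b, hb, rfl⟩) t (by omega)

/-- A complete run, seen through a function of the final memory. -/
theorem Samples.runFor_map {α β : Type} {P : Prog} {s : Memory} {B : ℕ} {D : PMF α}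
    {g : Memory → β} {f : α → β} (h : Samples P s B D fun a s' => g s' = f a) {T : ℕ} (hT : B ≤ T) :
    HaltsWithin P s T ∧ (runFor T ([P], s)).map (fun c => g c.2) = D.map f := by
  obtain ⟨μ, h1, h2, h3⟩ := h
  have h4 : Runs ([P], s) B (μ.bind fun p => PMF.pure p.2) := by
    refine h3 [] 0 _ fun p _ t _ => ?_
    rw [PMF.pure_map]
    clear * -
    induction t with
    | zero => rfl
    | succ t ih => rw [runFor_succ, RealRAM.step, PMF.pure_bind]; exact ih
  have h5 := h4 T hT
  constructor
  · intro c hc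
    rw [h5, PMF.mem_support_map_iff] at hc
    obtain ⟨s', -, rfl⟩ := hc
    rfl
  · rw [h5, PMF.map_comp, ← h1, PMF.map_comp, PMF.map_bind]
    rw [← PMF.bind_pure_comp (f ∘ Prod.fst)]
    refine PMF.bind_congr_support _ fun p hp => ?_
    rw [PMF.pure_map]
    simp [h2 p hp]

/-! ### Frames and counting loops -/

/-- `s'` arises from `s` by changing only the natural-number arrays in `An` and the real arrays in
`Ar`. -/
def Frame (s s' : Memory) (An Ar : List ℕ) : Prop :=
  (∀ a ∉ An, s'.nat a = s.nat a) ∧ ∀ a ∉ Ar, s'.real a = s.real a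

theorem Frame.refl (s : Memory) (An Ar : List ℕ) : Frame s s An Ar :=
  ⟨fun _ _ => rfl, fun _ _ => rfl⟩

theorem Frame.mono {s s' : Memory} {An Ar Bn Br : List ℕ} (h : Frame s s' An Ar)
    (hn : ∀ a ∈ An, a ∈ Bn) (hr : ∀ a ∈ Ar, a ∈ Br) : Frame s s' Bn Br :=
  ⟨fun a ha => h.1 a fun h' => ha (hn a h'), fun a ha => h.2 a fun h' => ha (hr a h')⟩

theorem Frame.trans {s s₁ s₂ : Memory} {An Ar : List ℕ} (h : Frame s s₁ An Ar)
    (h' : Frame s₁ s₂ An Ar) : Frame s s₂ An Ar :=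
  ⟨fun a ha => (h'.1 a ha).trans (h.1 a ha), fun a ha => (h'.2 a ha).trans (h.2 a ha)⟩

theorem Frame.writeNat (s : Memory) {a : ℕ} (i j k x : ℕ) {An Ar : List ℕ} (ha : a ∈ An) :
    Frame s (s.writeNat a i j k x) An Ar := by
  refine ⟨fun b hb => ?_, fun b _ => rfl⟩
  funext i' j' k'
  have : b ≠ a := fun h => hb (h ▸ ha)
  simp [Memory.writeNat, this]

theorem Frame.writeReal (s : Memory) {a : ℕ} (i j k : ℕ) (x : ℝ) {An Ar : List ℕ} (ha : a ∈ Ar) :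
    Frame s (s.writeReal a i j k x) An Ar := by
  refine ⟨fun b _ => rfl, fun b hb => ?_⟩
  funext i' j' k'
  have : b ≠ a := fun h => hb (h ▸ ha)
  simp [Memory.writeReal, this]

/-- The scalar cell `a` of the natural-number memory. -/
def nvar (a : ℕ) : NExpr := .read a (.const 0) (.const 0) (.const 0)

/-- The scalar cell `a` of the real memory. -/
def rvar (a : ℕ) : RExpr := .read a (.const 0) (.const 0) (.const 0)

/-- Assignment to a scalar cell of the natural-number memory. -/
def letNat (a : ℕ) (e : NExpr) : Prog := .setNat a (.const 0) (.const 0) (.const 0) e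

/-- Assignment to a scalar cell of the real memory. -/
def letReal (a : ℕ) (e : RExpr) : Prog := .setReal a (.const 0) (.const 0) (.const 0) e

@[simp] theorem eval_nvar (s : Memory) (a : ℕ) : (nvar a).eval s = s.nat a 0 0 0 := rfl
@[simp] theorem eval_rvar (s : Memory) (a : ℕ) : (rvar a).eval s = s.real a 0 0 0 := rfl

attribute [simp] NExpr.eval RExpr.eval Test.Holds Memory.writeNat Memory.writeReal

/-- `for c = 0, …, b - 1 do P`, where `c` and `b` are scalar cells. -/
def forLoop (c b : ℕ) (P : Prog) : Prog :=
  .seq (letNat c (.const 0))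
    (.while (.natLt (nvar c) (nvar b)) (.seq P (letNat c (.add (nvar c) (.const 1)))))

/-- A bound for the number of steps of a loop with at most `L` iterations of cost `B`. -/
def loopCost {R : Type*} [Semiring R] (L B : R) : R := L * (B + 1 + 1 + 1) + 3

theorem Wp.forLoop {c b : ℕ} {P : Prog} {s₀ : Memory} {B L N : ℕ} {An Ar : List ℕ}
    (J : ℕ → Memory → Prop) (hN : s₀.nat b 0 0 0 = N) (hL : N ≤ L) (hcA : c ∉ An)
    (hbA : b ∉ c :: An)
    (h0 : J 0 s₀) (hJ : ∀ k s x, J k s → J k (s.writeNat c 0 0 0 x))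
    (hP : ∀ k s, k < N → Frame s₀ s (c :: An) Ar → s.nat c 0 0 0 = k → J k s →
      Wp P s B fun s' => Frame s s' An Ar ∧ J (k + 1) s') :
    Wp (forLoop c b P) s₀ (loopCost L B) fun s' => Frame s₀ s' (c :: An) Ar ∧ J N s' := by
  have hmono : 1 + (N * (B + 1 + 1 + 1) + 1) + 1 ≤ loopCost L B := by
    have := Nat.mul_le_mul_right (B + 1 + 1 + 1) hL
    unfold loopCost
    omega
  refine Wp.mono (Wp.seq (Q := fun s => s = s₀.writeNat c 0 0 0 0) (Wp.setNat rfl) ?_)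
    hmono fun _ h => h
  rintro _ rfl
  have := Wp.while (t := .natLt (nvar c) (nvar b))
    (P := .seq P (letNat c (.add (nvar c) (.const 1)))) (B := B + 1 + 1) (N := N)
    (I := fun k s => k ≤ N ∧ Frame s₀ s (c :: An) Ar ∧ s.nat c 0 0 0 = k ∧ J k s) ?_
    (s := s₀.writeNat c 0 0 0 0) ?_
  · refine this.imp ?_
    rintro s' ⟨k, ⟨hk, hf, hc, hj⟩, ht⟩
    have hb : s'.nat b = s₀.nat b := hf.1 b hbA
    simp only [Test.Holds, eval_nvar, hc, hb, hN] at ht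
    obtain rfl : k = N := by omega
    exact ⟨hf, hj⟩
  · rintro k s ⟨hk, hf, hc, hj⟩ ht
    have hb : s.nat b = s₀.nat b := hf.1 b hbA
    simp only [Test.Holds, eval_nvar, hc, hb, hN] at ht
    refine ⟨ht, Wp.seq (hP k s ht hf hc hj) ?_⟩
    rintro s' ⟨hf', hj'⟩
    refine Wp.setNat ⟨ht, ?_, ?_, ?_⟩
    · exact hf.trans ((hf'.mono (fun a ha => by simp [ha]) fun a ha => ha).trans
        (Frame.writeNat _ _ _ _ _ (by simp)))
    · have : s'.nat c = s.nat c := hf'.1 c hcA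
      simp [this, hc]
    · exact hJ _ _ _ hj'
  · exact ⟨Nat.zero_le _, Frame.writeNat _ _ _ _ _ (by simp), by simp, hJ _ _ _ h0⟩

/-- Programs that agree after the first step draw the same samples. -/
theorem Samples.of_runFor_eq {α : Type} {P P' : Prog} {s : Memory} {B : ℕ} {D : PMF α}
    {R : α → Memory → Prop} (h : Samples P' s B D R) (hB : 1 ≤ B)
    (hP : ∀ L t, runFor (t + 1) (P :: L, s) = runFor (t + 1) (P' :: L, s)) : Samples P s B D R := by
  obtain ⟨μ, h1, h2, h3⟩ := h
  refine ⟨μ, h1, h2, fun L B' ν hν t ht => ?_⟩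
  obtain ⟨t, rfl⟩ := Nat.exists_eq_add_of_le' (show 1 ≤ t by omega)
  rw [hP, h3 L B' ν hν _ ht]

/-- Unfold a loop whose test succeeds. Entering the body of a `while` and starting a `seq` both take
one step, so the two programs reach the same configuration at the same time. -/
theorem Samples.while_true {α : Type} {t : Test} {P : Prog} {s : Memory} {B : ℕ} {D : PMF α}
    {R : α → Memory → Prop} (ht : t.Holds s) (hB : 1 ≤ B)
    (h : Samples (.seq P (.while t P)) s B D R) : Samples (.while t P) s B D R :=
  h.of_runFor_eq hB fun L n => by
    rw [runFor_succ, runFor_succ, RealRAM.step, RealRAM.step, if_pos ht]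

/-- A counting loop whose body draws a sample that depends on the samples so far. -/
theorem Samples.forLoop {α : Type} {c b : ℕ} {P : Prog} {s₀ : Memory} {B L N : ℕ} {An Ar : List ℕ}
    (J : ℕ → α → Memory → Prop) (D : ℕ → PMF α) (E : ℕ → α → PMF α) (a₀ : α)
    (hD0 : D 0 = PMF.pure a₀) (hDs : ∀ k < N, D (k + 1) = (D k).bind (E k))
    (hN : s₀.nat b 0 0 0 = N) (hL : N ≤ L) (hcA : c ∉ An) (hbA : b ∉ c :: An)
    (h0 : J 0 a₀ s₀) (hJ : ∀ k a s x, J k a s → J k a (s.writeNat c 0 0 0 x))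
    (hP : ∀ k a s, k < N → Frame s₀ s (c :: An) Ar → s.nat c 0 0 0 = k → J k a s →
      Samples P s B (E k a) fun a' s' => Frame s s' An Ar ∧ J (k + 1) a' s') :
    Samples (forLoop c b P) s₀ (loopCost L B) (D N)
      fun a s' => Frame s₀ s' (c :: An) Ar ∧ J N a s' := by
  -- `G r a` is the law of the final sample when `r` iterations are left and `a` was drawn so far.
  let G : ℕ → α → PMF α := fun r =>
    Nat.rec PMF.pure (fun r g a => (E (N - (r + 1)) a).bind g) r
  have hG0 : ∀ a, G 0 a = PMF.pure a := fun a => rfl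
  have hGs : ∀ r a, G (r + 1) a = (E (N - (r + 1)) a).bind (G r) := fun r a => rfl
  have hG : ∀ r ≤ N, (D (N - r)).bind (G r) = D N := by
    intro r
    induction r with
    | zero => intro _; exact PMF.bind_pure _
    | succ r ih =>
      intro hr
      have h1 : N - r = N - (r + 1) + 1 := by omega
      rw [← ih (by omega), h1, hDs _ (by omega), PMF.bind_bind]
  have hDN : D N = G N a₀ := by
    rw [← hG N le_rfl, Nat.sub_self, hD0, PMF.pure_bind]
  have hmono : 1 + (N * (B + 1 + 1 + 1) + 1) + 1 ≤ loopCost L B := by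
    have := Nat.mul_le_mul_right (B + 1 + 1 + 1) hL
    unfold loopCost
    omega
  set W : Prog := .while (.natLt (nvar c) (nvar b)) (.seq P (letNat c (.add (nvar c) (.const 1))))
    with hW
  have key : ∀ r ≤ N, ∀ a s, Frame s₀ s (c :: An) Ar → s.nat c 0 0 0 = N - r → J (N - r) a s →
      Samples W s (r * (B + 1 + 1 + 1) + 1) (G r a)
        fun a s' => Frame s₀ s' (c :: An) Ar ∧ J N a s' := by
    intro r
    induction r with
    | zero =>
      intro _ a s hf hc hj
      have hb : s.nat b = s₀.nat b := hf.1 b hbA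
      rw [zero_mul, zero_add, hG0]
      refine Wp.samples ⟨s, ⟨hf, hj⟩, 1, le_rfl, fun L n => ?_⟩
      rw [runFor_succ, step, PMF.pure_bind, if_neg]
      simp [hc, hb, hN]
    | succ r ih =>
      intro hr a s hf hc hj
      have hb : s.nat b = s₀.nat b := hf.1 b hbA
      have ht : (Test.natLt (nvar c) (nvar b)).Holds s := by
        simp only [Test.Holds, eval_nvar, hc, hb, hN]; omega
      rw [hGs]
      refine Samples.while_true ht (by omega) ?_
      have h1 : Samples (.seq P (letNat c (.add (nvar c) (.const 1)))) s (B + 1 + 1)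
          ((E (N - (r + 1)) a).bind PMF.pure) fun a' s' => Frame s₀ s' (c :: An) Ar ∧
            s'.nat c 0 0 0 = N - r ∧ J (N - r) a' s' := by
        refine Samples.seq (hP _ a s (by omega) hf hc hj) ?_
        rintro a' s' ⟨hf', hj'⟩
        have h2 : N - (r + 1) + 1 = N - r := by omega
        rw [h2] at hj'
        refine Wp.samples (Wp.setNat ⟨?_, ?_, hJ _ _ _ _ hj'⟩)
        · exact hf.trans ((hf'.mono (fun a ha => by simp [ha]) fun a ha => ha).trans
            (Frame.writeNat _ _ _ _ _ (by simp)))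
        · have : s'.nat c = s.nat c := hf'.1 c hcA
          simp [this, hc, h2]
      rw [PMF.bind_pure] at h1
      refine (Samples.seq h1 ?_).mono (B := B + 1 + 1 + (r * (B + 1 + 1 + 1) + 1) + 1) ?_
        fun _ _ h => h
      · rintro a' s' ⟨hf', hc', hj'⟩
        exact ih (by omega) a' s' hf' hc' hj'
      · rw [add_mul]; omega
  rw [hDN]
  refine (Wp.seq_samples (Q := fun s => s = s₀.writeNat c 0 0 0 0) (Wp.setNat rfl) ?_).mono hmono
    fun _ _ h => h
  rintro _ rfl
  refine key N le_rfl a₀ _ (Frame.writeNat _ _ _ _ _ (by simp)) (by simp) ?_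
  rw [Nat.sub_self]
  exact hJ _ _ _ _ h0

end

end RealRAM

namespace GAP

noncomputable section

variable {n m : ℕ}

/-! ### The objective function -/

/-- The coefficient of the `k`-th summand of the objective for item `j`: the drop from the `k`-th
largest value to the next one. -/
def drop (v : Values n m) (j : Fin m) (k : ℕ) : ℝ := sortedValue v j k - sortedValue v j (k + 1)

/-- The total amount of item `j` in the bins at the positions `0, …, k` of the greedy order. -/
def cumul (v : Values n m) (y : Fin n → Fin m → ℝ) (j : Fin m) (k : Fin n) : ℝ :=
  ∑ l ∈ Finset.Iic k, y (greedyOrder v j l) j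

theorem objective_eq (v : Values n m) (y : Fin n → Fin m → ℝ) :
    objective v y = ∑ j, ∑ k : Fin n, drop v j k * (1 - Real.exp (-cumul v y j k)) := rfl

theorem sortedValue_fin (v : Values n m) (j : Fin m) (k : Fin n) :
    sortedValue v j k = v (greedyOrder v j k) j := by
  simp [sortedValue]

theorem sortedValue_of_le (v : Values n m) (j : Fin m) {k : ℕ} (hk : n ≤ k) :
    sortedValue v j k = 0 := by
  simp [sortedValue, hk]

theorem sortedValue_nonneg {v : Values n m} (hv : 0 ≤ v) (j : Fin m) (k : ℕ) :
    0 ≤ sortedValue v j k := by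
  unfold sortedValue
  split_ifs
  · exact hv _ _
  · exact le_rfl

theorem drop_nonneg {v : Values n m} (hv : 0 ≤ v) (j : Fin m) (k : ℕ) : 0 ≤ drop v j k := by
  unfold drop
  by_cases h1 : k + 1 < n
  · have h := isGreedyOrder_greedyOrder v j (show (⟨k, by omega⟩ : Fin n) ≤ ⟨k + 1, h1⟩ by
      simp)
    simp only [sortedValue, h1, dif_pos, show k < n by omega]
    simpa using h
  · rw [sortedValue_of_le v j (show n ≤ k + 1 by omega), sub_zero]
    exact sortedValue_nonneg hv j k

theorem cumul_add (v : Values n m) (y d : Fin n → Fin m → ℝ) (j : Fin m) (k : Fin n) :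
    cumul v (y + d) j k = cumul v y j k + cumul v d j k := by
  simp [cumul, Finset.sum_add_distrib]

theorem cumul_sub (v : Values n m) (y d : Fin n → Fin m → ℝ) (j : Fin m) (k : Fin n) :
    cumul v (y - d) j k = cumul v y j k - cumul v d j k := by
  simp [cumul, Finset.sum_sub_distrib]

theorem cumul_smul (v : Values n m) (c : ℝ) (y : Fin n → Fin m → ℝ) (j : Fin m) (k : Fin n) :
    cumul v (c • y) j k = c * cumul v y j k := by
  simp [cumul, Finset.mul_sum]

theorem cumul_nonneg (v : Values n m) {y : Fin n → Fin m → ℝ} (hy : 0 ≤ y) (j : Fin m)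
    (k : Fin n) : 0 ≤ cumul v y j k := Finset.sum_nonneg fun _ _ => hy _ _

theorem cumul_single (v : Values n m) (i : Fin n) (j j' : Fin m) (k : Fin n) :
    cumul v (Pi.single i (Pi.single j 1)) j' k =
      if j' = j ∧ (greedyOrder v j).symm i ≤ k then 1 else 0 := by
  unfold cumul
  by_cases hj : j' = j
  · subst hj
    have : ∀ l, (Pi.single i (Pi.single j' 1) : Fin n → Fin m → ℝ) (greedyOrder v j' l) j' =
        if l = (greedyOrder v j').symm i then 1 else 0 := by
      intro l
      by_cases h : greedyOrder v j' l = i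
      · simp [← h]
      · rw [Pi.single_eq_of_ne h, if_neg]
        · rfl
        · rintro rfl; simp at h
    simp [this]
  · rw [if_neg (by tauto)]
    refine Finset.sum_eq_zero fun l _ => ?_
    by_cases h : greedyOrder v j' l = i
    · simp [h, hj]
    · simp [Pi.single_eq_of_ne h]

/-- The derivative of the objective at `y` in the direction `d`. -/
def slope (v : Values n m) (y d : Fin n → Fin m → ℝ) : ℝ :=
  ∑ j, ∑ k : Fin n, drop v j k * (Real.exp (-cumul v y j k) * cumul v d j k)

/-- `cumul` as a continuous linear map. -/
def cumulL (v : Values n m) (j : Fin m) (k : Fin n) : (Fin n → Fin m → ℝ) →L[ℝ] ℝ :=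
  LinearMap.toContinuousLinearMap
    { toFun := fun y => cumul v y j k
      map_add' := fun y d => cumul_add v y d j k
      map_smul' := fun c y => by simp [cumul_smul] }

theorem fderiv_objective (v : Values n m) (y d : Fin n → Fin m → ℝ) :
    fderiv ℝ (objective v) y d = slope v y d := by
  have h : HasFDerivAt (objective v) (∑ j, ∑ k : Fin n, drop v j k •
      (-(Real.exp (-cumul v y j k) • -cumulL v j k))) y := by
    refine HasFDerivAt.fun_sum fun j _ => HasFDerivAt.fun_sum fun k _ => ?_
    have h1 : HasFDerivAt (fun y => cumul v y j k) (cumulL v j k) y :=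
      (cumulL v j k).hasFDerivAt
    exact ((h1.neg.exp).const_sub 1).const_mul _
  rw [h.fderiv]
  simp only [slope, _root_.sum_apply, _root_.smul_apply, _root_.neg_apply, smul_eq_mul]
  refine Finset.sum_congr rfl fun j _ => Finset.sum_congr rfl fun k _ => ?_
  simp [cumulL]

theorem gradient_eq (v : Values n m) (y : Fin n → Fin m → ℝ) (i : Fin n) (j : Fin m) :
    gradient v y i j = ∑ k : Fin n,
      if (greedyOrder v j).symm i ≤ k then drop v j k * Real.exp (-cumul v y j k) else 0 := by
  rw [gradient, fderiv_objective, slope, Finset.sum_eq_single j]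
  · refine Finset.sum_congr rfl fun k _ => ?_
    simp [cumul_single]
  · intro j' _ hj
    simp [cumul_single, hj]
  · simp

theorem gradient_nonneg {v : Values n m} (hv : 0 ≤ v) (y : Fin n → Fin m → ℝ) (i : Fin n)
    (j : Fin m) : 0 ≤ gradient v y i j := by
  rw [gradient_eq]
  refine Finset.sum_nonneg fun k _ => ?_
  split_ifs
  · exact mul_nonneg (drop_nonneg hv _ _) (Real.exp_pos _).le
  · exact le_rfl

theorem sum_mul_gradient (v : Values n m) (y d : Fin n → Fin m → ℝ) :
    ∑ i, ∑ j, d i j * gradient v y i j = slope v y d := by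
  simp only [gradient, ← fderiv_objective]
  have hd : d = ∑ i, ∑ j, d i j • (Pi.single i (Pi.single j 1) : Fin n → Fin m → ℝ) := by
    ext i j
    simp only [Finset.sum_apply, Pi.smul_apply, smul_eq_mul]
    rw [Finset.sum_eq_single i, Finset.sum_eq_single j]
    · simp
    · intro j' _ hj'; simp [hj'.symm]
    · simp
    · intro i' _ hi'
      exact Finset.sum_eq_zero fun j' _ => by simp [Pi.single_eq_of_ne hi'.symm]
    · simp
  conv_rhs => rw [hd]
  simp [map_sum]

theorem slope_sub (v : Values n m) (y d d' : Fin n → Fin m → ℝ) :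
    slope v y (d - d') = slope v y d - slope v y d' := by
  simp only [← fderiv_objective, map_sub]

theorem slope_smul (v : Values n m) (y : Fin n → Fin m → ℝ) (c : ℝ) (d : Fin n → Fin m → ℝ) :
    slope v y (c • d) = c * slope v y d := by
  simp only [← fderiv_objective, map_smul, smul_eq_mul]

/-- The objective lies below its tangent planes. -/
theorem objective_le_tangent {v : Values n m} (hv : 0 ≤ v) (y y' : Fin n → Fin m → ℝ) :
    objective v y' ≤ objective v y + slope v y (y' - y) := by
  simp only [objective_eq, slope, ← Finset.sum_add_distrib]
  refine Finset.sum_le_sum fun j _ => Finset.sum_le_sum fun k _ => ?_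
  rw [← mul_add]
  refine mul_le_mul_of_nonneg_left ?_ (drop_nonneg hv _ _)
  rw [cumul_sub]
  set a := cumul v y j k
  set b := cumul v y' j k
  have h1 : Real.exp (-b) = Real.exp (-a) * Real.exp (a - b) := by
    rw [← Real.exp_add]; ring_nf
  have h2 := Real.add_one_le_exp (a - b)
  have h3 := mul_le_mul_of_nonneg_left h2 (Real.exp_pos (-a)).le
  rw [h1]
  linarith

theorem concaveOn_objective {v : Values n m} (hv : 0 ≤ v) :
    ConcaveOn ℝ Set.univ (objective v) := by
  refine ⟨convex_univ, fun y _ y' _ a b ha hb hab => ?_⟩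
  have h1 := mul_le_mul_of_nonneg_left (objective_le_tangent hv (a • y + b • y') y) ha
  have h2 := mul_le_mul_of_nonneg_left (objective_le_tangent hv (a • y + b • y') y') hb
  have h3 : a * slope v (a • y + b • y') (y - (a • y + b • y')) +
      b * slope v (a • y + b • y') (y' - (a • y + b • y')) = 0 := by
    rw [← slope_smul, ← slope_smul, ← fderiv_objective, ← fderiv_objective, ← map_add]
    have : a • (y - (a • y + b • y')) + b • (y' - (a • y + b • y')) = 0 := by
      obtain rfl : b = 1 - a := by linarith
      ext i j
      simp
      ring
    rw [this, map_zero]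
  have h4 : a * objective v (a • y + b • y') + b * objective v (a • y + b • y') =
      objective v (a • y + b • y') := by rw [← add_mul, hab, one_mul]
  simp only [smul_eq_mul]
  linarith

theorem objective_zero (v : Values n m) : objective v 0 = 0 := by
  simp [objective_eq, cumul]

theorem objective_nonneg {v : Values n m} (hv : 0 ≤ v) {y : Fin n → Fin m → ℝ} (hy : 0 ≤ y) :
    0 ≤ objective v y := by
  refine Finset.sum_nonneg fun j _ => Finset.sum_nonneg fun k _ =>
    mul_nonneg (drop_nonneg hv _ _) ?_
  rw [sub_nonneg, Real.exp_le_one_iff, neg_nonpos]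
  exact cumul_nonneg v hy j k

theorem slope_self_le {v : Values n m} (hv : 0 ≤ v) (y : Fin n → Fin m → ℝ) :
    slope v y y ≤ objective v y := by
  have h := objective_le_tangent hv y 0
  rw [objective_zero, slope_sub] at h
  have h0 : slope v y 0 = 0 := by rw [← fderiv_objective, map_zero]
  linarith

/-- The drops from position `k` on add up to the value at position `k`. -/
theorem sum_drop_ge (v : Values n m) (j : Fin m) (k : Fin n) :
    ∑ l : Fin n, (if k ≤ l then drop v j l else 0) = v (greedyOrder v j k) j := by
  have h : ∀ N : ℕ, k.1 ≤ N → ∑ l ∈ Finset.range N, (if k.1 ≤ l then drop v j l else 0) =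
      sortedValue v j k - sortedValue v j N := by
    intro N hN
    induction N, hN using Nat.le_induction with
    | base =>
      rw [sub_self]
      refine Finset.sum_eq_zero fun l hl => if_neg ?_
      simpa using hl
    | succ N hN ih => rw [Finset.sum_range_succ, ih, if_pos hN, drop]; ring
  have := h n k.2.le
  rw [sortedValue_of_le v j le_rfl, sub_zero, Finset.sum_range, sortedValue_fin] at this
  simpa only [← Fin.le_def] using this

namespace PublicData

variable (G : PublicData n m)

/-- The bin at some position up to `k` of the greedy order for item `j` has room for `j`. -/
def ReachesFit (v : Values n m) (j : Fin m) (k : ℕ) : Prop :=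
  ∃ l : Fin n, l.1 ≤ k ∧ G.Fits (greedyOrder v j l) {j}

theorem le_maxValue {v : Values n m} {i : Fin n} {j : Fin m} (h : G.Fits i {j}) :
    v i j ≤ G.maxValue v := by
  have h1 : G.binValue v i {j} = v i j := by simp [binValue, h]
  rw [← h1]
  exact le_ciSup (f := fun p : Fin n × Fin m => G.binValue v p.1 {p.2})
    (Set.finite_range _).bddAbove (i, j)

theorem binValue_nonneg {v : Values n m} (hv : 0 ≤ v) (i : Fin n) (S : Finset (Fin m)) :
    0 ≤ G.binValue v i S := by
  unfold binValue
  split_ifs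
  · exact Finset.sum_nonneg fun _ _ => hv _ _
  · exact le_rfl

theorem maxValue_nonneg {v : Values n m} (hv : 0 ≤ v) : 0 ≤ G.maxValue v :=
  Real.iSup_nonneg fun _ => G.binValue_nonneg hv _ _

open Classical in
/-- Only the drops behind the first bin with room for item `j` matter, and they add up to at most
the largest value of a single item. -/
theorem sum_drop_reachesFit_le {v : Values n m} (hv : 0 ≤ v) (j : Fin m) :
    ∑ k : Fin n, (if G.ReachesFit v j k then drop v j k else 0) ≤ G.maxValue v := by
  have h : ∀ N : ℕ, N ≤ n → ∑ k ∈ Finset.range N, (if G.ReachesFit v j k then drop v j k else 0) ≤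
      if ∃ l : Fin n, l.1 < N ∧ G.Fits (greedyOrder v j l) {j} then
        G.maxValue v - sortedValue v j N else 0 := by
    intro N
    induction N with
    | zero => simp
    | succ N ih =>
      intro hN
      have ih := ih (by omega)
      have h0 : (∃ l : Fin n, l.1 < N + 1 ∧ G.Fits (greedyOrder v j l) {j}) ↔
          G.ReachesFit v j N := by
        simp [ReachesFit]
      rw [Finset.sum_range_succ]
      simp only [h0]
      by_cases h1 : ∃ l : Fin n, l.1 < N ∧ G.Fits (greedyOrder v j l) {j}
      · have h2 : G.ReachesFit v j N := by
          obtain ⟨l, hl, hf⟩ := h1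
          exact ⟨l, hl.le, hf⟩
        rw [if_pos h1] at ih
        rw [if_pos h2, if_pos h2, drop]
        linarith
      · rw [if_neg h1] at ih
        by_cases h2 : G.ReachesFit v j N
        · obtain ⟨l, hl, hf⟩ := h2
          have hlN : l.1 = N := by
            by_contra hne
            exact h1 ⟨l, by omega, hf⟩
          have h3 := G.le_maxValue (v := v) hf
          rw [if_pos ⟨l, hl, hf⟩, if_pos ⟨l, hl, hf⟩, drop]
          rw [← hlN] at ih ⊢
          rw [sortedValue_fin]
          linarith
        · rw [if_neg h2, if_neg h2]
          linarith
  have := h n le_rfl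
  rw [sortedValue_of_le v j le_rfl, Finset.sum_range] at this
  refine this.trans ?_
  split_ifs
  · simp
  · exact G.maxValue_nonneg hv

/-- A vector whose entries vanish at the items that do not fit. -/
def Supported (d : Fin n → Fin m → ℝ) : Prop := ∀ i j, ¬ G.Fits i {j} → d i j = 0

theorem cumul_eq_zero {v : Values n m} {d : Fin n → Fin m → ℝ} (hd : G.Supported d) {j : Fin m}
    {k : Fin n} (h : ¬ G.ReachesFit v j k) : cumul v d j k = 0 :=
  Finset.sum_eq_zero fun l hl => hd _ _ fun hf => h ⟨l, by simpa using hl, hf⟩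

theorem objective_le {v : Values n m} (hv : 0 ≤ v) {y : Fin n → Fin m → ℝ}
    (hy : G.Supported y) : objective v y ≤ m * G.maxValue v := by
  classical
  have h : ∀ j : Fin m, ∑ k : Fin n, drop v j k * (1 - Real.exp (-cumul v y j k)) ≤
      G.maxValue v := by
    intro j
    refine le_trans (Finset.sum_le_sum fun k _ => ?_) (G.sum_drop_reachesFit_le hv j)
    split_ifs with hk
    · have := (Real.exp_pos (-cumul v y j k)).le
      exact mul_le_of_le_one_right (drop_nonneg hv _ _) (by linarith)
    · simp [G.cumul_eq_zero hy hk]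
  rw [objective_eq]
  refine (Finset.sum_le_sum fun j _ => h j).trans ?_
  simp

theorem gradient_le {v : Values n m} (hv : 0 ≤ v) {y : Fin n → Fin m → ℝ} (hy : 0 ≤ y)
    {i : Fin n} {j : Fin m} (h : G.Fits i {j}) : gradient v y i j ≤ G.maxValue v := by
  classical
  rw [gradient_eq]
  refine le_trans (Finset.sum_le_sum fun k _ => ?_) (G.sum_drop_reachesFit_le hv j)
  have h0 := drop_nonneg hv j k
  split_ifs with h1 h2 h2
  · refine mul_le_of_le_one_right h0 ?_
    rw [Real.exp_le_one_iff, neg_nonpos]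
    exact cumul_nonneg v hy j k
  · exact absurd ⟨_, h1, by simpa using h⟩ h2
  · exact h0
  · exact le_rfl

theorem abs_cumul_le (v : Values n m) {d : Fin n → Fin m → ℝ} (hd : ∀ i j, |d i j| ≤ 1)
    (j : Fin m) (k : Fin n) : |cumul v d j k| ≤ n := by
  refine (Finset.abs_sum_le_sum_abs _ _).trans ((Finset.sum_le_sum fun l _ => hd _ _).trans ?_)
  rw [Finset.sum_const, nsmul_eq_mul, mul_one]
  exact_mod_cast (Finset.card_le_univ _).trans (by simp)

/-- The objective is smooth: along a direction with entries in `[-1, 1]`, a step of length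
`δ ≤ 1 / n` loses at most `δ² n² m M` compared with the linear prediction. The bound involves `M`
instead of all values, since a supported direction changes only the partial sums that reach a bin
with room for the item. -/
theorem le_objective_add {v : Values n m} (hv : 0 ≤ v) {y d : Fin n → Fin m → ℝ} (hy : 0 ≤ y)
    (hd : G.Supported d) (hd1 : ∀ i j, |d i j| ≤ 1) {δ : ℝ} (hδ : 0 ≤ δ) (hδn : δ * n ≤ 1) :
    objective v y + δ * slope v y d - δ ^ 2 * n ^ 2 * m * G.maxValue v ≤
      objective v (y + δ • d) := by
  classical
  have h : ∀ j : Fin m, ∑ k : Fin n, drop v j k * (1 - Real.exp (-cumul v y j k)) +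
      δ * (∑ k : Fin n, drop v j k * (Real.exp (-cumul v y j k) * cumul v d j k)) -
      δ ^ 2 * n ^ 2 * G.maxValue v ≤
      ∑ k : Fin n, drop v j k * (1 - Real.exp (-cumul v (y + δ • d) j k)) := by
    intro j
    have h1 := mul_le_mul_of_nonneg_left (G.sum_drop_reachesFit_le hv j)
      (show 0 ≤ δ ^ 2 * (n : ℝ) ^ 2 by positivity)
    suffices H : ∑ k : Fin n, drop v j k * (1 - Real.exp (-cumul v y j k)) +
        δ * (∑ k : Fin n, drop v j k * (Real.exp (-cumul v y j k) * cumul v d j k)) -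
        δ ^ 2 * n ^ 2 * ∑ k : Fin n, (if G.ReachesFit v j k then drop v j k else 0) ≤
        ∑ k : Fin n, drop v j k * (1 - Real.exp (-cumul v (y + δ • d) j k)) by linarith
    rw [Finset.mul_sum, Finset.mul_sum, ← Finset.sum_add_distrib, ← Finset.sum_sub_distrib]
    refine Finset.sum_le_sum fun k _ => ?_
    rw [cumul_add, cumul_smul]
    split_ifs with hk
    · have hD := abs_cumul_le v hd1 j k
      have hs := cumul_nonneg v hy j k
      set a := cumul v y j k
      set D := cumul v d j k
      have hle : |-(δ * D)| ≤ δ * n := by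
        rw [abs_neg, abs_mul, abs_of_nonneg hδ]
        exact mul_le_mul_of_nonneg_left hD hδ
      have h2 := (abs_le.1 (Real.abs_exp_sub_one_sub_id_le (hle.trans hδn))).2
      have h3 : (-(δ * D)) ^ 2 ≤ (δ * n) ^ 2 := sq_le_sq' (by linarith [(abs_le.1 hle).1])
        (abs_le.1 hle).2
      have h4 : Real.exp (-a) ≤ 1 := by rw [Real.exp_le_one_iff]; linarith
      have h5 : Real.exp (-(a + δ * D)) = Real.exp (-a) * Real.exp (-(δ * D)) := by
        rw [← Real.exp_add]; ring_nf
      have h6 : Real.exp (-a) * (Real.exp (-(δ * D)) - 1 - -(δ * D)) ≤ (δ * n) ^ 2 := by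
        have := Real.add_one_le_exp (-(δ * D))
        calc _ ≤ 1 * (Real.exp (-(δ * D)) - 1 - -(δ * D)) :=
              mul_le_mul_of_nonneg_right h4 (by linarith)
          _ ≤ _ := by linarith
      have h7 : (1 - Real.exp (-a)) + δ * (Real.exp (-a) * D) - (δ * n) ^ 2 ≤
          1 - Real.exp (-(a + δ * D)) := by rw [h5]; linarith
      have h8 := mul_le_mul_of_nonneg_left h7 (drop_nonneg hv j k)
      calc _ = drop v j k * ((1 - Real.exp (-a)) + δ * (Real.exp (-a) * D) - (δ * n) ^ 2) := by
            ring
        _ ≤ _ := h8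
    · simp [G.cumul_eq_zero hd hk]
  have h' := Finset.sum_le_sum fun j (_ : j ∈ Finset.univ) => h j
  rw [Finset.sum_sub_distrib, Finset.sum_add_distrib, ← Finset.mul_sum] at h'
  simp only [Finset.sum_const, Finset.card_univ, Fintype.card_fin, nsmul_eq_mul] at h'
  rw [objective_eq, objective_eq, slope]
  linarith

end PublicData

end

end GAP

namespace GAP

noncomputable section

variable {n m : ℕ}

/-! ### Fractional local search -/

/-- The indicator vector of an allocation. -/
def indicator (z : Alloc n m) : Fin n → Fin m → ℝ := fun i j => if j ∈ z i then 1 else 0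

theorem indicator_nonneg (z : Alloc n m) : 0 ≤ indicator z := by
  intro i j
  simp only [indicator, Pi.zero_apply]
  split_ifs <;> norm_num

theorem dot_eq (z : Alloc n m) (u : Fin n → Fin m → ℝ) :
    dot z u = ∑ i, ∑ j, indicator z i j * u i j := by
  simp [dot, indicator]

theorem dot_gradient (v : Values n m) (y : Fin n → Fin m → ℝ) (z : Alloc n m) :
    dot z (gradient v y) = slope v y (indicator z) := by
  rw [dot_eq, sum_mul_gradient]

theorem slope_nonneg {v : Values n m} (hv : 0 ≤ v) (y : Fin n → Fin m → ℝ)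
    {d : Fin n → Fin m → ℝ} (hd : 0 ≤ d) : 0 ≤ slope v y d := by
  rw [← sum_mul_gradient]
  exact Finset.sum_nonneg fun _ _ => Finset.sum_nonneg fun _ _ =>
    mul_nonneg (hd _ _) (gradient_nonneg hv _ _ _)

theorem marginal_storePoint (η : ℝ) (Z : Multiset (Alloc n m)) :
    marginal (storePoint η Z) = (1 / storeSize n m η : ℝ) • (Z.map indicator).sum := by
  have h : ∀ (Z : Multiset (Alloc n m)) (i : Fin n) (j : Fin m),
      ∑ S with j ∈ S, ((Z.countP fun z => z i = S : ℕ) : ℝ) = (Z.map indicator).sum i j := by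
    intro Z i j
    induction Z using Multiset.induction with
    | empty => simp
    | cons z Z ih =>
      simp only [Multiset.countP_cons, Nat.cast_add, Finset.sum_add_distrib, ih, Multiset.map_cons,
        Multiset.sum_cons, Pi.add_apply]
      rw [add_comm]
      congr 1
      simp [indicator]
  ext i j
  simp only [marginal, storePoint, Pi.smul_apply, smul_eq_mul, ← Finset.mul_sum, ← h]

theorem marginal_storePoint_zero (η : ℝ) :
    marginal (storePoint η (0 : Multiset (Alloc n m))) = 0 := by
  simp [marginal_storePoint]

theorem marginal_storePoint_cons (η : ℝ) (z : Alloc n m) (Z : Multiset (Alloc n m)) :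
    marginal (storePoint η (z ::ₘ Z)) =
      marginal (storePoint η Z) + (1 / storeSize n m η : ℝ) • indicator z := by
  simp [marginal_storePoint, add_comm]

theorem slope_storePoint (v : Values n m) (y : Fin n → Fin m → ℝ) (η : ℝ)
    (Z : Multiset (Alloc n m)) :
    slope v y (marginal (storePoint η Z)) =
      1 / storeSize n m η * (Z.map fun z => dot z (gradient v y)).sum := by
  rw [marginal_storePoint, slope_smul]
  congr 1
  induction Z using Multiset.induction with
  | empty => simp [← fderiv_objective]
  | cons z Z ih =>
    rw [Multiset.map_cons, Multiset.sum_cons, Multiset.map_cons, Multiset.sum_cons, ← ih,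
      dot_gradient, ← fderiv_objective, ← fderiv_objective, ← fderiv_objective, map_add]

theorem marginal_nonneg {x : Fin n → Finset (Fin m) → ℝ} (hx : ∀ i S, 0 ≤ x i S) :
    0 ≤ marginal x := fun _ _ => Finset.sum_nonneg fun _ _ => hx _ _

theorem storePoint_nonneg (η : ℝ) (Z : Multiset (Alloc n m)) (i : Fin n) (S : Finset (Fin m)) :
    0 ≤ storePoint η Z i S := by
  unfold storePoint
  positivity

namespace PublicData

variable (G : PublicData n m)

variable {G} in
theorem Fits.mono {i : Fin n} {S T : Finset (Fin m)} (h : G.Fits i S) (hT : T ⊆ S) :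
    G.Fits i T :=
  (Finset.sum_le_sum_of_subset_of_nonneg hT fun _ _ _ => G.weight_nonneg _ _).trans h

theorem fits_empty (i : Fin n) : G.Fits i ∅ := by simpa [Fits] using G.capacity_nonneg i

theorem supported_indicator {z : Alloc n m} (hz : ∀ i, G.Fits i (z i)) :
    G.Supported (indicator z) := fun i j hj =>
  if_neg fun h => hj ((hz i).mono (by simpa using h))

theorem supported_marginal {x : Fin n → Finset (Fin m) → ℝ} (hx : x ∈ G.polytope) :
    G.Supported (marginal x) := by
  intro i j hj
  refine Finset.sum_eq_zero fun S hS => hx.2.1 i S fun hf => hj (hf.mono ?_)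
  simpa using hS

theorem storePoint_mem_polytope {η : ℝ} {Z : Multiset (Alloc n m)}
    (hc : Z.card ≤ storeSize n m η) (hZ : ∀ z ∈ Z, ∀ i, G.Fits i (z i)) :
    storePoint η Z ∈ G.polytope := by
  refine ⟨storePoint_nonneg η Z, fun i S hS => ?_, fun i => ?_⟩
  · have : Z.countP (fun z => z i = S) = 0 :=
      Multiset.countP_eq_zero.2 fun z hz h => hS (h ▸ hZ z hz i)
    simp [storePoint, this]
  · have h : ∑ S, ((Z.countP fun z => z i = S : ℕ) : ℝ) = Z.card := by
      clear hc hZ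
      induction Z using Multiset.induction with
      | empty => simp
      | cons z Z ih => simp [Multiset.countP_cons, Finset.sum_add_distrib, ih]
    simp only [storePoint, ← Finset.mul_sum, h]
    rw [one_div_mul_eq_div]
    exact div_le_one_of_le₀ (by exact_mod_cast hc) (by positivity)

theorem maxValue_pos_of_improves {η : ℝ} {v : Values n m} (hv : 0 ≤ v)
    {Z : Multiset (Alloc n m)} {z : Alloc n m} (hz : ∀ i, G.Fits i (z i))
    (h : G.Improves η v Z z) : 0 < G.maxValue v := by
  refine lt_of_le_of_ne (G.maxValue_nonneg hv) fun h0 => ?_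
  have hy := marginal_nonneg (storePoint_nonneg η Z)
  unfold Improves at h
  rw [← h0, mul_zero, sum_mul_gradient] at h
  have h1 := slope_nonneg hv (marginal (storePoint η Z)) hy
  have h2 : dot z (gradient v (marginal (storePoint η Z))) ≤ 0 := by
    refine Finset.sum_nonpos fun i _ => Finset.sum_nonpos fun j hj => ?_
    rw [h0]
    exact G.gradient_le hv hy ((hz i).mono (by simpa using hj))
  linarith

theorem pos_of_maxValue_pos {v : Values n m} (h : 0 < G.maxValue v) : 0 < n ∧ 0 < m := by
  rcases Nat.eq_zero_or_pos n with rfl | hn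
  · simp [maxValue] at h
  rcases Nat.eq_zero_or_pos m with rfl | hm
  · simp [maxValue] at h
  exact ⟨hn, hm⟩

theorem le_storeSize (n m : ℕ) {η : ℝ} : 6 * m * n ^ 2 / η ≤ storeSize n m η := Nat.le_ceil _

/-- One iteration gains at least `(5/6) δ η M`: the linear gain is at least `δ η M` (a removed
vector of least value costs at most the average value `y ⬝ u` of the stored ones), and the quadratic error
`δ² n² m M` is at most `δ η M / 6` because `K ≥ 6 m n² / η`. -/
theorem searchStep_gain {η : ℝ} (hη : 0 < η) (hη1 : η ≤ 1) {v : Values n m} (hv : 0 ≤ v)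
    {Z Z' : Multiset (Alloc n m)} (hZ : ∀ z ∈ Z, ∀ i, G.Fits i (z i)) (h : G.SearchStep η v Z Z') :
    0 < G.maxValue v ∧ Z'.card ≤ storeSize n m η ∧ (∀ z ∈ Z', ∀ i, G.Fits i (z i)) ∧
      objective v (marginal (storePoint η Z)) + 5 / 6 * (1 / storeSize n m η) * η * G.maxValue v ≤
        objective v (marginal (storePoint η Z')) := by
  obtain ⟨z, hz, himp, hZ'⟩ := h
  have hzf : ∀ i, G.Fits i (z i) := fun i => (hz i).1
  have hM := G.maxValue_pos_of_improves hv hzf himp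
  obtain ⟨hn, hm⟩ := G.pos_of_maxValue_pos hM
  have hn' : (1 : ℝ) ≤ n := by exact_mod_cast hn
  have hm' : (1 : ℝ) ≤ m := by exact_mod_cast hm
  have hKle := le_storeSize n m (η := η)
  set K := storeSize n m η with hK
  have hKpos : (0 : ℝ) < K := lt_of_lt_of_le (by positivity) hKle
  have h6 : 6 * m * (n : ℝ) ^ 2 ≤ K * η := (div_le_iff₀ hη).1 hKle
  have hnK : (n : ℝ) ≤ K := by
    have h1 : K * η ≤ K := mul_le_of_le_one_right hKpos.le hη1
    have h2 : (n : ℝ) * 1 ≤ n * (6 * m * n) := by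
      refine mul_le_mul_of_nonneg_left ?_ (by positivity)
      nlinarith
    nlinarith
  set y := marginal (storePoint η Z) with hy
  have hy0 : 0 ≤ y := marginal_nonneg (storePoint_nonneg η Z)
  have hgain : ∀ d : Fin n → Fin m → ℝ, G.Supported d → (∀ i j, |d i j| ≤ 1) →
      η * G.maxValue v ≤ slope v y d → objective v y + 5 / 6 * (1 / K) * η * G.maxValue v ≤
        objective v (y + (1 / K : ℝ) • d) := by
    intro d hd hd1 hs
    have h1 := G.le_objective_add hv hy0 hd hd1 (δ := 1 / K) (by positivity) (by
      rw [one_div_mul_eq_div]; exact (div_le_one hKpos).2 hnK)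
    have h2 := mul_le_mul_of_nonneg_left hs (show (0 : ℝ) ≤ 1 / K by positivity)
    have h3 : (1 / K : ℝ) ^ 2 * n ^ 2 * m * G.maxValue v ≤ 1 / 6 * (1 / K) * η * G.maxValue v := by
      refine mul_le_mul_of_nonneg_right ?_ hM.le
      have h4 : (n : ℝ) ^ 2 * m ≤ 1 / 6 * (K * η) := by linarith
      have h5 := mul_le_mul_of_nonneg_left h4 (show (0 : ℝ) ≤ (1 / K) ^ 2 by positivity)
      calc _ = (1 / K : ℝ) ^ 2 * (n ^ 2 * m) := by ring
        _ ≤ _ := h5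
        _ = _ := by field_simp
    linarith
  unfold Improves at himp
  rw [sum_mul_gradient, ← hy] at himp
  rcases hZ' with ⟨hc, rfl⟩ | ⟨hc, z₀, hz₀, hmin, rfl⟩
  · refine ⟨hM, by simpa using hc, ?_, ?_⟩
    · intro z' hz'
      rcases Multiset.mem_cons.1 hz' with rfl | hz'
      · exact hzf
      · exact hZ z' hz'
    · rw [marginal_storePoint_cons]
      refine hgain _ (G.supported_indicator hzf) (fun i j => ?_) ?_
      · simp only [indicator]; split_ifs <;> simp
      · rw [← dot_gradient]
        have := slope_nonneg hv y hy0
        linarith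
  · have hsplit := Multiset.cons_erase hz₀
    have hcard := Multiset.card_erase_add_one hz₀
    refine ⟨hM, by rw [Multiset.card_cons, hcard, hc], ?_, ?_⟩
    · intro z' hz'
      rcases Multiset.mem_cons.1 hz' with rfl | hz'
      · exact hzf
      · exact hZ z' (Multiset.mem_of_mem_erase hz')
    · have hyeq : marginal (storePoint η (z ::ₘ Z.erase z₀)) =
          y + (1 / K : ℝ) • (indicator z - indicator z₀) := by
        rw [marginal_storePoint_cons, hy]
        conv_rhs => rw [← hsplit]
        rw [marginal_storePoint_cons, ← hK]
        simp only [smul_sub]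
        abel
      rw [hyeq]
      refine hgain _ ?_ (fun i j => ?_) ?_
      · intro i j hj
        rw [Pi.sub_apply, Pi.sub_apply, G.supported_indicator hzf i j hj,
          G.supported_indicator (hZ z₀ hz₀) i j hj, sub_zero]
      · simp only [indicator, Pi.sub_apply]; split_ifs <;> simp
      · rw [slope_sub, ← dot_gradient, ← dot_gradient]
        have h1 : Z.card • dot z₀ (gradient v y) ≤ (Z.map fun z => dot z (gradient v y)).sum := by
          have := Multiset.card_nsmul_le_sum (s := Z.map fun z => dot z (gradient v y))
            (a := dot z₀ (gradient v y)) (by simpa using hmin)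
          simpa using this
        have h2 : dot z₀ (gradient v y) ≤ slope v y y := by
          conv_rhs => rw [hy, slope_storePoint, ← hy]
          rw [hc, nsmul_eq_mul] at h1
          rw [one_div_mul_eq_div, le_div_iff₀ hKpos]
          linarith
        linarith

theorem searchRun_invariant {η : ℝ} (hη : 0 < η) (hη1 : η ≤ 1) {v : Values n m} (hv : 0 ≤ v)
    {t : ℕ} {Z : Multiset (Alloc n m)} (h : G.SearchRun η v t Z) :
    (t = 0 ∨ 0 < G.maxValue v) ∧ Z.card ≤ storeSize n m η ∧ (∀ z ∈ Z, ∀ i, G.Fits i (z i)) ∧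
      t * (5 / 6 * (1 / storeSize n m η) * η * G.maxValue v) ≤
        objective v (marginal (storePoint η Z)) := by
  induction h with
  | start => simp [marginal_storePoint_zero, objective_zero]
  | next _ hstep ih =>
    obtain ⟨h1, h2, h3, h4⟩ := G.searchStep_gain hη hη1 hv ih.2.2.1 hstep
    refine ⟨Or.inr h1, h2, h3, ?_⟩
    push_cast
    linarith [ih.2.2.2]

theorem searchRun_mem_polytope {η : ℝ} (hη : 0 < η) (hη1 : η ≤ 1) {v : Values n m} (hv : 0 ≤ v)
    {t : ℕ} {Z : Multiset (Alloc n m)} (h : G.SearchRun η v t Z) :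
    storePoint η Z ∈ G.polytope := by
  obtain ⟨-, h2, h3, -⟩ := G.searchRun_invariant hη hη1 hv h
  exact G.storePoint_mem_polytope h2 h3

theorem storeSize_le (n m : ℕ) {ε : ℝ} (hε : 0 < ε) :
    storeSize n m (ε / 4) ≤ 24 * m * n ^ 2 * ⌈1 / ε⌉₊ := by
  refine Nat.ceil_le.2 ?_
  push_cast
  have h := Nat.le_ceil (1 / ε)
  calc 6 * (m : ℝ) * n ^ 2 / (ε / 4) = 24 * m * n ^ 2 * (1 / ε) := by field_simp; ring
    _ ≤ _ := mul_le_mul_of_nonneg_left h (by positivity)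

/-- The gains of the iterations add up to at most `F ≤ m M`. If `M = 0`, no vector is improving. -/
theorem searchRun_le {ε : ℝ} (hε : 0 < ε) (hε1 : ε ≤ 1) {v : Values n m} (hv : 0 ≤ v)
    {t : ℕ} {Z : Multiset (Alloc n m)} (h : G.SearchRun (ε / 4) v t Z) :
    t ≤ 5 * m * storeSize n m (ε / 4) * ⌈1 / ε⌉₊ := by
  obtain ⟨h1, h2, h3, h4⟩ := G.searchRun_invariant (by linarith) (by linarith) hv h
  rcases h1 with rfl | hM
  · simp
  have hpoly := G.storePoint_mem_polytope h2 h3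
  have h5 := h4.trans (G.objective_le hv (G.supported_marginal hpoly))
  obtain ⟨hn, hm⟩ := G.pos_of_maxValue_pos hM
  have hn' : (1 : ℝ) ≤ n := by exact_mod_cast hn
  have hm' : (1 : ℝ) ≤ m := by exact_mod_cast hm
  have hKpos : (0 : ℝ) < storeSize n m (ε / 4) :=
    lt_of_lt_of_le (by positivity) (le_storeSize n m (η := ε / 4))
  set K : ℝ := (storeSize n m (ε / 4) : ℝ) with hK
  have h6 : (t : ℝ) * (5 / 6 * (1 / K) * (ε / 4)) ≤ m := by
    refine le_of_mul_le_mul_right ?_ hM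
    linarith
  have h7 : (t : ℝ) ≤ 24 / 5 * m * K * (1 / ε) := by
    have : (t : ℝ) = t * (5 / 6 * (1 / K) * (ε / 4)) * (24 / 5 * K * (1 / ε)) := by
      field_simp; ring
    rw [this]
    calc _ ≤ m * (24 / 5 * K * (1 / ε)) := mul_le_mul_of_nonneg_right h6 (by positivity)
      _ = _ := by ring
  have h8 : (t : ℝ) ≤ 5 * m * K * ⌈1 / ε⌉₊ := by
    refine h7.trans (mul_le_mul ?_ (Nat.le_ceil _) (by positivity) (by positivity))
    gcongr
    norm_num
  rw [hK] at h8
  exact_mod_cast h8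

/-- An allocation as a point of the polytope. -/
def allocPoint (S : Alloc n m) : Fin n → Finset (Fin m) → ℝ := fun i T => if T = S i then 1 else 0

theorem allocPoint_mem_polytope {S : Alloc n m} (hS : ∀ i, G.Fits i (S i)) :
    allocPoint S ∈ G.polytope := by
  refine ⟨fun i T => ?_, fun i T hT => ?_, fun i => ?_⟩
  · simp only [allocPoint]; split_ifs <;> norm_num
  · exact if_neg fun h : T = S i => hT (h ▸ hS i)
  · simp [allocPoint]

theorem marginal_allocPoint (S : Alloc n m) : marginal (allocPoint S) = indicator S := by
  ext i j
  simp [marginal, allocPoint, indicator]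

/-- Rounding a feasible allocation keeps a `1 - 1/e` fraction of its welfare. -/
theorem welfare_le_objective {v : Values n m} (hv : 0 ≤ v) {S : Alloc n m} (hS : G.Feasible S) :
    (1 - 1 / Real.exp 1) * G.welfare v S ≤ objective v (indicator S) := by
  have he : 0 ≤ 1 - 1 / Real.exp 1 := by
    rw [one_div, ← Real.exp_neg, sub_nonneg, Real.exp_le_one_iff]; norm_num
  have h1 : G.welfare v S = ∑ j, ∑ i, if j ∈ S i then v i j else 0 := by
    rw [Finset.sum_comm]
    refine Finset.sum_congr rfl fun i _ => ?_
    simp [binValue, hS.1 i]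
  rw [h1, Finset.mul_sum, objective_eq]
  refine Finset.sum_le_sum fun j _ => ?_
  have hnn : ∀ k, 0 ≤ cumul v (indicator S) j k := cumul_nonneg v (indicator_nonneg S) j
  by_cases hj : ∃ i, j ∈ S i
  · obtain ⟨i, hi⟩ := hj
    have h2 : ∑ i, (if j ∈ S i then v i j else 0) = v i j := by
      rw [Finset.sum_eq_single i, if_pos hi]
      · intro k _ hk
        exact if_neg fun h => Finset.disjoint_left.1 (hS.2 k i hk) h hi
      · simp
    have h3 := sum_drop_ge v j ((greedyOrder v j).symm i)
    rw [Equiv.apply_symm_apply] at h3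
    rw [h2, ← h3, Finset.mul_sum]
    refine Finset.sum_le_sum fun k _ => ?_
    split_ifs with hk
    · rw [mul_comm]
      refine mul_le_mul_of_nonneg_left ?_ (drop_nonneg hv _ _)
      have h4 : 1 ≤ cumul v (indicator S) j k := by
        have := Finset.single_le_sum (f := fun l => indicator S (greedyOrder v j l) j)
          (fun l _ => indicator_nonneg S _ _) (Finset.mem_Iic.2 hk)
        simpa only [cumul, indicator, Equiv.apply_symm_apply, hi, if_true] using this
      rw [one_div, ← Real.exp_neg]
      have := Real.exp_le_exp.2 (neg_le_neg h4)
      linarith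
    · rw [mul_zero]
      refine mul_nonneg (drop_nonneg hv _ _) ?_
      rw [sub_nonneg, Real.exp_le_one_iff, neg_nonpos]
      exact hnn k
  · have h2 : ∑ i, (if j ∈ S i then v i j else 0) = 0 :=
      Finset.sum_eq_zero fun i _ => if_neg fun h => hj ⟨i, h⟩
    rw [h2, mul_zero]
    refine Finset.sum_nonneg fun k _ => mul_nonneg (drop_nonneg hv _ _) ?_
    rw [sub_nonneg, Real.exp_le_one_iff, neg_nonpos]
    exact hnn k

theorem welfare_nonneg {v : Values n m} (hv : 0 ≤ v) (S : Alloc n m) : 0 ≤ G.welfare v S :=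
  Finset.sum_nonneg fun _ _ => G.binValue_nonneg hv _ _

/-- The largest value of a single item is at most `8/5` times the optimum of the objective. -/
theorem exists_maxValue_le {v : Values n m} (hv : 0 ≤ v) :
    ∃ x ∈ G.polytope, G.maxValue v ≤ 8 / 5 * objective v (marginal x) := by
  classical
  have hzero : (0 : Fin n → Finset (Fin m) → ℝ) ∈ G.polytope := by
    refine ⟨fun _ _ => le_rfl, fun _ _ _ => rfl, fun i => by simp⟩
  have h0 : ∃ x ∈ G.polytope, 0 ≤ 8 / 5 * objective v (marginal x) :=
    ⟨0, hzero, mul_nonneg (by norm_num) (objective_nonneg hv (marginal_nonneg fun _ _ => le_rfl))⟩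
  rcases (G.maxValue_nonneg hv).eq_or_lt with hM | hM
  · rwa [← hM]
  obtain ⟨hn, hm⟩ := G.pos_of_maxValue_pos hM
  have : Nonempty (Fin n × Fin m) := ⟨(⟨0, hn⟩, ⟨0, hm⟩)⟩
  obtain ⟨⟨i, j⟩, hij⟩ := exists_eq_ciSup_of_finite (f := fun p : Fin n × Fin m =>
    G.binValue v p.1 {p.2})
  change G.binValue v i {j} = G.maxValue v at hij
  have hfit : G.Fits i {j} := by
    by_contra h
    simp [binValue, h] at hij
    exact hM.ne hij
  let S : Alloc n m := fun k => if k = i then {j} else ∅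
  have hS : G.Feasible S := by
    constructor
    · intro k
      by_cases hk : k = i
      · subst hk; simpa [S] using hfit
      · simpa [S, hk] using G.fits_empty k
    · intro k l hkl
      by_cases hk : k = i
      · have : l ≠ i := fun h => hkl (hk.trans h.symm)
        simp [S, this]
      · simp [S, hk]
  refine ⟨allocPoint S, G.allocPoint_mem_polytope hS.1, ?_⟩
  have h1 := G.welfare_le_objective hv hS
  have h2 : G.maxValue v ≤ G.welfare v S := by
    rw [← hij]
    have := Finset.single_le_sum (f := fun k => G.binValue v k (S k))
      (fun k _ => G.binValue_nonneg hv k (S k)) (Finset.mem_univ i)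
    simpa only [welfare, S, if_true] using this
  rw [marginal_allocPoint]
  have he : (5 / 8 : ℝ) ≤ 1 - 1 / Real.exp 1 := by
    have := Real.exp_one_gt_d9
    have h3 : 1 / Real.exp 1 ≤ 3 / 8 := by
      rw [div_le_div_iff₀ (Real.exp_pos 1) (by norm_num)]
      linarith
    linarith
  have h3 := mul_le_mul_of_nonneg_right he (G.welfare_nonneg hv S)
  linarith

/-- A linear function on the polytope is maximized by the best choice of one set for every bin. -/
theorem slope_le_of_isKnapsackApprox {η : ℝ} {v : Values n m} (hv : 0 ≤ v)
    {y : Fin n → Fin m → ℝ} {z : Alloc n m} (hz : G.IsKnapsackApprox η (gradient v y) z)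
    {x : Fin n → Finset (Fin m) → ℝ} (hx : x ∈ G.polytope) :
    (1 - η) * slope v y (marginal x) ≤ dot z (gradient v y) := by
  rw [← sum_mul_gradient, Finset.mul_sum]
  refine Finset.sum_le_sum fun i _ => ?_
  have h1 : ∑ j, marginal x i j * gradient v y i j = ∑ S, x i S * ∑ j ∈ S, gradient v y i j := by
    simp only [marginal, Finset.sum_mul, Finset.sum_filter, Finset.mul_sum]
    rw [Finset.sum_comm]
    refine Finset.sum_congr rfl fun S _ => ?_
    simp [Finset.sum_ite_mem]
  rw [h1, Finset.mul_sum]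
  have hpos : 0 ≤ ∑ j ∈ z i, gradient v y i j :=
    Finset.sum_nonneg fun _ _ => gradient_nonneg hv _ _ _
  calc _ ≤ ∑ S, x i S * ∑ j ∈ z i, gradient v y i j := by
        refine Finset.sum_le_sum fun S _ => ?_
        by_cases hS : G.Fits i S
        · have := mul_le_mul_of_nonneg_left ((hz i).2 S hS) (hx.1 i S)
          linarith
        · rw [hx.2.1 i S hS]; simp
    _ ≤ _ := by
        rw [← Finset.sum_mul]
        exact mul_le_of_le_one_left hpos (hx.2.2 i)

/-- The outcome of the local search is a `(1 - ε)`-approximate maximizer of the objective. -/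
theorem objective_le_of_searchStops {ε : ℝ} (hε : 0 < ε) (hε1 : ε ≤ 1) {v : Values n m}
    (hv : 0 ≤ v) {Z : Multiset (Alloc n m)} (h : G.SearchStops (ε / 4) v Z)
    {x : Fin n → Finset (Fin m) → ℝ} (hx : x ∈ G.polytope) :
    (1 - ε) * objective v (marginal x) ≤ objective v (marginal (storePoint (ε / 4) Z)) := by
  obtain ⟨z, hz, himp⟩ := h
  set y := marginal (storePoint (ε / 4) Z) with hy
  have hy0 : 0 ≤ y := marginal_nonneg (storePoint_nonneg _ Z)
  unfold Improves at himp
  rw [sum_mul_gradient, ← hy, not_lt] at himp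
  have hself := slope_self_le hv y
  have key : ∀ x ∈ G.polytope, (1 - ε / 4) * (objective v (marginal x) - objective v y) ≤
      ε / 4 * (G.maxValue v + objective v y) := by
    intro x hx
    have h1 := G.slope_le_of_isKnapsackApprox hv hz hx
    have h2 := objective_le_tangent hv y (marginal x)
    rw [slope_sub] at h2
    have h3 := mul_le_mul_of_nonneg_left h2 (show (0 : ℝ) ≤ 1 - ε / 4 by linarith)
    nlinarith
  obtain ⟨x₀, hx₀, hM⟩ := G.exists_maxValue_le hv
  have h1 := key x hx
  have h2 := key x₀ hx₀
  have hF := objective_nonneg hv hy0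
  set a := objective v (marginal x)
  set b := objective v (marginal x₀)
  set f := objective v y
  set M := G.maxValue v
  have hM0 : 0 ≤ M := G.maxValue_nonneg hv
  have ha : 0 ≤ a := objective_nonneg hv (marginal_nonneg hx.1)
  -- The second inequality bounds `M` by a multiple of the value `f` of the outcome.
  have h3 : M * (1 - 13 / 5 * (ε / 4)) ≤ 8 / 5 * f := by nlinarith
  have h4 : (1 - ε / 4) * a ≤ ε / 4 * M + f := by linarith
  have h5 : 0 ≤ 1 - 13 / 5 * (ε / 4) := by linarith
  have h6 : (1 - ε / 4) * ((1 - 13 / 5 * (ε / 4)) * a) ≤ (1 - ε / 4) * f := by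
    have h7 := mul_le_mul_of_nonneg_left h4 h5
    have h8 := mul_le_mul_of_nonneg_left h3 (show 0 ≤ ε / 4 by linarith)
    linarith
  have h9 : (1 - 13 / 5 * (ε / 4)) * a ≤ f := le_of_mul_le_mul_left h6 (by linarith)
  have h10 : 0 ≤ ε * a := mul_nonneg hε.le ha
  linarith

end PublicData

end

end GAP

namespace GAP

noncomputable section

variable {n m : ℕ}

/-! ### Sums along the greedy order -/

/-- `k` comes before `i`, or is equal to `i`, in the greedy order for item `j`. -/
def Precedes (v : Values n m) (j : Fin m) (k i : Fin n) : Prop :=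
  (greedyOrder v j).symm k ≤ (greedyOrder v j).symm i

/-- The greedy order breaks ties in favour of the smaller index. -/
theorem precedes_iff (v : Values n m) (j : Fin m) (k i : Fin n) :
    Precedes v j k i ↔ ¬ v k j < v i j ∧ ¬ (¬ v i j < v k j ∧ i < k) := by
  have hmono := isGreedyOrder_greedyOrder v j
  have hstab := (Tuple.eq_sort_iff (f := fun i => -v i j) (σ := greedyOrder v j)).1 rfl
  have h1 : ∀ k i : Fin n, Precedes v j k i → v i j ≤ v k j := fun k i h => by
    simpa using hmono h
  have h2 : ∀ k i : Fin n, v k j = v i j → k < i → Precedes v j k i := by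
    intro k i he hlt
    by_contra hn
    have h3 : (greedyOrder v j).symm i < (greedyOrder v j).symm k := not_le.1 hn
    have h4 := hstab.2 _ _ h3 (by simp [he])
    simp only [Equiv.apply_symm_apply] at h4
    exact absurd hlt (not_lt.2 h4.le)
  constructor
  · intro h
    refine ⟨not_lt.2 (h1 k i h), fun ⟨h3, h4⟩ => ?_⟩
    have h5 := h2 i k (le_antisymm (not_lt.1 h3 |> fun _ => h1 k i h) (not_lt.1 h3)) h4
    exact h4.ne ((greedyOrder v j).symm.injective (le_antisymm h5 h))
  · rintro ⟨h3, h4⟩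
    by_contra hn
    have h5 : Precedes v j i k := (not_le.1 hn).le
    have h6 : v i j = v k j := le_antisymm (not_lt.1 h3) (h1 i k h5)
    have h7 : k ≤ i := not_lt.1 fun h => h4 ⟨by rw [h6]; exact lt_irrefl _, h⟩
    rcases h7.eq_or_lt with rfl | h7
    · exact hn le_rfl
    · exact hn (h2 k i h6.symm h7)

/-- The amount of item `j` in the bin at position `p` of the greedy order, and `0` behind the last
bin. -/
def amountAt (v : Values n m) (y : Fin n → Fin m → ℝ) (j : Fin m) (p : ℕ) : ℝ :=
  if h : p < n then y (greedyOrder v j ⟨p, h⟩) j else 0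

/-- `exp (-s)`, where `s` is the amount of item `j` at the positions before `p`. -/
def survival (v : Values n m) (y : Fin n → Fin m → ℝ) (j : Fin m) (p : ℕ) : ℝ :=
  Real.exp (-∑ q ∈ Finset.range p, amountAt v y j q)

theorem amountAt_fin (v : Values n m) (y : Fin n → Fin m → ℝ) (j : Fin m) (p : Fin n) :
    amountAt v y j p = y (greedyOrder v j p) j := by simp [amountAt]

theorem sum_range_eq (f : ℕ → ℝ) {p : ℕ} (hp : p ≤ n) :
    ∑ q ∈ Finset.range p, f q = ∑ q : Fin n, if q.1 < p then f q else 0 := by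
  rw [← Finset.sum_range fun q => if q < p then f q else 0, ← Finset.sum_filter]
  refine Finset.sum_congr ?_ fun _ _ => rfl
  ext q
  simp only [Finset.mem_range, Finset.mem_filter]
  omega

theorem survival_succ (v : Values n m) (y : Fin n → Fin m → ℝ) (j : Fin m) (p : Fin n) :
    survival v y j (p + 1) = Real.exp (-cumul v y j p) := by
  rw [survival, sum_range_eq _ (Nat.succ_le_of_lt p.2), cumul]
  congr 2
  rw [← Finset.sum_filter]
  refine Finset.sum_congr ?_ fun q _ => amountAt_fin v y j q
  ext q
  simp only [Finset.mem_filter, Finset.mem_univ, true_and, Finset.mem_Iic, Fin.le_def]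
  omega

theorem survival_eq_mul (v : Values n m) (y : Fin n → Fin m → ℝ) (j : Fin m) (p : ℕ) :
    survival v y j p = survival v y j (p + 1) * Real.exp (amountAt v y j p) := by
  rw [survival, survival, ← Real.exp_add, Finset.sum_range_succ]
  ring_nf

theorem cumul_symm (v : Values n m) (y : Fin n → Fin m → ℝ) (j : Fin m) (i : Fin n) :
    cumul v y j ((greedyOrder v j).symm i) =
      ∑ k, open Classical in if Precedes v j k i then y k j else 0 := by
  classical
  rw [cumul, ← Equiv.sum_comp (greedyOrder v j), ← Finset.sum_filter]
  refine Finset.sum_congr ?_ fun _ _ => rfl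
  ext q
  simp [Precedes]

/-- A formula for the gradient that needs no sorting. -/
theorem gradient_eq_precedes (v : Values n m) (y : Fin n → Fin m → ℝ) (i : Fin n) (j : Fin m) :
    gradient v y i j = v i j * Real.exp (-cumul v y j ((greedyOrder v j).symm i)) -
      ∑ k, open Classical in if Precedes v j k i then 0 else
        v k j * Real.exp (-cumul v y j ((greedyOrder v j).symm k)) * (Real.exp (y k j) - 1) := by
  classical
  set p₀ := (greedyOrder v j).symm i with hp₀
  set a := sortedValue v j
  set e := survival v y j
  have habel : ∀ N, p₀.1 + 1 ≤ N →
      ∑ p ∈ Finset.range N, (if p₀.1 ≤ p then (a p - a (p + 1)) * e (p + 1) else 0) =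
        a p₀ * e (p₀ + 1) -
          ∑ p ∈ Finset.range N, (if p ≤ p₀.1 then 0 else a p * (e p - e (p + 1))) - a N * e N := by
    intro N hN
    induction N, hN using Nat.le_induction with
    | base =>
      rw [Finset.sum_range_succ, if_pos le_rfl, Finset.sum_eq_zero, Finset.sum_eq_zero]
      · ring
      · intro p hp
        exact if_pos (by have := Finset.mem_range.1 hp; omega)
      · intro p hp
        exact if_neg (by have := Finset.mem_range.1 hp; omega)
    | succ N hN ih =>
      rw [Finset.sum_range_succ, ih, Finset.sum_range_succ, if_pos (by omega), if_neg (by omega)]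
      ring
  have h := habel n p₀.2
  rw [show a n = 0 from sortedValue_of_le v j le_rfl, Finset.sum_range, Finset.sum_range] at h
  rw [gradient_eq]
  calc _ = ∑ p : Fin n, (if p₀.1 ≤ p then (a p - a (p + 1)) * e (p + 1) else 0) := by
        refine Finset.sum_congr rfl fun p _ => ?_
        rw [show e (p + 1) = _ from survival_succ v y j p]
        rfl
    _ = _ := by
        rw [h, zero_mul, sub_zero, show e (p₀ + 1) = _ from survival_succ v y j p₀,
          show a p₀ = _ from sortedValue_fin v j p₀, hp₀, Equiv.apply_symm_apply]
        congr 1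
        conv_rhs => rw [← Equiv.sum_comp (greedyOrder v j)]
        refine Finset.sum_congr rfl fun p _ => ?_
        simp only [Precedes, Equiv.symm_apply_apply, ← hp₀, Fin.le_def]
        split_ifs
        · rfl
        · rw [show a p = _ from sortedValue_fin v j p,
            show e p = _ from survival_eq_mul v y j p, amountAt_fin,
            show survival v y j (p + 1) = _ from survival_succ v y j p,
            show e (p + 1) = _ from survival_succ v y j p]
          ring

/-- The objective as the expected value of the first successful bin in the greedy order. -/
theorem objective_eq_survival (v : Values n m) (y : Fin n → Fin m → ℝ) :
    objective v y = ∑ j, ∑ p : Fin n, v (greedyOrder v j p) j *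
      (survival v y j p - survival v y j (p + 1)) := by
  rw [objective_eq]
  refine Finset.sum_congr rfl fun j _ => ?_
  set a := sortedValue v j
  set e := survival v y j
  have habel : ∀ N, ∑ p ∈ Finset.range N, a p * (e p - e (p + 1)) =
      ∑ p ∈ Finset.range N, (a p - a (p + 1)) * (1 - e (p + 1)) + a N * (1 - e N) -
        a 0 * (1 - e 0) := by
    intro N
    induction N with
    | zero => simp
    | succ N ih => rw [Finset.sum_range_succ, ih, Finset.sum_range_succ]; ring
  have h := habel n
  have he0 : e 0 = 1 := by simp [e, survival]
  rw [show a n = 0 from sortedValue_of_le v j le_rfl, he0, Finset.sum_range, Finset.sum_range] at h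
  calc _ = ∑ p : Fin n, (a p - a (p + 1)) * (1 - e (p + 1)) := by
        refine Finset.sum_congr rfl fun p _ => ?_
        rw [show e (p + 1) = _ from survival_succ v y j p]
        rfl
    _ = ∑ p : Fin n, a p * (e p - e (p + 1)) := by rw [h]; ring
    _ = _ := by
        refine Finset.sum_congr rfl fun p _ => ?_
        rw [show a p = _ from sortedValue_fin v j p]

/-! ### Expectations -/

/-- The expectation of `f` under a law on a finite type. -/
def expect {α : Type*} [Fintype α] (μ : PMF α) (f : α → ℝ) : ℝ := ∑ a, (μ a).toReal * f a

section Expect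

variable {α β : Type*} [Fintype α] [Fintype β]

theorem sum_toReal (μ : PMF α) : ∑ a, (μ a).toReal = 1 := by
  rw [← ENNReal.toReal_sum fun a _ => μ.apply_ne_top a,
    ← tsum_fintype (L := .unconditional _), μ.tsum_coe, ENNReal.toReal_one]

theorem expect_pure (a : α) (f : α → ℝ) : expect (PMF.pure a) f = f a := by
  classical
  rw [expect, Finset.sum_eq_single a] <;> simp +contextual [PMF.pure_apply]

theorem expect_bind (μ : PMF α) (g : α → PMF β) (f : β → ℝ) :
    expect (μ.bind g) f = expect μ fun a => expect (g a) f := by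
  have h : ∀ b, ((μ.bind g) b).toReal = ∑ a, (μ a).toReal * (g a b).toReal := by
    intro b
    rw [PMF.bind_apply, tsum_fintype, ENNReal.toReal_sum]
    · simp
    · exact fun a _ => ENNReal.mul_ne_top (μ.apply_ne_top a) ((g a).apply_ne_top b)
  simp only [expect, h, Finset.sum_mul, Finset.mul_sum]
  rw [Finset.sum_comm]
  simp only [mul_assoc]

theorem expect_map (μ : PMF α) (g : α → β) (f : β → ℝ) :
    expect (μ.map g) f = expect μ fun a => f (g a) := by
  rw [← PMF.bind_pure_comp, expect_bind]
  simp only [Function.comp, expect_pure]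

theorem expect_const (μ : PMF α) (c : ℝ) : expect μ (fun _ => c) = c := by
  rw [expect, ← Finset.sum_mul, sum_toReal, one_mul]

theorem expect_sum {ι : Type*} (μ : PMF α) (s : Finset ι) (f : ι → α → ℝ) :
    expect μ (fun a => ∑ i ∈ s, f i a) = ∑ i ∈ s, expect μ (f i) := by
  simp only [expect, Finset.mul_sum]
  exact Finset.sum_comm

theorem expect_mul_left (μ : PMF α) (c : ℝ) (f : α → ℝ) :
    expect μ (fun a => c * f a) = c * expect μ f := by
  simp only [expect, Finset.mul_sum]
  exact Finset.sum_congr rfl fun _ _ => by ring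

theorem expect_sub (μ : PMF α) (f g : α → ℝ) :
    expect μ (fun a => f a - g a) = expect μ f - expect μ g := by
  simp only [expect, mul_sub, Finset.sum_sub_distrib]

theorem expect_le (μ : PMF α) {f g : α → ℝ} (h : ∀ a ∈ μ.support, f a ≤ g a) :
    expect μ f ≤ expect μ g := by
  refine Finset.sum_le_sum fun a _ => ?_
  by_cases ha : a ∈ μ.support
  · exact mul_le_mul_of_nonneg_left (h a ha) ENNReal.toReal_nonneg
  · rw [PMF.mem_support_iff, not_not] at ha
    simp [ha]

theorem expect_coin {p : ℝ} (h0 : 0 ≤ p) (h1 : p ≤ 1) (f : Bool → ℝ) :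
    expect (RealRAM.coin p) f = p * f true + (1 - p) * f false := by
  have hp : max 0 (min 1 p) = p := by rw [min_eq_right h1, max_eq_right h0]
  have h2 : 0 ≤ 1 - p := by linarith
  simp only [expect, RealRAM.coin, hp, PMF.ofFintype_apply, Fintype.sum_bool, if_true,
    ENNReal.toReal_ofReal h0, Bool.false_eq_true, if_false, ENNReal.toReal_ofReal h2]

end Expect

/-- The probability that the random set contains `j`. -/
def inclusion (μ : PMF (Finset (Fin m))) (j : Fin m) : ℝ :=
  expect μ fun S => if j ∈ S then 1 else 0

/-! ### Thinning -/

/-- Add the item with index `k` to `S` with probability `p k`. -/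
def addCoin (p : Fin m → ℝ) (k : ℕ) (S : Finset (Fin m)) : PMF (Finset (Fin m)) :=
  if h : k < m then
    (RealRAM.coin (p ⟨k, h⟩)).map fun b => if b then insert ⟨k, h⟩ S else S
  else PMF.pure S

/-- The random set that contains each of the first `k` items `j` independently with probability
`p j`. -/
def coinSet (p : Fin m → ℝ) : ℕ → PMF (Finset (Fin m))
  | 0 => PMF.pure ∅
  | k + 1 => (coinSet p k).bind (addCoin p k)

theorem inclusion_coinSet {p : Fin m → ℝ} (h0 : ∀ j, 0 ≤ p j) (h1 : ∀ j, p j ≤ 1) (j : Fin m)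
    (k : ℕ) : inclusion (coinSet p k) j = if j.1 < k then p j else 0 := by
  induction k with
  | zero => simp [inclusion, coinSet, expect_pure]
  | succ k ih =>
    rw [inclusion, coinSet, expect_bind]
    by_cases hk : k < m
    · have h2 : ∀ S : Finset (Fin m), expect (addCoin p k S) (fun S => if j ∈ S then 1 else 0) =
          if j = ⟨k, hk⟩ then p j + (1 - p j) * (if j ∈ S then 1 else 0)
            else if j ∈ S then 1 else 0 := by
        intro S
        rw [addCoin, dif_pos hk, expect_map, expect_coin (h0 _) (h1 _)]
        by_cases hj : j = ⟨k, hk⟩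
        · subst hj; simp
        · simp [hj]
          split_ifs <;> ring
      simp only [h2]
      by_cases hj : j = ⟨k, hk⟩
      · have hjk : j.1 = k := by rw [hj]
        have h3 : expect (coinSet p k) (fun S => if j ∈ S then (1 : ℝ) else 0) = 0 := by
          rw [← inclusion, ih, if_neg (by omega)]
        simp only [if_pos hj]
        rw [show (fun S : Finset (Fin m) => p j + (1 - p j) * (if j ∈ S then (1 : ℝ) else 0)) =
          fun S => p j - (p j - 1) * (if j ∈ S then (1 : ℝ) else 0) from funext fun S => by ring,
          expect_sub, expect_const, expect_mul_left, h3, if_pos (by omega)]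
        ring
      · have hjk : j.1 ≠ k := fun h => hj (Fin.ext h)
        simp only [if_neg hj]
        rw [← inclusion, ih]
        have : j.1 < k ↔ j.1 < k + 1 := by omega
        simp only [this]
    · have h2 : ∀ S, addCoin p k S = PMF.pure S := fun S => dif_neg hk
      simp only [h2, expect_pure]
      rw [← inclusion, ih, if_pos (by omega), if_pos (by omega)]

theorem ne_zero_of_mem_coinSet {p : Fin m → ℝ} {k : ℕ} {S : Finset (Fin m)}
    (hS : S ∈ (coinSet p k).support) {j : Fin m} (hj : j ∈ S) : p j ≠ 0 := by
  induction k generalizing S with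
  | zero =>
    rw [coinSet, PMF.mem_support_pure_iff] at hS
    subst hS
    simp at hj
  | succ k ih =>
    rw [coinSet, PMF.mem_support_bind_iff] at hS
    obtain ⟨S', hS', hS⟩ := hS
    unfold addCoin at hS
    split_ifs at hS with hk
    · rw [PMF.mem_support_map_iff] at hS
      obtain ⟨b, hb, rfl⟩ := hS
      cases b
      · exact ih hS' (by simpa using hj)
      · rcases Finset.mem_insert.1 (by simpa using hj) with rfl | hj
        · intro h0
          simp [RealRAM.coin, h0] at hb
        · exact ih hS' hj
    · rw [PMF.mem_support_pure_iff] at hS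
      exact ih hS' (hS ▸ hj)

/-- Keep each item `j` of the random set independently with probability `r j`. -/
def thinLaw (μ : PMF (Finset (Fin m))) (r : Fin m → ℝ) : PMF (Finset (Fin m)) :=
  μ.bind fun T => coinSet (fun j => (if j ∈ T then 1 else 0) * r j) m

theorem inclusion_thinLaw (μ : PMF (Finset (Fin m))) {r : Fin m → ℝ} (h0 : ∀ j, 0 ≤ r j)
    (h1 : ∀ j, r j ≤ 1) (j : Fin m) : inclusion (thinLaw μ r) j = inclusion μ j * r j := by
  rw [inclusion, thinLaw, expect_bind]
  have h2 : ∀ T : Finset (Fin m), expect (coinSet (fun j => (if j ∈ T then 1 else 0) * r j) m)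
      (fun S => if j ∈ S then 1 else 0) = r j * if j ∈ T then 1 else 0 := by
    intro T
    rw [← inclusion, inclusion_coinSet, if_pos j.2, mul_comm]
    · intro j; split_ifs <;> simp [h0]
    · intro j; split_ifs <;> simp [h1]
  simp only [h2]
  rw [expect_mul_left, inclusion, mul_comm]

theorem exists_superset_of_mem_thinLaw {μ : PMF (Finset (Fin m))} {r : Fin m → ℝ}
    {S : Finset (Fin m)} (hS : S ∈ (thinLaw μ r).support) : ∃ T ∈ μ.support, S ⊆ T := by
  rw [thinLaw, PMF.mem_support_bind_iff] at hS
  obtain ⟨T, hT, hS⟩ := hS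
  refine ⟨T, hT, fun j hj => ?_⟩
  have := ne_zero_of_mem_coinSet hS hj
  by_contra hjT
  simp [hjT] at this

/-- The factor by which an inclusion probability `y` has to be damped to become `1 - exp (-y)`. -/
def dampFactor (y : ℝ) : ℝ := (1 - Real.exp (-y)) / y

theorem dampFactor_nonneg {y : ℝ} (hy : 0 ≤ y) : 0 ≤ dampFactor y := by
  refine div_nonneg ?_ hy
  rw [sub_nonneg, Real.exp_le_one_iff]
  linarith

theorem dampFactor_le_one {y : ℝ} (hy : 0 ≤ y) : dampFactor y ≤ 1 := by
  refine div_le_one_of_le₀ ?_ hy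
  have := Real.add_one_le_exp (-y)
  linarith

theorem mul_dampFactor (y : ℝ) : y * dampFactor y = 1 - Real.exp (-y) := by
  unfold dampFactor
  by_cases hy : y = 0
  · simp [hy]
  · field_simp

/-! ### The laws of the roundings -/

/-- Draw the sets of the first `k` bins independently from the laws `ν i`. -/
def drawBins (ν : Fin n → PMF (Finset (Fin m))) : ℕ → PMF (Alloc n m)
  | 0 => PMF.pure fun _ => ∅
  | k + 1 => (drawBins ν k).bind fun T =>
      if h : k < n then (ν ⟨k, h⟩).map (Function.update T ⟨k, h⟩) else PMF.pure T

theorem drawBins_apply (ν : Fin n → PMF (Finset (Fin m))) {k : ℕ} (hk : k ≤ n) (T : Alloc n m) :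
    drawBins ν k T = ∏ i : Fin n, if i.1 < k then ν i (T i) else if T i = ∅ then 1 else 0 := by
  classical
  induction k generalizing T with
  | zero =>
    rw [drawBins, PMF.pure_apply]
    split_ifs with h
    · subst h; simp
    · have : ∃ i, T i ≠ ∅ := by
        by_contra h'
        push Not at h'
        exact h (funext h')
      obtain ⟨i, hi⟩ := this
      exact (Finset.prod_eq_zero (Finset.mem_univ i) (by simp [hi])).symm
  | succ k ih =>
    have hkn : k < n := by omega
    set i₀ : Fin n := ⟨k, hkn⟩ with hi₀
    rw [drawBins, PMF.bind_apply]
    simp only [dif_pos hkn, ← hi₀]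
    rw [tsum_eq_single (Function.update T i₀ ∅)]
    · have h1 : ((ν i₀).map (Function.update (Function.update T i₀ ∅) i₀)) T = ν i₀ (T i₀) := by
        rw [PMF.map_apply, tsum_eq_single (T i₀)]
        · simp
        · intro S hS
          rw [if_neg]
          intro h
          apply hS
          have := congrFun h i₀
          simpa using this.symm
      rw [h1, ih (by omega), ← Finset.mul_prod_erase _ _ (Finset.mem_univ i₀),
        ← Finset.mul_prod_erase _ _ (Finset.mem_univ i₀)]
      have h2 : ¬ (i₀.1 < k) := by simp [hi₀]
      have h3 : i₀.1 < k + 1 := by simp [hi₀]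
      rw [if_neg h2, if_pos h3, Function.update_self, if_pos rfl, one_mul, mul_comm]
      congr 1
      refine Finset.prod_congr rfl fun i hi => ?_
      have hne : i ≠ i₀ := (Finset.mem_erase.1 hi).1
      have hne' : i.1 ≠ k := fun h => hne (Fin.ext h)
      rw [Function.update_of_ne hne]
      have : i.1 < k ↔ i.1 < k + 1 := by omega
      simp only [this]
    · intro T' hT'
      by_cases h0 : T' i₀ = ∅
      · have : ((ν i₀).map (Function.update T' i₀)) T = 0 := by
          rw [PMF.map_apply, ENNReal.tsum_eq_zero]
          intro S
          rw [if_neg]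
          rintro rfl
          apply hT'
          rw [Function.update_idem, ← h0, Function.update_eq_self]
        rw [this, mul_zero]
      · have : drawBins ν k T' = 0 := by
          rw [ih (by omega)]
          refine Finset.prod_eq_zero (Finset.mem_univ i₀) ?_
          have h2 : ¬ (i₀.1 < k) := by simp [hi₀]
          rw [if_neg h2, if_neg h0]
        rw [this, zero_mul]

namespace PublicData

variable (G : PublicData n m)

theorem jointLaw_apply (x : G.polytope) (T : Alloc n m) :
    G.jointLaw x T = ∏ i, G.binLaw x i (T i) := rfl

theorem jointLaw_eq_drawBins (x : G.polytope) : G.jointLaw x = drawBins (G.binLaw x) n := by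
  ext T
  rw [drawBins_apply _ le_rfl, jointLaw_apply]
  exact Finset.prod_congr rfl fun i _ => (if_pos i.2).symm

theorem binLaw_apply_of_ne (x : G.polytope) (i : Fin n) {S : Finset (Fin m)} (hS : S ≠ ∅) :
    G.binLaw x i S = ENNReal.ofReal (x.1 i S) := by
  simp [binLaw, hS]

theorem fits_of_mem_binLaw (x : G.polytope) {i : Fin n} {S : Finset (Fin m)}
    (hS : S ∈ (G.binLaw x i).support) : G.Fits i S := by
  by_cases h : S = ∅
  · rw [h]; exact G.fits_empty i
  · by_contra hf
    rw [PMF.mem_support_iff, G.binLaw_apply_of_ne x i h, x.2.2.1 i S hf] at hS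
    simp at hS

theorem inclusion_binLaw (x : G.polytope) (i : Fin n) (j : Fin m) :
    inclusion (G.binLaw x i) j = marginal x.1 i j := by
  rw [inclusion, expect, marginal, Finset.sum_filter]
  refine Finset.sum_congr rfl fun S _ => ?_
  split_ifs with h
  · rw [G.binLaw_apply_of_ne x i (Finset.ne_empty_of_mem h), mul_one,
      ENNReal.toReal_ofReal (x.2.1 i S)]
  · simp

/-- A family of laws of sets, one for each bin, as a point of the polytope. -/
theorem exists_binLaw_eq {ν : Fin n → PMF (Finset (Fin m))}
    (hν : ∀ i, ∀ S ∈ (ν i).support, G.Fits i S) : ∃ x : G.polytope, ∀ i, G.binLaw x i = ν i := by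
  refine ⟨⟨fun i S => (ν i S).toReal, fun _ _ => ENNReal.toReal_nonneg, fun i S hS => ?_,
    fun i => (sum_toReal _).le⟩, fun i => ?_⟩
  · by_contra h
    refine hS (hν i S fun h0 => h ?_)
    simp [h0]
  · ext S
    by_cases hS : S = ∅
    · subst hS
      have h1 := sum_toReal (ν i)
      rw [← Finset.sum_filter_add_sum_filter_not _ (fun T => T ≠ ∅)] at h1
      simp only [ne_eq, not_not, Finset.filter_eq', Finset.mem_univ, if_true,
        Finset.sum_singleton] at h1
      simp only [binLaw, PMF.ofFintype_apply, if_true, ne_eq]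
      rw [← ENNReal.ofReal_toReal ((ν i).apply_ne_top ∅)]
      congr 1
      linarith
    · rw [binLaw_apply_of_ne _ _ _ hS, ENNReal.ofReal_toReal ((ν i).apply_ne_top S)]

/-- Drawing the set of every bin from some law and damping it by thinning is a rounding. -/
theorem isRounding_of_thinLaw {x : Fin n → Finset (Fin m) → ℝ} (hx : ∀ i S, 0 ≤ x i S)
    {μ : Fin n → PMF (Finset (Fin m))} (hμ : ∀ i, ∀ S ∈ (μ i).support, G.Fits i S)
    (hm : ∀ i j, inclusion (μ i) j = marginal x i j) (π : Fin m → Equiv.Perm (Fin n)) :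
    G.IsRounding x π ((drawBins (fun i => thinLaw (μ i) fun j => dampFactor (marginal x i j)) n).map
      (resolve π)) := by
  have hmx := marginal_nonneg hx
  obtain ⟨x', hx'⟩ := G.exists_binLaw_eq
    (ν := fun i => thinLaw (μ i) fun j => dampFactor (marginal x i j)) fun i S hS => by
      obtain ⟨T, hT, hST⟩ := exists_superset_of_mem_thinLaw hS
      exact (hμ i T hT).mono hST
  refine ⟨x', fun i j => ?_, ?_⟩
  · rw [← G.inclusion_binLaw, hx', inclusion_thinLaw, hm, mul_dampFactor]
    · exact fun j => dampFactor_nonneg (hmx i j)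
    · exact fun j => dampFactor_le_one (hmx i j)
  · rw [roundLaw, G.jointLaw_eq_drawBins]
    congr 2
    exact (funext hx').symm

theorem exists_isDamping {x : Fin n → Finset (Fin m) → ℝ} (hx : x ∈ G.polytope) :
    ∃ x' ∈ G.polytope, IsDamping x x' := by
  obtain ⟨x', h, -⟩ := G.isRounding_of_thinLaw hx.1 (μ := G.binLaw ⟨x, hx⟩)
    (fun i S => G.fits_of_mem_binLaw _) (fun i j => G.inclusion_binLaw _ i j) fun _ => 1
  exact ⟨x'.1, x'.2, h⟩

theorem fits_of_mem_jointLaw (x : G.polytope) {T : Alloc n m} (hT : T ∈ (G.jointLaw x).support)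
    (i : Fin n) : G.Fits i (T i) := by
  refine G.fits_of_mem_binLaw x (i := i) ?_
  rw [PMF.mem_support_iff] at hT ⊢
  rw [jointLaw_apply] at hT
  exact fun h => hT (Finset.prod_eq_zero (Finset.mem_univ i) h)

/-- The bins are independent. -/
theorem expect_jointLaw_prod (x : G.polytope) (f : Fin n → Finset (Fin m) → ℝ) :
    expect (G.jointLaw x) (fun T => ∏ i, f i (T i)) = ∏ i, expect (G.binLaw x i) (f i) := by
  simp only [expect, Finset.prod_univ_sum, Fintype.piFinset_univ, jointLaw_apply,
    ENNReal.toReal_prod, ← Finset.prod_mul_distrib]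

theorem mem_resolve {π : Fin m → Equiv.Perm (Fin n)} {T : Alloc n m} {i : Fin n} {j : Fin m} :
    j ∈ resolve π T i ↔ j ∈ T i ∧ ∀ k, j ∈ T k → (π j).symm i ≤ (π j).symm k := by
  simp [resolve]

theorem feasible_resolve {T : Alloc n m} (hT : ∀ i, G.Fits i (T i))
    (π : Fin m → Equiv.Perm (Fin n)) : G.Feasible (resolve π T) := by
  refine ⟨fun i => (hT i).mono (Finset.filter_subset _ _), fun i k hik => ?_⟩
  refine Finset.disjoint_left.2 fun j hi hk => hik ?_
  rw [mem_resolve] at hi hk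
  exact (π j).symm.injective (le_antisymm (hi.2 k hk.1) (hk.2 i hi.1))

theorem feasible_of_mem_roundingRange {D : PMF (Alloc n m)} (hD : D ∈ G.roundingRange)
    {S : Alloc n m} (hS : S ∈ D.support) : G.Feasible S := by
  obtain ⟨x, -, π, x', -, rfl⟩ := hD
  rw [roundLaw, PMF.mem_support_map_iff] at hS
  obtain ⟨T, hT, rfl⟩ := hS
  exact G.feasible_resolve (G.fits_of_mem_jointLaw x' hT) π

theorem welfare_of_feasible {v : Values n m} {S : Alloc n m} (hS : G.Feasible S) :
    G.welfare v S = ∑ j, ∑ i, if j ∈ S i then v i j else 0 := by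
  rw [Finset.sum_comm]
  refine Finset.sum_congr rfl fun i _ => ?_
  simp [binValue, hS.1 i]

/-- For each item, resolving conflicts greedily is at least as good as any other resolution. -/
theorem welfare_resolve_le {v : Values n m} {T : Alloc n m} (hT : ∀ i, G.Fits i (T i))
    (π : Fin m → Equiv.Perm (Fin n)) {σ : Fin m → Equiv.Perm (Fin n)} (hσ : IsGreedyOrder v σ) :
    G.welfare v (resolve π T) ≤ G.welfare v (resolve σ T) := by
  have winner : ∀ (π : Fin m → Equiv.Perm (Fin n)) (j : Fin m), (∃ i, j ∈ T i) →
      ∃ w, j ∈ T w ∧ (∀ k, j ∈ T k → (π j).symm w ≤ (π j).symm k) ∧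
        ∑ i, (if j ∈ resolve π T i then v i j else 0) = v w j := by
    rintro π j ⟨i, hi⟩
    obtain ⟨w, hw, hmin⟩ := Finset.exists_min_image {k | j ∈ T k} (π j).symm
      ⟨i, by simpa using hi⟩
    simp only [Finset.mem_filter, Finset.mem_univ, true_and] at hw hmin
    refine ⟨w, hw, hmin, ?_⟩
    rw [Finset.sum_eq_single w, if_pos (mem_resolve.2 ⟨hw, hmin⟩)]
    · intro k _ hk
      refine if_neg fun h => Finset.disjoint_left.1 ((G.feasible_resolve hT π).2 k w hk) h ?_
      exact mem_resolve.2 ⟨hw, hmin⟩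
    · simp
  rw [G.welfare_of_feasible (G.feasible_resolve hT π),
    G.welfare_of_feasible (G.feasible_resolve hT σ)]
  refine Finset.sum_le_sum fun j _ => ?_
  by_cases hj : ∃ i, j ∈ T i
  · obtain ⟨w, hw, -, h1⟩ := winner π j hj
    obtain ⟨w', -, hmin, h2⟩ := winner σ j hj
    rw [h1, h2]
    simpa using hσ j (hmin w hw)
  · push Not at hj
    rw [Finset.sum_eq_zero, Finset.sum_eq_zero] <;>
    · intro i _
      exact if_neg fun h => hj i (mem_resolve.1 h).1

theorem expWelfare_roundLaw (v : Values n m) (x' : G.polytope) (π : Fin m → Equiv.Perm (Fin n)) :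
    G.expWelfare v (G.roundLaw x' π) =
      expect (G.jointLaw x') fun T => G.welfare v (resolve π T) :=
  expect_map (G.jointLaw x') (resolve π) (G.welfare v)

/-- The expected welfare of the greedy rounding for the standard tie-breaking. -/
theorem expWelfare_greedyOrder (v : Values n m) {x : Fin n → Finset (Fin m) → ℝ}
    {x' : G.polytope} (h : IsDamping x x'.1) :
    G.expWelfare v (G.roundLaw x' (greedyOrder v)) = objective v (marginal x) := by
  classical
  rw [G.expWelfare_roundLaw]
  have h1 : expect (G.jointLaw x') (fun T => G.welfare v (resolve (greedyOrder v) T)) =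
      expect (G.jointLaw x') fun T => ∑ j, ∑ i, v i j * ∏ k,
        (if k = i then (if j ∈ T k then 1 else 0) else
          if Precedes v j k i then 1 - (if j ∈ T k then 1 else 0) else 1) := by
    refine Finset.sum_congr rfl fun T _ => ?_
    by_cases hT : T ∈ (G.jointLaw x').support
    · beta_reduce
      rw [G.welfare_of_feasible (G.feasible_resolve (G.fits_of_mem_jointLaw x' hT) _)]
      congr 1
      refine Finset.sum_congr rfl fun j _ => Finset.sum_congr rfl fun i _ => ?_
      by_cases hw : j ∈ resolve (greedyOrder v) T i
      · rw [if_pos hw, Finset.prod_eq_one, mul_one]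
        rw [mem_resolve] at hw
        intro k _
        by_cases hki : k = i
        · rw [if_pos hki, hki, if_pos hw.1]
        · rw [if_neg hki]
          split_ifs with h2 h3
          · exact absurd ((greedyOrder v j).symm.injective (le_antisymm h2 (hw.2 k h3))) hki
          · simp
          · rfl
      · rw [if_neg hw]
        rw [mem_resolve, not_and] at hw
        by_cases hi : j ∈ T i
        · have := hw hi
          push Not at this
          obtain ⟨k, hk, hlt⟩ := this
          have hki : k ≠ i := by rintro rfl; exact lt_irrefl _ hlt
          rw [Finset.prod_eq_zero (Finset.mem_univ k), mul_zero]
          rw [if_neg hki, if_pos (show Precedes v j k i from hlt.le), if_pos hk, sub_self]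
        · rw [Finset.prod_eq_zero (Finset.mem_univ i), mul_zero]
          rw [if_pos rfl, if_neg hi]
    · rw [PMF.mem_support_iff, not_not] at hT
      simp [hT]
  rw [h1, expect_sum, objective_eq_survival]
  refine Finset.sum_congr rfl fun j _ => ?_
  rw [expect_sum, ← Equiv.sum_comp (greedyOrder v j)]
  refine Finset.sum_congr rfl fun p _ => ?_
  set i := greedyOrder v j p with hi
  rw [expect_mul_left, G.expect_jointLaw_prod x' fun k S =>
    if k = i then (if j ∈ S then 1 else 0) else
      if Precedes v j k i then 1 - (if j ∈ S then 1 else 0) else 1]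
  congr 1
  have hy : ∀ k, inclusion (G.binLaw x' k) j = 1 - Real.exp (-marginal x k j) := fun k => by
    rw [G.inclusion_binLaw, h]
  have h2 : ∀ k, expect (G.binLaw x' k) (fun S => if k = i then (if j ∈ S then (1 : ℝ) else 0) else
      if Precedes v j k i then 1 - (if j ∈ S then 1 else 0) else 1) =
      (if k = i then Real.exp (marginal x k j) - 1 else 1) *
        if Precedes v j k i then Real.exp (-marginal x k j) else 1 := by
    intro k
    by_cases hk : k = i
    · have hp : Precedes v j k i := by rw [hk]; exact le_rfl
      simp only [if_pos hk, if_pos hp]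
      rw [← inclusion, hy, sub_mul, ← Real.exp_add]
      simp
    · simp only [if_neg hk, one_mul]
      split_ifs
      · rw [expect_sub, expect_const, ← inclusion, hy]
        ring
      · exact expect_const _ _
  rw [Finset.prod_congr rfl fun k _ => h2 k, Finset.prod_mul_distrib,
    Finset.prod_ite_eq' Finset.univ i, if_pos (Finset.mem_univ i)]
  have h3 : ∏ k, (if Precedes v j k i then Real.exp (-marginal x k j) else 1) =
      survival v (marginal x) j (p + 1) := by
    rw [survival_succ, show p = (greedyOrder v j).symm i by simp [hi], cumul_symm,
      ← Finset.sum_neg_distrib, Real.exp_sum]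
    refine Finset.prod_congr rfl fun k _ => ?_
    split_ifs <;> simp
  rw [h3, survival_eq_mul v _ j p, amountAt_fin]
  ring

theorem expWelfare_le_objective {v : Values n m} {x : Fin n → Finset (Fin m) → ℝ}
    {π : Fin m → Equiv.Perm (Fin n)} {D : PMF (Alloc n m)} (hD : G.IsRounding x π D) :
    G.expWelfare v D ≤ objective v (marginal x) := by
  obtain ⟨x', h, rfl⟩ := hD
  rw [← G.expWelfare_greedyOrder v h, expWelfare_roundLaw, expWelfare_roundLaw]
  exact expect_le _ fun T hT => G.welfare_resolve_le (G.fits_of_mem_jointLaw x' hT) π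
    (isGreedyOrder_greedyOrder v)

theorem expWelfare_eq_objective {v : Values n m} {x : Fin n → Finset (Fin m) → ℝ}
    {π : Fin m → Equiv.Perm (Fin n)} (hπ : IsGreedyOrder v π) {D : PMF (Alloc n m)}
    (hD : G.IsRounding x π D) : G.expWelfare v D = objective v (marginal x) := by
  refine le_antisymm (G.expWelfare_le_objective hD) ?_
  obtain ⟨x', h, rfl⟩ := hD
  rw [← G.expWelfare_greedyOrder v h, expWelfare_roundLaw, expWelfare_roundLaw]
  exact expect_le _ fun T hT => G.welfare_resolve_le (G.fits_of_mem_jointLaw x' hT) _ hπ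

end PublicData

end

end GAP

namespace GAP

noncomputable section

/-! ### The knapsack approximation scheme -/

section Knapsack

variable (C : ℝ) (w : ℕ → ℝ) (q : ℕ → ℕ)

open Classical in
/-- The least weight of a set of items among the first `j` with total rounded value exactly `p`.
The value `C + 1` stands for infinity: nothing of weight more than the capacity `C` matters. -/
def minWeight : ℕ → ℕ → ℝ
  | 0, p => if p = 0 then 0 else C + 1
  | j + 1, p =>
    if ¬ p < q j ∧ minWeight j (p - q j) + w j < minWeight j p then minWeight j (p - q j) + w j
    else minWeight j p

/-- The optimal set among the first `j + 1` items of rounded value `p` contains item `j`. -/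
def Takes (j p : ℕ) : Prop :=
  ¬ p < q j ∧ minWeight C w q j (p - q j) + w j < minWeight C w q j p

open Classical in
/-- The optimal set, found by backtracking. -/
def trace : ℕ → ℕ → Finset ℕ
  | 0, _ => ∅
  | j + 1, p => if Takes C w q j p then insert j (trace j (p - q j)) else trace j p

theorem minWeight_succ_of_takes {j p : ℕ} (h : Takes C w q j p) :
    minWeight C w q (j + 1) p = minWeight C w q j (p - q j) + w j := if_pos h

theorem minWeight_succ_of_not_takes {j p : ℕ} (h : ¬ Takes C w q j p) :
    minWeight C w q (j + 1) p = minWeight C w q j p := if_neg h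

theorem trace_succ_of_takes {j p : ℕ} (h : Takes C w q j p) :
    trace C w q (j + 1) p = insert j (trace C w q j (p - q j)) := if_pos h

theorem trace_succ_of_not_takes {j p : ℕ} (h : ¬ Takes C w q j p) :
    trace C w q (j + 1) p = trace C w q j p := if_neg h

theorem lt_of_mem_trace {j p k : ℕ} (h : k ∈ trace C w q j p) : k < j := by
  induction j generalizing p with
  | zero => simp [trace] at h
  | succ j ih =>
    by_cases ht : Takes C w q j p
    · rw [trace_succ_of_takes C w q ht, Finset.mem_insert] at h
      rcases h with rfl | h
      · exact Nat.lt_succ_self _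
      · exact (ih h).trans (Nat.lt_succ_self _)
    · rw [trace_succ_of_not_takes C w q ht] at h
      exact (ih h).trans (Nat.lt_succ_self _)

theorem minWeight_le (j : ℕ) {S : Finset ℕ} (hS : S ⊆ Finset.range j) :
    minWeight C w q j (∑ k ∈ S, q k) ≤ ∑ k ∈ S, w k := by
  induction j generalizing S with
  | zero =>
    obtain rfl : S = ∅ := by simpa using hS
    simp [minWeight]
  | succ j ih =>
    have hsub : S.erase j ⊆ Finset.range j := by
      intro k hk
      have h1 := Finset.mem_erase.1 hk
      have h2 := Finset.mem_range.1 (hS h1.2)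
      exact Finset.mem_range.2 (by omega)
    by_cases hj : j ∈ S
    · have hq := Finset.add_sum_erase S q hj
      have hw := Finset.add_sum_erase S w hj
      have h1 := ih hsub
      set p := ∑ k ∈ S, q k with hp
      have h2 : p - q j = ∑ k ∈ S.erase j, q k := by omega
      rw [← h2] at h1
      by_cases ht : Takes C w q j p
      · rw [minWeight_succ_of_takes C w q ht]
        linarith
      · rw [minWeight_succ_of_not_takes C w q ht]
        have h3 : ¬ p < q j := by omega
        have h4 : minWeight C w q j p ≤ minWeight C w q j (p - q j) + w j :=
          not_lt.1 fun h => ht ⟨h3, h⟩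
        linarith
    · rw [Finset.erase_eq_of_notMem hj] at hsub
      refine le_trans ?_ (ih hsub)
      by_cases ht : Takes C w q j (∑ k ∈ S, q k)
      · rw [minWeight_succ_of_takes C w q ht]
        exact ht.2.le
      · rw [minWeight_succ_of_not_takes C w q ht]

theorem trace_spec (hw : ∀ k, 0 ≤ w k) {j p : ℕ} (h : minWeight C w q j p ≤ C) :
    ∑ k ∈ trace C w q j p, q k = p ∧ ∑ k ∈ trace C w q j p, w k = minWeight C w q j p := by
  induction j generalizing p with
  | zero =>
    by_cases hp : p = 0
    · simp [trace, minWeight, hp]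
    · simp only [minWeight, if_neg hp] at h
      linarith
  | succ j ih =>
    by_cases ht : Takes C w q j p
    · rw [minWeight_succ_of_takes C w q ht] at h ⊢
      have hj : j ∉ trace C w q j (p - q j) := fun h => lt_irrefl _ (lt_of_mem_trace C w q h)
      obtain ⟨h1, h2⟩ := ih (p := p - q j) (by linarith [hw j])
      have h3 := ht.1
      rw [trace_succ_of_takes C w q ht, Finset.sum_insert hj, Finset.sum_insert hj, h1, h2]
      exact ⟨by omega, by ring⟩
    · rw [minWeight_succ_of_not_takes C w q ht] at h ⊢
      rw [trace_succ_of_not_takes C w q ht]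
      exact ih h

end Knapsack

variable {n m : ℕ}

/-- A finite set of natural numbers as a set of items. -/
def itemsOf (m : ℕ) (S : Finset ℕ) : Finset (Fin m) := {j | j.1 ∈ S}

theorem sum_itemsOf {M : Type*} [AddCommMonoid M] {S : Finset ℕ} (hS : ∀ k ∈ S, k < m)
    (f : ℕ → M) : ∑ j ∈ itemsOf m S, f j = ∑ k ∈ S, f k := by
  refine (Finset.sum_map (itemsOf m S) Fin.valEmbedding f).symm.trans
    (Finset.sum_congr ?_ fun _ _ => rfl)
  ext k
  simp only [itemsOf, Finset.mem_map, Finset.mem_filter, Finset.mem_univ, true_and,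
    Fin.valEmbedding_apply]
  exact ⟨fun ⟨j, hj, h⟩ => h ▸ hj, fun h => ⟨⟨k, hS k h⟩, h, rfl⟩⟩

/-- Values are rounded down to multiples of `θ = η U / m`, where `U` is the largest value of an
item that fits, and the rounded problem is solved exactly. The rounded values `q j` are cut off at
`K ≥ m / η`, which affects only items that do not fit. -/
theorem knapsack_approx (G : PublicData n m) (i : Fin n) {η U θ : ℝ} {K P : ℕ} {w u : ℕ → ℝ}
    {q : ℕ → ℕ} (hη : 0 < η) (hη1 : η ≤ 1) (hw0 : ∀ k, 0 ≤ w k)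
    (hw : ∀ j : Fin m, w j = G.weight i j)
    (hu : ∀ j : Fin m, 0 ≤ u j) (hK : m / η ≤ K) (hθ : θ = η * U / m)
    (hU : ∀ j : Fin m, G.Fits i {j} → u j ≤ U)
    (hU' : U = 0 ∨ ∃ j : Fin m, G.Fits i {j} ∧ U = u j)
    (hq1 : ∀ j : Fin m, q j ≤ K) (hq2 : ∀ j : Fin m, q j * θ ≤ u j)
    (hq3 : ∀ j : Fin m, q j < K → u j < (q j + 1) * θ)
    (hP : minWeight (G.capacity i) w q m P ≤ G.capacity i)
    (hP' : ∀ p ≤ m * K, minWeight (G.capacity i) w q m p ≤ G.capacity i → p ≤ P) :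
    G.Fits i (itemsOf m (trace (G.capacity i) w q m P)) ∧
      ∀ S, G.Fits i S → (1 - η) * ∑ j ∈ S, u j ≤
        ∑ j ∈ itemsOf m (trace (G.capacity i) w q m P), u j := by
  set R := trace (G.capacity i) w q m P with hR
  have hRm : ∀ k ∈ R, k < m := fun k hk => lt_of_mem_trace _ _ _ hk
  obtain ⟨hRq, hRw⟩ := trace_spec (G.capacity i) w q hw0 hP
  have hU0 : 0 ≤ U := by
    rcases hU' with h | ⟨j, -, h⟩
    · exact h.ge
    · exact h ▸ hu j
  have hθ0 : 0 ≤ θ := by rw [hθ]; positivity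
  constructor
  · unfold PublicData.Fits
    simp only [← hw]
    rw [sum_itemsOf hRm w, hRw]
    exact hP
  have hlow : P * θ ≤ ∑ j ∈ itemsOf m R, u j := by
    rw [← hRq, ← sum_itemsOf hRm q, Nat.cast_sum, Finset.sum_mul]
    exact Finset.sum_le_sum fun j _ => hq2 j
  -- If `q j` was cut off at `K`, then `u j ≤ U ≤ K θ` because item `j` fits.
  have hup : ∀ j : Fin m, G.Fits i {j} → u j ≤ (q j + 1) * θ := by
    intro j hj
    rcases (hq1 j).lt_or_eq with h | h
    · exact (hq3 j h).le
    · have hm : (0 : ℝ) < m := by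
        have := j.2
        exact_mod_cast (by omega : 0 < m)
      have h1 : U ≤ K * θ := by
        calc U = m / η * θ := by rw [hθ]; field_simp
          _ ≤ K * θ := mul_le_mul_of_nonneg_right hK hθ0
      rw [h]
      linarith [hU j hj]
  have key : ∀ S, G.Fits i S → ∑ j ∈ S, u j - η * U ≤ ∑ j ∈ itemsOf m R, u j := by
    intro S hS
    have h1 : ∑ j ∈ S, u j ≤ ∑ j ∈ S, ((q j : ℝ) + 1) * θ :=
      Finset.sum_le_sum fun j hj => hup j (hS.mono (by simpa using hj))
    have h2 : ∑ j ∈ S, q j ≤ P := by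
      refine hP' _ ?_ ?_
      · refine (Finset.sum_le_card_nsmul S _ K fun j _ => hq1 j).trans ?_
        rw [smul_eq_mul]
        exact Nat.mul_le_mul_right _ ((Finset.card_le_univ S).trans (by simp))
      · have h3 := minWeight_le (G.capacity i) w q m (S := S.map Fin.valEmbedding) (by
          intro k hk
          obtain ⟨j, -, rfl⟩ := Finset.mem_map.1 hk
          exact Finset.mem_range.2 j.2)
        rw [Finset.sum_map, Finset.sum_map] at h3
        simp only [Fin.valEmbedding_apply, hw] at h3
        exact h3.trans hS
    have h3 : (S.card : ℝ) * θ ≤ η * U := by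
      rcases Nat.eq_zero_or_pos m with hm | hm
      · subst hm
        have : S.card = 0 := by simpa using Finset.card_le_univ S
        rw [this, Nat.cast_zero, zero_mul]
        positivity
      · have hm' : (0 : ℝ) < m := by exact_mod_cast hm
        have h4 : (S.card : ℝ) ≤ m := by exact_mod_cast (Finset.card_le_univ S).trans (by simp)
        calc _ ≤ m * θ := mul_le_mul_of_nonneg_right h4 hθ0
          _ = η * U := by rw [hθ]; field_simp
    have h4 : ∑ j ∈ S, ((q j : ℝ) + 1) * θ = (∑ j ∈ S, q j : ℕ) * θ + S.card * θ := by
      rw [← Finset.sum_mul, Finset.sum_add_distrib]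
      push_cast
      simp only [Finset.sum_const, nsmul_eq_mul, mul_one]
      ring
    have h5 : ((∑ j ∈ S, q j : ℕ) : ℝ) * θ ≤ P * θ :=
      mul_le_mul_of_nonneg_right (by exact_mod_cast h2) hθ0
    linarith
  intro S hS
  have h1 := key S hS
  -- The single item of value `U` is one of the competitors.
  have h2 : U - η * U ≤ ∑ j ∈ itemsOf m R, u j := by
    rcases hU' with h | ⟨j, hj, h⟩
    · rw [h]
      simpa using Finset.sum_nonneg fun (j : Fin m) (_ : j ∈ itemsOf m R) => hu j
    · have := key {j} hj
      rwa [Finset.sum_singleton, ← h] at this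
  rcases le_total U (∑ j ∈ S, u j) with h | h
  · have := mul_le_mul_of_nonneg_left h hη.le
    linarith
  · have := mul_le_mul_of_nonneg_left h (show 0 ≤ 1 - η by linarith)
    linarith

end

end GAP

namespace RealRAM

noncomputable section

/-! ### Nested loops and sums -/

/-- A doubly nested counting loop. -/
def forLoop₂ (ci bi cj bj : ℕ) (P : Prog) : Prog := forLoop ci bi (forLoop cj bj P)

/-- A doubly nested loop that completes the task `Φ i j` at each pair of indices and preserves
`I`. -/
theorem Wp.forLoop₂_invariant {ci bi cj bj : ℕ} {P : Prog} {s₀ : Memory} {B L N M : ℕ}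
    {An Ar : List ℕ} (I : Memory → Prop) (Φ : Fin N → Fin M → Memory → Prop)
    (hN : s₀.nat bi 0 0 0 = N) (hM : s₀.nat bj 0 0 0 = M)
    (hNL : N ≤ L) (hML : M ≤ L) (hci : ci ∉ cj :: An) (hbi : bi ∉ ci :: cj :: An) (hcj : cj ∉ An)
    (hbj : bj ∉ ci :: cj :: An) (h0 : I s₀)
    (hI : ∀ s c x, c = ci ∨ c = cj → I s → I (s.writeNat c 0 0 0 x))
    (hΦ : ∀ i j s c x, c = ci ∨ c = cj → Φ i j s → Φ i j (s.writeNat c 0 0 0 x))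
    (hP : ∀ (i : Fin N) (j : Fin M) s, Frame s₀ s (ci :: cj :: An) Ar → s.nat ci 0 0 0 = i →
      s.nat cj 0 0 0 = j → I s → Wp P s B fun s' => Frame s s' An Ar ∧ I s' ∧ Φ i j s' ∧
        ∀ i' j', ¬ (i'.1 = i.1 ∧ j'.1 = j.1) → Φ i' j' s → Φ i' j' s') :
    Wp (forLoop₂ ci bi cj bj P) s₀ (loopCost L (loopCost L B)) fun s' =>
      Frame s₀ s' (ci :: cj :: An) Ar ∧ I s' ∧ ∀ i j, Φ i j s' := by
  refine (Wp.forLoop (fun k s => I s ∧ ∀ (i : Fin N) j, i.1 < k → Φ i j s) hN hNL hci hbi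
    ⟨h0, fun i j hi => absurd hi (Nat.not_lt_zero _)⟩
    (fun k s x h => ⟨hI s ci x (Or.inl rfl) h.1,
      fun i j hi => hΦ i j s ci x (Or.inl rfl) (h.2 i j hi)⟩)
    ?_).imp fun s' h => ⟨h.1, h.2.1, fun i j => h.2.2 i j i.2⟩
  rintro k s hk hf hc ⟨hIs, hJ⟩
  have hM' : s.nat bj 0 0 0 = M := by rw [hf.1 bj hbj, hM]
  refine (Wp.forLoop (fun k' s => I s ∧ ∀ (i : Fin N) (j : Fin M),
    i.1 < k ∨ i.1 = k ∧ j.1 < k' → Φ i j s) hM' hML hcj (fun h => hbj (List.mem_cons_of_mem _ h))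
    ⟨hIs, fun i j h => hJ i j (by omega)⟩
    (fun k' s x h => ⟨hI s cj x (Or.inr rfl) h.1,
      fun i j hi => hΦ i j s cj x (Or.inr rfl) (h.2 i j hi)⟩) ?_).imp
    fun s' h => ⟨h.1, h.2.1, fun i j hi => h.2.2 i j (by omega)⟩
  rintro k' s' hk' hf' hc' ⟨hIs', hJ'⟩
  refine (hP ⟨k, hk⟩ ⟨k', hk'⟩ s' (hf.trans (hf'.mono (fun a ha => by
    simp only [List.mem_cons] at ha ⊢; tauto) fun a ha => ha)) ?_ hc' hIs').imp ?_
  · rw [hf'.1 ci hci, hc]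
  · rintro s'' ⟨h1, h1', h2, h3⟩
    refine ⟨h1, h1', fun i j hij => ?_⟩
    by_cases he : i.1 = k ∧ j.1 = k'
    · have hi : i = ⟨k, hk⟩ := Fin.ext he.1
      have hj : j = ⟨k', hk'⟩ := Fin.ext he.2
      rw [hi, hj]
      exact h2
    · exact h3 i j he (hJ' i j (by omega))

theorem Wp.forLoop₂ {ci bi cj bj : ℕ} {P : Prog} {s₀ : Memory} {B L N M : ℕ} {An Ar : List ℕ}
    (Φ : Fin N → Fin M → Memory → Prop) (hN : s₀.nat bi 0 0 0 = N) (hM : s₀.nat bj 0 0 0 = M)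
    (hNL : N ≤ L) (hML : M ≤ L) (hci : ci ∉ cj :: An) (hbi : bi ∉ ci :: cj :: An) (hcj : cj ∉ An)
    (hbj : bj ∉ ci :: cj :: An)
    (hΦ : ∀ i j s c x, c = ci ∨ c = cj → Φ i j s → Φ i j (s.writeNat c 0 0 0 x))
    (hP : ∀ (i : Fin N) (j : Fin M) s, Frame s₀ s (ci :: cj :: An) Ar → s.nat ci 0 0 0 = i →
      s.nat cj 0 0 0 = j → Wp P s B fun s' => Frame s s' An Ar ∧ Φ i j s' ∧
        ∀ i' j', ¬ (i'.1 = i.1 ∧ j'.1 = j.1) → Φ i' j' s → Φ i' j' s') :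
    Wp (forLoop₂ ci bi cj bj P) s₀ (loopCost L (loopCost L B)) fun s' =>
      Frame s₀ s' (ci :: cj :: An) Ar ∧ ∀ i j, Φ i j s' :=
  (Wp.forLoop₂_invariant (fun _ => True) Φ hN hM hNL hML hci hbi hcj hbj trivial
    (fun _ _ _ _ _ => trivial) hΦ fun i j s hf hi hj _ => (hP i j s hf hi hj).imp
      fun _ h => ⟨h.1, trivial, h.2⟩).imp fun _ h => ⟨h.1, h.2.2⟩

theorem sum_ite_lt_succ {N k : ℕ} (hk : k < N) (g : Fin N → ℝ) :
    ∑ l : Fin N, (if l.1 < k + 1 then g l else 0) =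
      (∑ l : Fin N, if l.1 < k then g l else 0) + g ⟨k, hk⟩ := by
  rw [← Finset.add_sum_erase _ _ (Finset.mem_univ (⟨k, hk⟩ : Fin N)),
    ← Finset.add_sum_erase (a := (⟨k, hk⟩ : Fin N))
      (f := fun l : Fin N => if l.1 < k then g l else 0) _ (Finset.mem_univ _)]
  simp only [lt_add_iff_pos_right, zero_lt_one, if_true, lt_irrefl, if_false, zero_add]
  rw [add_comm]
  congr 1
  refine Finset.sum_congr rfl fun l hl => ?_
  have hne : l.1 ≠ k := fun h => (Finset.mem_erase.1 hl).1 (Fin.ext h)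
  have : l.1 < k + 1 ↔ l.1 < k := by omega
  simp only [this]

/-- `for c = 0, …, b - 1 do if t then r₈ := r₈ + e`. -/
def accumulate (c b : ℕ) (t : Test) (e : RExpr) : Prog :=
  forLoop c b (.ite t (letReal 8 (.add (rvar 8) e)) (letReal 8 (rvar 8)))

open Classical in
theorem Wp.accumulate {c b : ℕ} {t : Test} {e : RExpr} {s₀ : Memory} {L N : ℕ} (p : Fin N → Prop)
    (f : Fin N → ℝ) (hN : s₀.nat b 0 0 0 = N) (hL : N ≤ L) (hbc : b ≠ c)
    (he : ∀ (k : Fin N) s, Frame s₀ s [c] [8] → s.nat c 0 0 0 = k →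
      (t.Holds s ↔ p k) ∧ (p k → e.eval s = f k)) :
    Wp (accumulate c b t e) s₀ (loopCost L (1 + 1)) fun s' => Frame s₀ s' [c] [8] ∧
      s'.real 8 0 0 0 = s₀.real 8 0 0 0 + ∑ k, if p k then f k else 0 := by
  refine (Wp.forLoop (An := []) (Ar := [8]) (fun k s => s.real 8 0 0 0 = s₀.real 8 0 0 0 +
    ∑ l : Fin N, if l.1 < k then if p l then f l else 0 else 0) hN hL (by simp) (by simpa using hbc)
    (by simp) (fun k s x h => h) ?_).imp fun s' h => ⟨h.1, by rw [h.2]; simp⟩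
  intro k s hk hf hc hJ
  obtain ⟨h1, h2⟩ := he ⟨k, hk⟩ s hf hc
  have hsum := sum_ite_lt_succ hk fun l => if p l then f l else 0
  refine Wp.ite (fun ht => Wp.setReal ?_) fun ht => Wp.setReal ?_
  · refine ⟨Frame.writeReal _ _ _ _ _ (by simp), ?_⟩
    rw [h1] at ht
    rw [hsum, if_pos ht, ← h2 ht, ← add_assoc, ← hJ]
    simp
  · refine ⟨Frame.writeReal _ _ _ _ _ (by simp), ?_⟩
    rw [h1] at ht
    rw [hsum, if_neg ht, add_zero, ← hJ]
    simp

/-- The test that always succeeds. -/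
def always : Test := .natLt (.const 0) (.const 1)

/-- `r₈ := ∑ e` over all values of the counters `10` (below cell `0`) and `11` (below cell `1`). -/
def sumLoop₂ (e : RExpr) : Prog :=
  .seq (letReal 8 (.ofNat (.const 0))) (forLoop 10 0 (accumulate 11 1 always e))

theorem Wp.sumLoop₂ {e : RExpr} {s₀ : Memory} {L N M : ℕ} (f : Fin N → Fin M → ℝ)
    (hN : s₀.nat 0 0 0 0 = N) (hM : s₀.nat 1 0 0 0 = M) (hNL : N ≤ L) (hML : M ≤ L)
    (he : ∀ (i : Fin N) (j : Fin M) s, Frame s₀ s [10, 11] [8] → s.nat 10 0 0 0 = i →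
      s.nat 11 0 0 0 = j → e.eval s = f i j) :
    Wp (sumLoop₂ e) s₀ (1 + loopCost L (loopCost L (1 + 1)) + 1) fun s' =>
      Frame s₀ s' [10, 11] [8] ∧ s'.real 8 0 0 0 = ∑ i, ∑ j, f i j := by
  classical
  refine Wp.seq (Q := fun s => Frame s₀ s [10, 11] [8] ∧ s.real 8 0 0 0 = 0)
    (Wp.setReal ⟨Frame.writeReal _ _ _ _ _ (by simp), by simp⟩) ?_
  rintro s₁ ⟨hf₁, h0⟩
  refine (Wp.forLoop (An := [11]) (Ar := [8]) (fun k s => s.real 8 0 0 0 =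
    ∑ l : Fin N, if l.1 < k then ∑ j, f l j else 0) (N := N) (by rw [hf₁.1 0 (by simp), hN]) hNL
    (by simp) (by simp) (by simpa using h0) (fun k s x h => h) ?_).imp
    fun s' h => ⟨hf₁.trans h.1, by rw [h.2]; simp⟩
  intro k s hk hf hc hJ
  have hf' := hf₁.trans hf
  refine (Wp.accumulate (fun _ : Fin M => True) (fun j => f ⟨k, hk⟩ j)
    (by rw [hf'.1 1 (by simp), hM]) hML (by simp) ?_).imp ?_
  · intro j s' hfs hcj
    refine ⟨by simp [always], fun _ => he ⟨k, hk⟩ j s' ?_ ?_ hcj⟩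
    · exact hf'.trans (hfs.mono (by simp) (by simp))
    · rw [hfs.1 10 (by simp), hc]
  · rintro s' ⟨h1, h2⟩
    refine ⟨h1, ?_⟩
    rw [h2, hJ, sum_ite_lt_succ hk]
    simp only [if_true]

end

end RealRAM

namespace GAP

noncomputable section

open RealRAM

variable {n m : ℕ}

/-! ### The program: set-up and gradient -/

/-! The memory is laid out as follows. Scalar cells of the natural-number memory: `3` is the
capacity `K` of the store, `4` is `m K + 1`, `5` the number of stored vectors, `6` the flag of the
main loop, `10`, `11`, `12`, `13` are loop counters, `15` and `16` the level and the item of the backtracking,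
`17` and `20` the slots of the vector to be removed and of the vector that was drawn, `21` the last
coin. Arrays of natural numbers: `2` is the output, `7[l,i,j]` tells whether the vector in slot `l`
gives item `j` to bin `i` (stored vectors are in the slots `1, 2, …`, the candidate is in the slot
behind them, and slot `0` is always the zero vector), `14[j]` is the rounded value of item `j`, and
`22[i,j]` the set drawn by bin `i`. Scalar cells of the real memory: `7` is the largest value `M` of
an item, `8` an accumulator, `9` and `10` are the quantities `U` and `θ` of the knapsack scheme,
`12` is the least scalar product found so far. Real arrays: `4`, `5` and `6` are `y`, the survival
probabilities and the gradient, and `11[j,p]` is the table of the dynamic program. -/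

/-- The memory contains the input in the cells reserved for it. -/
structure HasInput (G : PublicData n m) (ε : ℝ) (v : Values n m) (s : Memory) : Prop where
  nat_zero : s.nat 0 0 0 0 = n
  nat_one : s.nat 1 0 0 0 = m
  real_eq : ∀ a < 4, s.real a = (G.input ε v).real a

section HasInput

variable {G : PublicData n m} {ε : ℝ} {v : Values n m} {s : Memory}

theorem HasInput.frame (h : HasInput G ε v s) {s' : Memory} {An Ar : List ℕ}
    (hf : Frame s s' An Ar) (h0 : 0 ∉ An) (h1 : 1 ∉ An) (hr : ∀ a < 4, a ∉ Ar) :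
    HasInput G ε v s' :=
  ⟨by rw [hf.1 0 h0, h.nat_zero], by rw [hf.1 1 h1, h.nat_one],
    fun a ha => by rw [hf.2 a (hr a ha), h.real_eq a ha]⟩

theorem HasInput.accuracy (h : HasInput G ε v s) : s.real 0 0 0 0 = ε := by
  rw [h.real_eq 0 (by norm_num)]; simp [PublicData.input]

theorem HasInput.weight (h : HasInput G ε v s) (i : Fin n) (j : Fin m) :
    s.real 1 i j 0 = G.weight i j := by
  rw [h.real_eq 1 (by norm_num)]; simp [PublicData.input]

theorem HasInput.weight_nonneg (h : HasInput G ε v s) (i k : ℕ) : 0 ≤ s.real 1 i k 0 := by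
  rw [h.real_eq 1 (by norm_num)]
  simp only [PublicData.input, one_ne_zero, if_false, if_true]
  split_ifs
  · exact G.weight_nonneg _ _
  · exact le_rfl

theorem HasInput.capacity (h : HasInput G ε v s) (i : Fin n) : s.real 2 i 0 0 = G.capacity i := by
  rw [h.real_eq 2 (by norm_num)]; simp [PublicData.input]

theorem HasInput.value (h : HasInput G ε v s) (i : Fin n) (j : Fin m) : s.real 3 i j 0 = v i j := by
  rw [h.real_eq 3 (by norm_num)]; simp [PublicData.input]

end HasInput

theorem fits_singleton (G : PublicData n m) (i : Fin n) (j : Fin m) :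
    G.Fits i {j} ↔ ¬ G.capacity i < G.weight i j := by
  simp [PublicData.Fits]

/-- The natural number `k` as a real expression. -/
def lit (k : ℕ) : RExpr := .ofNat (.const k)

@[simp] theorem eval_lit (s : Memory) (k : ℕ) : (lit k).eval s = k := rfl

/-- The entry of the real array `a` at two counters. -/
def entry (a i j : ℕ) : RExpr := .read a (nvar i) (nvar j) (.const 0)

@[simp] theorem eval_entry (s : Memory) (a i j : ℕ) :
    (entry a i j).eval s = s.real a (s.nat i 0 0 0) (s.nat j 0 0 0) 0 := rfl

/-- The accuracy `ε / 4` of the local search. -/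
def accuracy : RExpr := .div (rvar 0) (lit 4)

@[simp] theorem eval_accuracy (s : Memory) : accuracy.eval s = s.real 0 0 0 0 / 4 := rfl

/-- Compute the capacity of the store by counting. -/
def storeSizeProg : Prog :=
  .seq (letNat 3 (.const 0))
    (.while (.realLt (.ofNat (nvar 3))
      (.div (.mul (.mul (lit 6) (.ofNat (nvar 1))) (.mul (.ofNat (nvar 0)) (.ofNat (nvar 0))))
        accuracy))
      (letNat 3 (.add (nvar 3) (.const 1))))

theorem storeSizeProg_spec {G : PublicData n m} {ε : ℝ} {v : Values n m} {s : Memory}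
    (h : HasInput G ε v s) {L : ℕ} (hL : storeSize n m (ε / 4) ≤ L) :
    Wp storeSizeProg s (1 + (L * 2 + 1) + 1) fun s' => Frame s s' [3] [] ∧
      s'.nat 3 0 0 0 = storeSize n m (ε / 4) := by
  refine Wp.seq (Q := fun s' => Frame s s' [3] [] ∧ s'.nat 3 0 0 0 = 0)
    (Wp.setNat ⟨Frame.writeNat _ _ _ _ _ (by simp), by simp⟩) ?_
  rintro s₁ ⟨hf₁, h₁⟩
  have heval : ∀ s', Frame s s' [3] [] → RExpr.eval s' (.div (.mul (.mul (lit 6)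
      (.ofNat (nvar 1))) (.mul (.ofNat (nvar 0)) (.ofNat (nvar 0)))) accuracy) =
        6 * m * n ^ 2 / (ε / 4) := by
    intro s' hf
    have hi := h.frame hf (by simp) (by simp) (by simp)
    simp [hi.nat_zero, hi.nat_one, hi.accuracy, sq]
  refine (Wp.while (B := 1) (N := storeSize n m (ε / 4)) (I := fun k s' => Frame s s' [3] [] ∧
    s'.nat 3 0 0 0 = k ∧ k ≤ storeSize n m (ε / 4)) ?_ ⟨hf₁, h₁, Nat.zero_le _⟩).mono
      (by have := Nat.mul_le_mul_right 2 hL; omega) ?_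
  · rintro k s' ⟨hf, hk, hle⟩ ht
    simp only [Test.Holds, heval s' hf] at ht
    simp only [RExpr.eval, eval_nvar, hk] at ht
    have hlt : k < storeSize n m (ε / 4) := Nat.lt_ceil.2 ht
    refine ⟨hlt, Wp.setNat ⟨hf.trans (Frame.writeNat _ _ _ _ _ (by simp)), by simp [hk], hlt⟩⟩
  · rintro s' ⟨k, ⟨hf, hk, hle⟩, ht⟩
    refine ⟨hf, ?_⟩
    simp only [Test.Holds, heval s' hf] at ht
    simp only [RExpr.eval, eval_nvar, hk, not_lt] at ht
    rw [hk]
    exact le_antisymm hle (Nat.ceil_le.2 ht)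

/-- Compute the number `m K + 1` of levels of the dynamic program. -/
def levelsProg : Prog :=
  .seq (letNat 4 (.const 1)) (forLoop 11 1 (letNat 4 (.add (nvar 4) (nvar 3))))

theorem levelsProg_spec {s : Memory} {K L : ℕ} (hm : s.nat 1 0 0 0 = m) (hK : s.nat 3 0 0 0 = K)
    (hL : m ≤ L) : Wp levelsProg s (1 + loopCost L 1 + 1) fun s' => Frame s s' [11, 4] [] ∧
      s'.nat 4 0 0 0 = m * K + 1 := by
  refine Wp.seq (Q := fun s' => Frame s s' [11, 4] [] ∧ s'.nat 4 0 0 0 = 1)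
    (Wp.setNat ⟨Frame.writeNat _ _ _ _ _ (by simp), by simp⟩) ?_
  rintro s₁ ⟨hf₁, h₁⟩
  refine (Wp.forLoop (An := [4]) (Ar := []) (fun k s' => s'.nat 4 0 0 0 = k * K + 1) (N := m)
    (by rw [hf₁.1 1 (by simp), hm]) hL (by simp) (by simp) (by simpa using h₁)
    (fun k s x h => by simpa using h) ?_).imp fun s' h => ⟨hf₁.trans h.1, h.2⟩
  intro k s' _ hf hc hJ
  refine Wp.setNat ⟨Frame.writeNat _ _ _ _ _ (by simp), ?_⟩
  have h3 : s'.nat 3 0 0 0 = K := by rw [hf.1 3 (by simp), hf₁.1 3 (by simp), hK]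
  simp [hJ, h3]
  ring

/-- Item `11` fits into bin `10`. -/
def fitsTest : Test := .not (.realLt (.read 2 (nvar 10) (.const 0) (.const 0)) (entry 1 10 11))

theorem fitsTest_holds {G : PublicData n m} {ε : ℝ} {v : Values n m} {s : Memory}
    (h : HasInput G ε v s) {i : Fin n} {j : Fin m} (hi : s.nat 10 0 0 0 = i)
    (hj : s.nat 11 0 0 0 = j) : fitsTest.Holds s ↔ G.Fits i {j} := by
  rw [fits_singleton]
  simp [fitsTest, hi, hj, h.weight, h.capacity]

/-- Compute the largest value of a single item. -/
def maxValueProg : Prog :=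
  .seq (letReal 7 (lit 0)) (forLoop 10 0 (forLoop 11 1
    (.ite (.and fitsTest (.realLt (rvar 7) (entry 3 10 11)))
      (letReal 7 (entry 3 10 11)) (letReal 7 (rvar 7)))))

theorem maxValueProg_spec {G : PublicData n m} {ε : ℝ} {v : Values n m} (hv : 0 ≤ v) {s : Memory}
    (h : HasInput G ε v s) {L : ℕ} (hnL : n ≤ L) (hmL : m ≤ L) :
    Wp maxValueProg s (1 + loopCost L (loopCost L (1 + 1)) + 1) fun s' =>
      Frame s s' [10, 11] [7] ∧ s'.real 7 0 0 0 = G.maxValue v := by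
  refine Wp.seq (Q := fun s' => Frame s s' [10, 11] [7] ∧ s'.real 7 0 0 0 = 0)
    (Wp.setReal ⟨Frame.writeReal _ _ _ _ _ (by simp), by simp⟩) ?_
  rintro s₁ ⟨hf₁, h₁⟩
  have hi₁ := h.frame hf₁ (by simp) (by simp) (by simp; omega)
  refine (Wp.forLoop (An := [11]) (Ar := [7]) (fun k s' => 0 ≤ s'.real 7 0 0 0 ∧
    s'.real 7 0 0 0 ≤ G.maxValue v ∧
    ∀ (i : Fin n) (j : Fin m), i.1 < k → G.Fits i {j} → v i j ≤ s'.real 7 0 0 0)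
    hi₁.nat_zero hnL (by simp) (by simp)
    ⟨h₁.ge, by rw [h₁]; exact G.maxValue_nonneg hv, fun i j hi => absurd hi (Nat.not_lt_zero _)⟩
    (fun k s x h => h) ?_).imp ?_
  · intro k s₂ hk hf₂ hc₂ hJ₂
    have hi₂ := hi₁.frame hf₂ (by simp) (by simp) (by simp; omega)
    refine (Wp.forLoop (An := []) (Ar := [7]) (fun k' s' => 0 ≤ s'.real 7 0 0 0 ∧
      s'.real 7 0 0 0 ≤ G.maxValue v ∧ ∀ (i : Fin n) (j : Fin m),
        i.1 < k ∨ i.1 = k ∧ j.1 < k' → G.Fits i {j} → v i j ≤ s'.real 7 0 0 0)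
      hi₂.nat_one hmL (by simp) (by simp)
      ⟨hJ₂.1, hJ₂.2.1, fun i j hij => hJ₂.2.2 i j (by omega)⟩ (fun k s x h => h) ?_).imp
      fun s' h => ⟨h.1, h.2.1, h.2.2.1, fun i j hi => h.2.2.2 i j (by omega)⟩
    intro k' s₃ hk' hf₃ hc₃ hJ₃
    have hi₃ := hi₂.frame hf₃ (by simp) (by simp) (by simp; omega)
    have hc : s₃.nat 10 0 0 0 = k := by rw [hf₃.1 10 (by simp), hc₂]
    have hfit := fitsTest_holds hi₃ (i := ⟨k, hk⟩) (j := ⟨k', hk'⟩) hc hc₃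
    have hval : s₃.real 3 k k' 0 = v ⟨k, hk⟩ ⟨k', hk'⟩ := hi₃.value ⟨k, hk⟩ ⟨k', hk'⟩
    obtain ⟨h0, hle, hall⟩ := hJ₃
    refine Wp.ite (fun ht => Wp.setReal ⟨Frame.writeReal _ _ _ _ _ (by simp), ?_⟩)
      fun ht => Wp.setReal ⟨Frame.writeReal _ _ _ _ _ (by simp), ?_⟩
    · obtain ⟨ht1, ht2⟩ := ht
      rw [hfit] at ht1
      simp only [Test.Holds, eval_rvar, eval_entry, hc, hc₃, hval] at ht2
      simp only [Memory.writeReal, NExpr.eval, eval_entry, hc, hc₃, hval, and_self, if_true]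
      refine ⟨hv _ _, G.le_maxValue ht1, fun i j hij hf => ?_⟩
      by_cases he : i.1 = k ∧ j.1 = k'
      · have h5 : i = ⟨k, hk⟩ := Fin.ext he.1
        have h6 : j = ⟨k', hk'⟩ := Fin.ext he.2
        rw [h5, h6]
      · exact (hall i j (by omega) hf).trans ht2.le
    · simp only [Memory.writeReal, NExpr.eval, eval_rvar, and_self, if_true]
      refine ⟨h0, hle, fun i j hij hf => ?_⟩
      by_cases he : i.1 = k ∧ j.1 = k'
      · have h5 : i = ⟨k, hk⟩ := Fin.ext he.1
        have h6 : j = ⟨k', hk'⟩ := Fin.ext he.2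
        by_contra hlt
        refine ht ⟨hfit.2 (h5 ▸ h6 ▸ hf), ?_⟩
        simp only [Test.Holds, eval_rvar, eval_entry, hc, hc₃, hval]
        rw [← h5, ← h6]
        exact not_le.1 hlt
      · exact hall i j (by omega) hf
  · rintro s' ⟨hf, h0, hle, hall⟩
    refine ⟨hf₁.trans hf, le_antisymm hle (Real.iSup_le ?_ h0)⟩
    rintro ⟨i, j⟩
    by_cases hij : G.Fits i {j}
    · simpa [PublicData.binValue, hij] using hall i j i.2 hij
    · simpa [PublicData.binValue, hij] using h0

/-- The slots `1, …, N` of the store contain the vectors `z 0, …, z (N - 1)`. -/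
def Holds (N : ℕ) (z : Fin N → Alloc n m) (s : Memory) : Prop :=
  s.nat 5 0 0 0 = N ∧ ∀ (l : Fin N) (i : Fin n) (j : Fin m),
    s.nat 7 (l + 1) i j = if j ∈ z l i then 1 else 0

/-- The multiset of the stored vectors. -/
def storeOf {N : ℕ} (z : Fin N → Alloc n m) : Multiset (Alloc n m) := Finset.univ.val.map z

theorem marginal_storeOf (η : ℝ) {N : ℕ} (z : Fin N → Alloc n m) (i : Fin n) (j : Fin m) :
    marginal (storePoint η (storeOf z)) i j =
      (∑ l, if j ∈ z l i then (1 : ℝ) else 0) / storeSize n m η := by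
  rw [marginal_storePoint, storeOf, Multiset.map_map]
  change (1 / storeSize n m η : ℝ) * (∑ l, indicator (z l)) i j = _
  rw [one_div_mul_eq_div, Finset.sum_apply, Finset.sum_apply]
  rfl

/-- Compute the marginals of the point represented by the store. -/
def marginalProg : Prog :=
  forLoop₂ 10 0 11 1 (.seq (letReal 8 (lit 0)) (.seq
    (accumulate 12 5 always (.ofNat (.read 7 (.add (nvar 12) (.const 1)) (nvar 10) (nvar 11))))
    (.setReal 4 (nvar 10) (nvar 11) (.const 0) (.div (rvar 8) (.ofNat (nvar 3))))))

theorem marginalProg_spec {G : PublicData n m} {ε : ℝ} {v : Values n m} {s : Memory} {N : ℕ}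
    {z : Fin N → Alloc n m} {η : ℝ} (h : HasInput G ε v s) (hz : Holds N z s)
    (hK : s.nat 3 0 0 0 = storeSize n m η) {L : ℕ} (hnL : n ≤ L) (hmL : m ≤ L) (hNL : N ≤ L) :
    Wp marginalProg s (loopCost L (loopCost L (1 + (loopCost L (1 + 1) + 1 + 1) + 1))) fun s' =>
      Frame s s' [10, 11, 12] [8, 4] ∧
        ∀ i j, s'.real 4 i.1 j.1 0 = marginal (storePoint η (storeOf z)) i j := by
  refine Wp.forLoop₂ (fun i j s' => s'.real 4 i j 0 = marginal (storePoint η (storeOf z)) i j)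
    h.nat_zero h.nat_one hnL hmL (by simp) (by simp) (by simp) (by simp)
    (fun i j s c x _ h => h) ?_
  intro i j s₁ hf₁ hci hcj
  refine Wp.seq (Q := fun s' => Frame s₁ s' [12] [8, 4] ∧ s'.real 8 0 0 0 = 0 ∧
    s'.real 4 = s₁.real 4) (Wp.setReal ⟨Frame.writeReal _ _ _ _ _ (by simp), by simp, by simp⟩) ?_
  rintro s₂ ⟨hf₂, h80, h4⟩
  have hf₂' : Frame s s₂ [10, 11, 12] [8, 4] := hf₁.trans (hf₂.mono (by simp) (by simp))
  refine Wp.seq (Wp.accumulate (N := N) (fun _ => True) (fun l => if j ∈ z l i then (1 : ℝ) else 0)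
    (by rw [hf₂'.1 5 (by simp), hz.1]) hNL (by simp) ?_) ?_
  · intro l s₃ hf₃ hl
    refine ⟨by simp [always], fun _ => ?_⟩
    have h7 : s₃.nat 7 = s.nat 7 := by rw [hf₃.1 7 (by simp), hf₂'.1 7 (by simp)]
    have h10 : s₃.nat 10 0 0 0 = i := by rw [hf₃.1 10 (by simp), hf₂.1 10 (by simp), hci]
    have h11 : s₃.nat 11 0 0 0 = j := by rw [hf₃.1 11 (by simp), hf₂.1 11 (by simp), hcj]
    simp only [RExpr.eval, NExpr.eval, eval_nvar, h10, h11, hl, h7, hz.2]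
    split_ifs <;> simp
  · rintro s₃ ⟨hf₃, h8⟩
    have h10 : s₃.nat 10 0 0 0 = i := by rw [hf₃.1 10 (by simp), hf₂.1 10 (by simp), hci]
    have h11 : s₃.nat 11 0 0 0 = j := by rw [hf₃.1 11 (by simp), hf₂.1 11 (by simp), hcj]
    have h3 : s₃.nat 3 0 0 0 = storeSize n m η := by
      rw [hf₃.1 3 (by simp), hf₂'.1 3 (by simp), hK]
    have h4' : s₃.real 4 = s₁.real 4 := by rw [hf₃.2 4 (by simp), h4]
    refine Wp.setReal ⟨?_, ?_, ?_⟩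
    · exact (hf₂.trans (hf₃.mono (by simp) (by simp))).trans
        (Frame.writeReal _ _ _ _ _ (by simp))
    · simp [h10, h11, h3, h8, h80, marginal_storeOf]
    · intro i' j' hne h
      simp only [Memory.writeReal, eval_nvar, h10, h11, NExpr.eval]
      rw [if_neg (by tauto), h4', h]

/-- Bin `a` precedes bin `b`, or is equal to it, in the greedy order for item `11`. -/
def precedesTest (a b : ℕ) : Test :=
  .and (.not (.realLt (entry 3 a 11) (entry 3 b 11)))
    (.not (.and (.not (.realLt (entry 3 b 11) (entry 3 a 11))) (.natLt (nvar b) (nvar a))))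

theorem precedesTest_holds {G : PublicData n m} {ε : ℝ} {v : Values n m} {s : Memory}
    (h : HasInput G ε v s) {a b : ℕ} {k i : Fin n} {j : Fin m} (ha : s.nat a 0 0 0 = k)
    (hb : s.nat b 0 0 0 = i) (hj : s.nat 11 0 0 0 = j) :
    (precedesTest a b).Holds s ↔ Precedes v j k i := by
  rw [precedes_iff]
  simp only [precedesTest, Test.Holds, eval_entry, eval_nvar, ha, hb, hj, h.value, Fin.lt_def]

/-- Compute the survival probabilities. -/
def survivalProg : Prog :=
  forLoop₂ 10 0 11 1 (.seq (letReal 8 (lit 0)) (.seq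
    (accumulate 12 0 (precedesTest 12 10) (entry 4 12 11))
    (.setReal 5 (nvar 10) (nvar 11) (.const 0) (.exp (.sub (lit 0) (rvar 8))))))

theorem survivalProg_spec {G : PublicData n m} {ε : ℝ} {v : Values n m} {s : Memory}
    {y : Fin n → Fin m → ℝ} (h : HasInput G ε v s) (hy : ∀ i j, s.real 4 i.1 j.1 0 = y i j) {L : ℕ}
    (hnL : n ≤ L) (hmL : m ≤ L) :
    Wp survivalProg s (loopCost L (loopCost L (1 + (loopCost L (1 + 1) + 1 + 1) + 1))) fun s' =>
      Frame s s' [10, 11, 12] [8, 5] ∧ ∀ i j, s'.real 5 i.1 j.1 0 =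
        Real.exp (-cumul v y j ((greedyOrder v j).symm i)) := by
  classical
  refine Wp.forLoop₂ (fun i j s' => s'.real 5 i j 0 =
      Real.exp (-cumul v y j ((greedyOrder v j).symm i)))
    h.nat_zero h.nat_one hnL hmL (by simp) (by simp) (by simp) (by simp)
    (fun i j s c x _ h => h) ?_
  intro i j s₁ hf₁ hci hcj
  refine Wp.seq (Q := fun s' => Frame s₁ s' [12] [8, 5] ∧ s'.real 8 0 0 0 = 0 ∧
    s'.real 5 = s₁.real 5) (Wp.setReal ⟨Frame.writeReal _ _ _ _ _ (by simp), by simp, by simp⟩) ?_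
  rintro s₂ ⟨hf₂, h80, h5⟩
  have hf₂' : Frame s s₂ [10, 11, 12] [8, 5] := hf₁.trans (hf₂.mono (by simp) (by simp))
  have hi₂ := h.frame hf₂' (by simp) (by simp) (by simp; omega)
  refine Wp.seq (Wp.accumulate (N := n) (fun k => Precedes v j k i) (fun k => y k j)
    hi₂.nat_zero hnL (by simp) ?_) ?_
  · intro k s₃ hf₃ hk
    have hi₃ := hi₂.frame hf₃ (by simp) (by simp) (by simp; omega)
    have h4 : s₃.real 4 = s.real 4 := by rw [hf₃.2 4 (by simp), hf₂'.2 4 (by simp)]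
    have h10 : s₃.nat 10 0 0 0 = i := by rw [hf₃.1 10 (by simp), hf₂.1 10 (by simp), hci]
    have h11 : s₃.nat 11 0 0 0 = j := by rw [hf₃.1 11 (by simp), hf₂.1 11 (by simp), hcj]
    refine ⟨precedesTest_holds hi₃ hk h10 h11, fun _ => ?_⟩
    simp only [eval_entry, hk, h11, h4, hy]
  · rintro s₃ ⟨hf₃, h8⟩
    have h10 : s₃.nat 10 0 0 0 = i := by rw [hf₃.1 10 (by simp), hf₂.1 10 (by simp), hci]
    have h11 : s₃.nat 11 0 0 0 = j := by rw [hf₃.1 11 (by simp), hf₂.1 11 (by simp), hcj]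
    have h5' : s₃.real 5 = s₁.real 5 := by rw [hf₃.2 5 (by simp), h5]
    refine Wp.setReal ⟨?_, ?_, ?_⟩
    · exact (hf₂.trans (hf₃.mono (by simp) (by simp))).trans
        (Frame.writeReal _ _ _ _ _ (by simp))
    · simp [h10, h11, h8, h80, cumul_symm]
    · intro i' j' hne h
      simp only [Memory.writeReal, eval_nvar, h10, h11, NExpr.eval]
      rw [if_neg (by tauto), h5', h]

/-- Compute the gradient. -/
def gradientProg : Prog :=
  forLoop₂ 10 0 11 1 (.seq (letReal 8 (.mul (entry 3 10 11) (entry 5 10 11))) (.seq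
    (accumulate 12 0 (.not (precedesTest 12 10)) (.sub (lit 0)
      (.mul (.mul (entry 3 12 11) (entry 5 12 11)) (.sub (.exp (entry 4 12 11)) (lit 1)))))
    (.setReal 6 (nvar 10) (nvar 11) (.const 0) (rvar 8))))

theorem gradientProg_spec {G : PublicData n m} {ε : ℝ} {v : Values n m} {s : Memory}
    {y : Fin n → Fin m → ℝ} (h : HasInput G ε v s) (hy : ∀ i j, s.real 4 i.1 j.1 0 = y i j)
    (hE : ∀ i j, s.real 5 i.1 j.1 0 = Real.exp (-cumul v y j ((greedyOrder v j).symm i))) {L : ℕ}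
    (hnL : n ≤ L) (hmL : m ≤ L) :
    Wp gradientProg s (loopCost L (loopCost L (1 + (loopCost L (1 + 1) + 1 + 1) + 1))) fun s' =>
      Frame s s' [10, 11, 12] [8, 6] ∧ ∀ i j, s'.real 6 i.1 j.1 0 = gradient v y i j := by
  classical
  refine Wp.forLoop₂ (fun i j s' => s'.real 6 i j 0 = gradient v y i j)
    h.nat_zero h.nat_one hnL hmL (by simp) (by simp) (by simp) (by simp)
    (fun i j s c x _ h => h) ?_
  intro i j s₁ hf₁ hci hcj
  have hi₁ := h.frame hf₁ (by simp) (by simp) (by simp; omega)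
  refine Wp.seq (Q := fun s' => Frame s₁ s' [12] [8, 6] ∧ s'.real 8 0 0 0 =
    v i j * Real.exp (-cumul v y j ((greedyOrder v j).symm i)) ∧ s'.real 6 = s₁.real 6)
    (Wp.setReal ⟨Frame.writeReal _ _ _ _ _ (by simp), ?_, by simp⟩) ?_
  · have h5 : s₁.real 5 = s.real 5 := hf₁.2 5 (by simp)
    simp [hci, hcj, hi₁.value, h5, hE]
  rintro s₂ ⟨hf₂, h80, h6⟩
  have hf₂' : Frame s s₂ [10, 11, 12] [8, 6] := hf₁.trans (hf₂.mono (by simp) (by simp))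
  have hi₂ := h.frame hf₂' (by simp) (by simp) (by simp; omega)
  refine Wp.seq (Wp.accumulate (N := n) (fun k => ¬ Precedes v j k i) (fun k =>
    -(v k j * Real.exp (-cumul v y j ((greedyOrder v j).symm k)) * (Real.exp (y k j) - 1)))
    hi₂.nat_zero hnL (by simp) ?_) ?_
  · intro k s₃ hf₃ hk
    have hi₃ := hi₂.frame hf₃ (by simp) (by simp) (by simp; omega)
    have h4 : s₃.real 4 = s.real 4 := by rw [hf₃.2 4 (by simp), hf₂'.2 4 (by simp)]
    have h5 : s₃.real 5 = s.real 5 := by rw [hf₃.2 5 (by simp), hf₂'.2 5 (by simp)]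
    have h10 : s₃.nat 10 0 0 0 = i := by rw [hf₃.1 10 (by simp), hf₂.1 10 (by simp), hci]
    have h11 : s₃.nat 11 0 0 0 = j := by rw [hf₃.1 11 (by simp), hf₂.1 11 (by simp), hcj]
    refine ⟨not_congr (precedesTest_holds hi₃ hk h10 h11), fun _ => ?_⟩
    simp [hk, h11, h4, h5, hy, hE, hi₃.value]
  · rintro s₃ ⟨hf₃, h8⟩
    have h10 : s₃.nat 10 0 0 0 = i := by rw [hf₃.1 10 (by simp), hf₂.1 10 (by simp), hci]
    have h11 : s₃.nat 11 0 0 0 = j := by rw [hf₃.1 11 (by simp), hf₂.1 11 (by simp), hcj]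
    have h6' : s₃.real 6 = s₁.real 6 := by rw [hf₃.2 6 (by simp), h6]
    refine Wp.setReal ⟨?_, ?_, ?_⟩
    · exact (hf₂.trans (hf₃.mono (by simp) (by simp))).trans
        (Frame.writeReal _ _ _ _ _ (by simp))
    · simp only [Memory.writeReal, eval_nvar, h10, h11, NExpr.eval, eval_rvar, and_self, if_true]
      rw [h8, h80, gradient_eq_precedes, sub_eq_add_neg, ← Finset.sum_neg_distrib]
      congr 1
      refine Finset.sum_congr rfl fun k _ => ?_
      by_cases hp : Precedes v j k i <;> simp [hp]
    · intro i' j' hne h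
      simp only [Memory.writeReal, eval_nvar, h10, h11, NExpr.eval]
      rw [if_neg (by tauto), h6', h]

end

end GAP

namespace GAP

noncomputable section

open RealRAM

variable {n m : ℕ}

/-! ### The program: the knapsack approximation scheme -/

/-- Compute the largest entry of the gradient among the items that fit into bin `10`. -/
def largestProg : Prog :=
  .seq (letReal 9 (lit 0)) (forLoop 11 1
    (.ite (.and fitsTest (.realLt (rvar 9) (entry 6 10 11)))
      (letReal 9 (entry 6 10 11)) (letReal 9 (rvar 9))))

theorem largestProg_spec {G : PublicData n m} {ε : ℝ} {v : Values n m} {s : Memory}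
    (h : HasInput G ε v s) {i : Fin n} (hi : s.nat 10 0 0 0 = i) {u : Fin n → Fin m → ℝ}
    (hu : ∀ i j, s.real 6 i.1 j.1 0 = u i j) {L : ℕ} (hmL : m ≤ L) :
    Wp largestProg s (1 + loopCost L (1 + 1) + 1) fun s' => Frame s s' [11] [9] ∧
      (∀ j, G.Fits i {j} → u i j ≤ s'.real 9 0 0 0) ∧
      (s'.real 9 0 0 0 = 0 ∨ ∃ j, G.Fits i {j} ∧ s'.real 9 0 0 0 = u i j) := by
  refine Wp.seq (Q := fun s' => Frame s s' [11] [9] ∧ s'.real 9 0 0 0 = 0)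
    (Wp.setReal ⟨Frame.writeReal _ _ _ _ _ (by simp), by simp⟩) ?_
  rintro s₁ ⟨hf₁, h₁⟩
  have hi₁ := h.frame hf₁ (by simp) (by simp) (by simp; omega)
  refine (Wp.forLoop (An := []) (Ar := [9]) (fun k s' =>
    (∀ j : Fin m, j.1 < k → G.Fits i {j} → u i j ≤ s'.real 9 0 0 0) ∧
    (s'.real 9 0 0 0 = 0 ∨ ∃ j, G.Fits i {j} ∧ s'.real 9 0 0 0 = u i j))
    hi₁.nat_one hmL (by simp) (by simp) ⟨fun j hj => absurd hj (Nat.not_lt_zero _), Or.inl h₁⟩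
    (fun k s x h => h) ?_).imp fun s' h => ⟨hf₁.trans h.1, fun j => h.2.1 j j.2, h.2.2⟩
  rintro k s₂ hk hf₂ hc ⟨hall, hex⟩
  have hi₂ := hi₁.frame hf₂ (by simp) (by simp) (by simp; omega)
  have h10 : s₂.nat 10 0 0 0 = i := by rw [hf₂.1 10 (by simp), hf₁.1 10 (by simp), hi]
  have hfit := fitsTest_holds hi₂ (j := ⟨k, hk⟩) h10 hc
  have hval : s₂.real 6 i k 0 = u i ⟨k, hk⟩ := by
    rw [hf₂.2 6 (by simp), hf₁.2 6 (by simp), ← hu]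
  refine Wp.ite (fun ht => Wp.setReal ⟨Frame.writeReal _ _ _ _ _ (by simp), ?_⟩)
    fun ht => Wp.setReal ⟨Frame.writeReal _ _ _ _ _ (by simp), ?_⟩
  · obtain ⟨ht1, ht2⟩ := ht
    rw [hfit] at ht1
    simp only [Test.Holds, eval_rvar, eval_entry, h10, hc, hval] at ht2
    simp only [Memory.writeReal, NExpr.eval, eval_entry, h10, hc, hval, and_self, if_true]
    refine ⟨fun j hj hf => ?_, Or.inr ⟨_, ht1, rfl⟩⟩
    by_cases he : j.1 = k
    · have h6 : j = ⟨k, hk⟩ := Fin.ext he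
      rw [h6]
    · exact (hall j (by omega) hf).trans ht2.le
  · simp only [Memory.writeReal, NExpr.eval, eval_rvar, and_self, if_true]
    refine ⟨fun j hj hf => ?_, hex⟩
    by_cases he : j.1 = k
    · have h6 : j = ⟨k, hk⟩ := Fin.ext he
      by_contra hlt
      refine ht ⟨hfit.2 (h6 ▸ hf), ?_⟩
      simp only [Test.Holds, eval_rvar, eval_entry, h10, hc, hval]
      rw [← h6]
      exact not_le.1 hlt
    · exact hall j (by omega) hf

/-- The rounded value of the item in the counter `a`. -/
def rounded (a : ℕ) : NExpr := .read 14 (nvar a) (.const 0) (.const 0)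

@[simp] theorem eval_rounded (s : Memory) (a : ℕ) :
    (rounded a).eval s = s.nat 14 (s.nat a 0 0 0) 0 0 := rfl

/-- Round the values of the items down to multiples of `θ`, by counting up to `K`. -/
def roundProg : Prog :=
  forLoop 11 1 (.seq (.setNat 14 (nvar 11) (.const 0) (.const 0) (.const 0))
    (.while (.and (.natLt (rounded 11) (nvar 3)) (.not (.realLt (entry 6 10 11)
        (.mul (.add (.ofNat (rounded 11)) (lit 1)) (rvar 10)))))
      (.setNat 14 (nvar 11) (.const 0) (.const 0) (.add (rounded 11) (.const 1)))))

theorem roundProg_spec {s : Memory} (hm : s.nat 1 0 0 0 = m) {i : Fin n}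
    (hi : s.nat 10 0 0 0 = i) {u : Fin n → Fin m → ℝ} (hu : ∀ i j, s.real 6 i.1 j.1 0 = u i j)
    (hu0 : ∀ i j, 0 ≤ u i j) {K L : ℕ} (hK : s.nat 3 0 0 0 = K) {θ : ℝ}
    (hθ : s.real 10 0 0 0 = θ) (hmL : m ≤ L) (hKL : K ≤ L) :
    Wp roundProg s (loopCost L (1 + (L * 2 + 1) + 1)) fun s' => Frame s s' [11, 14] [] ∧
      ∀ j : Fin m, s'.nat 14 j 0 0 ≤ K ∧ s'.nat 14 j 0 0 * θ ≤ u i j ∧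
        (s'.nat 14 j 0 0 < K → u i j < (s'.nat 14 j 0 0 + 1) * θ) := by
  refine (Wp.forLoop (An := [14]) (Ar := []) (fun k s' => ∀ j : Fin m, j.1 < k →
    s'.nat 14 j 0 0 ≤ K ∧ s'.nat 14 j 0 0 * θ ≤ u i j ∧
        (s'.nat 14 j 0 0 < K → u i j < (s'.nat 14 j 0 0 + 1) * θ))
    hm hmL (by simp) (by simp) (fun j hj => absurd hj (Nat.not_lt_zero _))
    (fun k s x h => by simpa using h) ?_).imp fun s' h => ⟨h.1, fun j => h.2 j j.2⟩
  intro k s₁ hk hf₁ hc hJ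
  refine Wp.seq (Q := fun s' => Frame s₁ s' [14] [] ∧ s'.nat 14 k 0 0 = 0 ∧
    ∀ j, j ≠ k → s'.nat 14 j 0 0 = s₁.nat 14 j 0 0)
    (Wp.setNat ⟨Frame.writeNat _ _ _ _ _ (by simp), by simp [hc],
      fun j hj => by simp [hc, hj]⟩) ?_
  rintro s₂ ⟨hf₂, h0, hne⟩
  have hread : ∀ s', Frame s₂ s' [14] [] → s'.nat 10 0 0 0 = i ∧ s'.nat 11 0 0 0 = k ∧
      s'.nat 3 0 0 0 = K ∧ s'.real 10 0 0 0 = θ ∧ s'.real 6 i k 0 = u i ⟨k, hk⟩ := by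
    intro s' hf
    refine ⟨?_, ?_, ?_, ?_, ?_⟩
    · rw [hf.1 10 (by simp), hf₂.1 10 (by simp), hf₁.1 10 (by simp), hi]
    · rw [hf.1 11 (by simp), hf₂.1 11 (by simp), hc]
    · rw [hf.1 3 (by simp), hf₂.1 3 (by simp), hf₁.1 3 (by simp), hK]
    · rw [hf.2 10 (by simp), hf₂.2 10 (by simp), hf₁.2 10 (by simp), hθ]
    · rw [hf.2 6 (by simp), hf₂.2 6 (by simp), hf₁.2 6 (by simp), ← hu]
  refine (Wp.while (B := 1) (N := K) (I := fun t s' => Frame s₂ s' [14] [] ∧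
    s'.nat 14 k 0 0 = t ∧ t ≤ K ∧ t * θ ≤ u i ⟨k, hk⟩ ∧
      ∀ j, j ≠ k → s'.nat 14 j 0 0 = s₁.nat 14 j 0 0) ?_
    ⟨Frame.refl _ _ _, h0, Nat.zero_le _, by simpa using hu0 i ⟨k, hk⟩, hne⟩).mono
      (by have := Nat.mul_le_mul_right 2 hKL; omega) ?_
  · rintro t s' ⟨hf, ht, hle, hlow, hoth⟩ htest
    obtain ⟨g1, g2, g3, g4, g5⟩ := hread s' hf
    simp only [Test.Holds, RExpr.eval, eval_rounded, eval_nvar, eval_entry, eval_lit, eval_rvar,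
      g1, g2, g3, g4, g5, ht, not_lt] at htest
    refine ⟨htest.1, Wp.setNat ⟨hf.trans (Frame.writeNat _ _ _ _ _ (by simp)), by simp [g2, ht],
      htest.1, by simpa using htest.2, fun j hj => ?_⟩⟩
    simp [g2, hj, hoth]
  · rintro s' ⟨t, ⟨hf, ht, hle, hlow, hoth⟩, htest⟩
    obtain ⟨g1, g2, g3, g4, g5⟩ := hread s' hf
    simp only [Test.Holds, RExpr.eval, eval_rounded, eval_nvar, eval_entry, eval_lit, eval_rvar,
      g1, g2, g3, g4, g5, ht, not_and, not_not] at htest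
    refine ⟨hf₂.trans hf, fun j hj => ?_⟩
    by_cases he : j.1 = k
    · have h6 : j = ⟨k, hk⟩ := Fin.ext he
      rw [he, ht, h6]
      exact ⟨hle, hlow, fun h => by simpa using htest h⟩
    · rw [hoth j he]
      exact hJ j (by omega)

/-- The entry of the table of the dynamic program at the row `a` and the column `p`. -/
def tableEntry (a p : NExpr) : RExpr := .read 11 a p (.const 0)

/-- In the table of the dynamic program, taking the item in the counter `a` is better for the level
in the counter `b`. -/
def takesTest (a b : ℕ) : Test :=
  .and (.not (.natLt (nvar b) (rounded a)))
    (.realLt (.add (tableEntry (nvar a) (.sub (nvar b) (rounded a))) (entry 1 10 a))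
      (tableEntry (nvar a) (nvar b)))

theorem takesTest_holds {s : Memory} {a b i j p P : ℕ} {C : ℝ} {w : ℕ → ℝ}
    {q : ℕ → ℕ} (hi : s.nat 10 0 0 0 = i) (ha : s.nat a 0 0 0 = j) (hb : s.nat b 0 0 0 = p)
    (hw : s.real 1 i j 0 = w j) (hq : s.nat 14 j 0 0 = q j) (hp : p < P)
    (hW : ∀ p < P, s.real 11 j p 0 = minWeight C w q j p) :
    (takesTest a b).Holds s ↔ Takes C w q j p := by
  have h1 := hW p hp
  have h2 := hW (p - q j) (by omega)
  simp only [takesTest, tableEntry, Test.Holds, RExpr.eval, NExpr.eval, eval_nvar, eval_rounded,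
    eval_entry, hi, ha, hb, hw, hq, h1, h2, Takes]

/-- Fill the table of the dynamic program. -/
def tableProg : Prog :=
  .seq (forLoop 13 4 (.ite (.natLt (.const 0) (nvar 13))
      (.setReal 11 (.const 0) (nvar 13) (.const 0)
        (.add (.read 2 (nvar 10) (.const 0) (.const 0)) (lit 1)))
      (.setReal 11 (.const 0) (nvar 13) (.const 0) (lit 0))))
    (forLoop 11 1 (forLoop 13 4 (.ite (takesTest 11 13)
      (.setReal 11 (.add (nvar 11) (.const 1)) (nvar 13) (.const 0)
        (.add (tableEntry (nvar 11) (.sub (nvar 13) (rounded 11))) (entry 1 10 11)))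
      (.setReal 11 (.add (nvar 11) (.const 1)) (nvar 13) (.const 0)
        (tableEntry (nvar 11) (nvar 13))))))

theorem tableProg_spec {s : Memory} (hm : s.nat 1 0 0 0 = m) {i P L : ℕ} {C : ℝ} {w : ℕ → ℝ}
    {q : ℕ → ℕ} (hi : s.nat 10 0 0 0 = i) (hP : s.nat 4 0 0 0 = P) (hC : s.real 2 i 0 0 = C)
    (hw : ∀ k, s.real 1 i k 0 = w k) (hq : ∀ k, s.nat 14 k 0 0 = q k) (hmL : m ≤ L) (hPL : P ≤ L) :
    Wp tableProg s (loopCost L (1 + 1) + loopCost L (loopCost L (1 + 1)) + 1) fun s' =>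
      Frame s s' [11, 13] [11] ∧ ∀ j ≤ m, ∀ p < P, s'.real 11 j p 0 = minWeight C w q j p := by
  refine Wp.seq (Q := fun s' => Frame s s' [11, 13] [11] ∧ ∀ p < P, s'.real 11 0 p 0 =
    minWeight C w q 0 p) ((Wp.forLoop (An := []) (Ar := [11]) (fun k s' => ∀ p < k,
      s'.real 11 0 p 0 = minWeight C w q 0 p) hP hPL (by simp) (by simp)
      (fun p hp => absurd hp (Nat.not_lt_zero _)) (fun k s x h => h) ?_).imp fun s' h =>
        ⟨h.1.mono (by simp) (by simp), h.2⟩) ?_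
  · intro k s₁ hk hf hc hJ
    have h10 : s₁.nat 10 0 0 0 = i := by rw [hf.1 10 (by simp), hi]
    have h2 : s₁.real 2 i 0 0 = C := by rw [hf.2 2 (by simp), hC]
    refine Wp.ite (fun ht => Wp.setReal ⟨Frame.writeReal _ _ _ _ _ (by simp), fun p hp => ?_⟩)
      fun ht => Wp.setReal ⟨Frame.writeReal _ _ _ _ _ (by simp), fun p hp => ?_⟩
    · by_cases he : p = k
      · subst he
        simp only [Test.Holds, NExpr.eval, eval_nvar, hc] at ht
        simp [hc, h10, h2, minWeight, ht.ne']
      · simp [hc, he, hJ p (by omega)]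
    · by_cases he : p = k
      · subst he
        simp only [Test.Holds, NExpr.eval, eval_nvar, hc, not_lt, Nat.le_zero] at ht
        simp [hc, minWeight, ht]
      · simp [hc, he, hJ p (by omega)]
  rintro s₁ ⟨hf₁, h₁⟩
  refine (Wp.forLoop (An := [13]) (Ar := [11]) (fun k s' => ∀ j ≤ k, ∀ p < P,
    s'.real 11 j p 0 = minWeight C w q j p) (N := m) (by rw [hf₁.1 1 (by simp), hm]) hmL (by simp)
    (by simp) (fun j hj p hp => by rw [Nat.le_zero.1 hj]; exact h₁ p hp) (fun k s x h => h) ?_).imp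
    fun s' h => ⟨hf₁.trans h.1, h.2⟩
  intro k s₂ hk hf₂ hc hJ
  have hf₂' := hf₁.trans hf₂
  refine (Wp.forLoop (An := []) (Ar := [11]) (fun k' s' => (∀ j ≤ k, ∀ p < P,
    s'.real 11 j p 0 = minWeight C w q j p) ∧ ∀ p < k', s'.real 11 (k + 1) p 0 =
      minWeight C w q (k + 1) p) (N := P) (by rw [hf₂'.1 4 (by simp), hP]) hPL (by simp) (by simp)
    ⟨hJ, fun p hp => absurd hp (Nat.not_lt_zero _)⟩ (fun k s x h => h) ?_).imp
    fun s' h => ⟨h.1, fun j hj p hp => ?_⟩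
  · rintro p s₃ hp hf₃ hcp ⟨hJ₁, hJ₂⟩
    have h10 : s₃.nat 10 0 0 0 = i := by rw [hf₃.1 10 (by simp), hf₂'.1 10 (by simp), hi]
    have h11 : s₃.nat 11 0 0 0 = k := by rw [hf₃.1 11 (by simp), hc]
    have h14 : s₃.nat 14 k 0 0 = q k := by rw [hf₃.1 14 (by simp), hf₂'.1 14 (by simp), hq]
    have hwk : s₃.real 1 i k 0 = w k := by rw [hf₃.2 1 (by simp), hf₂'.2 1 (by simp), hw]
    have htake := takesTest_holds (C := C) h10 h11 hcp hwk h14 hp (hJ₁ k le_rfl)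
    refine Wp.ite (fun ht => Wp.setReal ⟨Frame.writeReal _ _ _ _ _ (by simp), ?_, ?_⟩)
      fun ht => Wp.setReal ⟨Frame.writeReal _ _ _ _ _ (by simp), ?_, ?_⟩
    · intro j hj p' hp'
      have : j ≠ k + 1 := by omega
      simp [h11, this, hJ₁ j hj p' hp']
    · intro p' hp'
      by_cases he : p' = p
      · subst he
        rw [htake] at ht
        rw [minWeight_succ_of_takes C w q ht, ← hJ₁ k le_rfl (p' - q k) (by omega)]
        simp [tableEntry, h11, hcp, h14, h10, hwk]
      · simp [hcp, he, hJ₂ p' (by omega)]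
    · intro j hj p' hp'
      have : j ≠ k + 1 := by omega
      simp [h11, this, hJ₁ j hj p' hp']
    · intro p' hp'
      by_cases he : p' = p
      · subst he
        rw [htake] at ht
        rw [minWeight_succ_of_not_takes C w q ht, ← hJ₁ k le_rfl p' hp]
        simp [tableEntry, h11, hcp]
      · simp [hcp, he, hJ₂ p' (by omega)]
  · rcases Nat.lt_or_ge k j with hlt | hge
    · obtain rfl : j = k + 1 := by omega
      exact h.2.2 p hp
    · exact h.2.1 j hge p hp

/-- Find the largest level that can be reached within the capacity. -/
def bestLevelProg : Prog :=
  .seq (letNat 15 (.const 0)) (forLoop 13 4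
    (.ite (.realLt (.read 2 (nvar 10) (.const 0) (.const 0)) (tableEntry (nvar 1) (nvar 13)))
      (letNat 15 (nvar 15)) (letNat 15 (nvar 13))))

theorem bestLevelProg_spec {s : Memory} (hm : s.nat 1 0 0 0 = m) {i P L : ℕ} {C : ℝ} {w : ℕ → ℝ}
    {q : ℕ → ℕ} (hi : s.nat 10 0 0 0 = i) (hP : s.nat 4 0 0 0 = P) (hP0 : 0 < P)
    (hC : s.real 2 i 0 0 = C) (hC0 : 0 ≤ C)
    (hW : ∀ p < P, s.real 11 m p 0 = minWeight C w q m p) (hPL : P ≤ L) :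
    Wp bestLevelProg s (1 + loopCost L (1 + 1) + 1) fun s' =>
      Frame s s' [13, 15] [] ∧ s'.nat 15 0 0 0 < P ∧ minWeight C w q m (s'.nat 15 0 0 0) ≤ C ∧
        ∀ p < P, minWeight C w q m p ≤ C → p ≤ s'.nat 15 0 0 0 := by
  refine Wp.seq (Q := fun s' => Frame s s' [13, 15] [] ∧ s'.nat 15 0 0 0 = 0)
    (Wp.setNat ⟨Frame.writeNat _ _ _ _ _ (by simp), by simp⟩) ?_
  rintro s₁ ⟨hf₁, h₁⟩
  have h0 : minWeight C w q m 0 ≤ C := by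
    have := minWeight_le C w q m (S := ∅) (by simp)
    simp only [Finset.sum_empty] at this
    exact this.trans hC0
  refine (Wp.forLoop (An := [15]) (Ar := []) (fun k s' => s'.nat 15 0 0 0 < P ∧
    minWeight C w q m (s'.nat 15 0 0 0) ≤ C ∧ ∀ p < k, minWeight C w q m p ≤ C →
      p ≤ s'.nat 15 0 0 0) (N := P) (by rw [hf₁.1 4 (by simp), hP]) hPL (by simp) (by simp)
    ⟨by rwa [h₁], by rwa [h₁], fun p hp => absurd hp (Nat.not_lt_zero _)⟩
    (fun k s x h => by simpa using h) ?_).imp fun s' h => ⟨hf₁.trans h.1, h.2⟩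
  rintro k s₂ hk hf₂ hc ⟨hJ₁, hJ₂, hJ₃⟩
  have hf₂' := hf₁.trans hf₂
  have h10 : s₂.nat 10 0 0 0 = i := by rw [hf₂'.1 10 (by simp), hi]
  have h1 : s₂.nat 1 0 0 0 = m := by rw [hf₂'.1 1 (by simp), hm]
  have h2 : s₂.real 2 i 0 0 = C := by rw [hf₂'.2 2 (by simp), hC]
  have hWk : s₂.real 11 m k 0 = minWeight C w q m k := by rw [hf₂'.2 11 (by simp), hW k hk]
  refine Wp.ite (fun ht => Wp.setNat ⟨Frame.writeNat _ _ _ _ _ (by simp), ?_⟩)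
    fun ht => Wp.setNat ⟨Frame.writeNat _ _ _ _ _ (by simp), ?_⟩
  · simp only [Test.Holds, tableEntry, RExpr.eval, NExpr.eval, eval_nvar, h10, h1, h2, hc,
      hWk] at ht
    simp only [Memory.writeNat, NExpr.eval, eval_nvar, and_self, if_true]
    refine ⟨hJ₁, hJ₂, fun p hp hle => ?_⟩
    rcases Nat.lt_succ_iff_lt_or_eq.1 hp with hp | rfl
    · exact hJ₃ p hp hle
    · exact absurd ht (not_lt.2 hle)
  · simp only [Test.Holds, tableEntry, RExpr.eval, NExpr.eval, eval_nvar, h10, h1, h2, hc, hWk,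
      not_lt] at ht
    simp only [Memory.writeNat, NExpr.eval, eval_nvar, and_self, if_true, hc]
    exact ⟨hk, ht, fun p hp _ => Nat.lt_succ_iff.1 hp⟩

/-- Set the cell that tells whether the candidate gives the item in the counter `a` to bin `10`. -/
def setCandidate (a : ℕ) (e : NExpr) : Prog :=
  .setNat 7 (.add (nvar 5) (.const 1)) (nvar 10) (nvar a) e

/-- Read off the optimal set of the rounded problem by backtracking, and store it as the set of bin
`10` in the candidate. -/
def backtrackProg : Prog :=
  forLoop 12 1 (.seq (letNat 16 (.sub (.sub (nvar 1) (.const 1)) (nvar 12)))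
    (.ite (takesTest 16 15)
      (.seq (setCandidate 16 (.const 1)) (letNat 15 (.sub (nvar 15) (rounded 16))))
      (.seq (setCandidate 16 (.const 0)) (letNat 15 (nvar 15)))))

/-- `s'` differs from `s` in array `7` at most in the row `(l, i)`. -/
def SameRows (s s' : Memory) (l i : ℕ) : Prop :=
  ∀ l' i' j', ¬ (l' = l ∧ i' = i) → s'.nat 7 l' i' j' = s.nat 7 l' i' j'

theorem SameRows.trans {s s₁ s₂ : Memory} {l i : ℕ} (h : SameRows s s₁ l i)
    (h' : SameRows s₁ s₂ l i) : SameRows s s₂ l i := fun l' i' j' hne =>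
  (h' l' i' j' hne).trans (h l' i' j' hne)

theorem backtrackProg_spec {s : Memory} (hm : s.nat 1 0 0 0 = m) {i P Q L N : ℕ} {C : ℝ}
    {w : ℕ → ℝ} {q : ℕ → ℕ} (hi : s.nat 10 0 0 0 = i) (hN : s.nat 5 0 0 0 = N)
    (hQ : s.nat 15 0 0 0 = Q) (hQP : Q < P) (hw : ∀ k, s.real 1 i k 0 = w k)
    (hq : ∀ k, s.nat 14 k 0 0 = q k)
    (hW : ∀ j ≤ m, ∀ p < P, s.real 11 j p 0 = minWeight C w q j p) (hmL : m ≤ L) :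
    Wp backtrackProg s (loopCost L (1 + (1 + 1 + 1 + 1) + 1)) fun s' =>
      Frame s s' [12, 15, 16, 7] [] ∧ SameRows s s' (N + 1) i ∧
        ∀ j < m, s'.nat 7 (N + 1) i j = if j ∈ trace C w q m Q then 1 else 0 := by
  refine (Wp.forLoop (An := [15, 16, 7]) (Ar := []) (fun k s' => SameRows s s' (N + 1) i ∧
    s'.nat 15 0 0 0 < P ∧
    (∀ j < m, m ≤ j + k → s'.nat 7 (N + 1) i j = if j ∈ trace C w q m Q then 1 else 0) ∧
    ∀ j, j + k < m → (j ∈ trace C w q m Q ↔ j ∈ trace C w q (m - k) (s'.nat 15 0 0 0)))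
    hm hmL (by simp) (by simp)
    ⟨fun _ _ _ _ => rfl, by rwa [hQ], fun j hj hj' => absurd hj (by omega),
      fun j hj => by rw [hQ]; rfl⟩
    (fun k s x h => by
      simpa [SameRows] using h) ?_).imp
    fun s' h => ⟨h.1, h.2.1, fun j hj => h.2.2.2.1 j hj (by omega)⟩
  rintro k s₁ hk hf₁ hc ⟨hJ₁, hJ₂, hJ₃, hJ₄⟩
  refine Wp.seq (Q := fun s' => Frame s₁ s' [16] [] ∧ s'.nat 16 0 0 0 = m - 1 - k)
    (Wp.setNat ⟨Frame.writeNat _ _ _ _ _ (by simp), ?_⟩) ?_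
  · have h1 : s₁.nat 1 0 0 0 = m := by rw [hf₁.1 1 (by simp), hm]
    simp [h1, hc]
  rintro s₂ ⟨hf₂, h16⟩
  obtain ⟨j₀, hj₀⟩ : ∃ j₀, m - 1 - k = j₀ := ⟨_, rfl⟩
  rw [hj₀] at h16
  have hmk : m - k = j₀ + 1 := by omega
  have hmk' : m - (k + 1) = j₀ := by omega
  have h10 : s₂.nat 10 0 0 0 = i := by rw [hf₂.1 10 (by simp), hf₁.1 10 (by simp), hi]
  have h5 : s₂.nat 5 0 0 0 = N := by rw [hf₂.1 5 (by simp), hf₁.1 5 (by simp), hN]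
  have h15 : s₂.nat 15 0 0 0 = s₁.nat 15 0 0 0 := by rw [hf₂.1 15 (by simp)]
  have h14 : s₂.nat 14 j₀ 0 0 = q j₀ := by rw [hf₂.1 14 (by simp), hf₁.1 14 (by simp), hq]
  have hwj : s₂.real 1 i j₀ 0 = w j₀ := by rw [hf₂.2 1 (by simp), hf₁.2 1 (by simp), hw]
  have h7 : s₂.nat 7 = s₁.nat 7 := hf₂.1 7 (by simp)
  set p := s₁.nat 15 0 0 0 with hp
  have htake := takesTest_holds (C := C) h10 h16 h15 hwj h14 hJ₂ (fun p' hp' => by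
    rw [hf₂.2 11 (by simp), hf₁.2 11 (by simp), hW j₀ (by omega) p' hp'])
  -- One step of the backtracking that decides whether item `j₀` is taken.
  have main : ∀ (b p' : ℕ) (e : NExpr), p' ≤ p →
      (j₀ ∈ trace C w q (j₀ + 1) p ↔ b = 1) → (b = 1 ∨ b = 0) →
      (∀ j < j₀, j ∈ trace C w q (j₀ + 1) p ↔ j ∈ trace C w q j₀ p') →
      (∀ s', Frame s₂ s' [7] [] → e.eval s' = p') →
      Wp (.seq (setCandidate 16 (.const b)) (letNat 15 e)) s₂ (1 + 1 + 1) fun s' =>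
        Frame s₁ s' [15, 16, 7] [] ∧ SameRows s s' (N + 1) i ∧ s'.nat 15 0 0 0 < P ∧
        (∀ j < m, m ≤ j + (k + 1) →
          s'.nat 7 (N + 1) i j = if j ∈ trace C w q m Q then 1 else 0) ∧
        ∀ j, j + (k + 1) < m →
          (j ∈ trace C w q m Q ↔ j ∈ trace C w q (m - (k + 1)) (s'.nat 15 0 0 0)) := by
    intro b p' e hpp hb hb' htr he
    refine Wp.seq (Q := fun s' => Frame s₂ s' [7] [] ∧ ∀ l i' j, s'.nat 7 l i' j =
      if l = N + 1 ∧ i' = i ∧ j = j₀ then b else s₁.nat 7 l i' j)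
      (Wp.setNat ⟨Frame.writeNat _ _ _ _ _ (by simp), fun l i' j => ?_⟩) ?_
    · simp [h5, h10, h16, h7]
    rintro s₃ ⟨hf₃, hs₃⟩
    have hev := he s₃ hf₃
    refine Wp.setNat ⟨?_, ?_, ?_, ?_, ?_⟩
    · exact ((hf₂.mono (by simp) (by simp)).trans (hf₃.mono (by simp) (by simp))).trans
        (Frame.writeNat _ _ _ _ _ (by simp))
    · intro l i' j hne
      have : ¬ (l = N + 1 ∧ i' = i ∧ j = j₀) := by tauto
      simpa [hs₃, this] using hJ₁ l i' j hne
    · simp [hev]; omega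
    · intro j hj hjk
      by_cases hjj : j = j₀
      · have h8 : (j ∈ trace C w q m Q) ↔ b = 1 := by
          rw [hJ₄ j (by omega), hmk, hjj, hb]
        simp only [Memory.writeNat, hs₃, hjj]
        rw [hjj] at h8
        rcases hb' with h | h <;> simp [h8, h]
      · simpa [hs₃, hjj] using hJ₃ j hj (by omega)
    · intro j hj
      rw [hJ₄ j (by omega), hmk, hmk', htr j (by omega)]
      simp [hev]
  refine Wp.ite (fun ht => main 1 (p - q j₀) _ (Nat.sub_le _ _) ?_ (Or.inl rfl) ?_ ?_)
    fun ht => main 0 p _ le_rfl ?_ (Or.inr rfl) ?_ ?_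
  · rw [htake] at ht
    simp [trace_succ_of_takes C w q ht]
  · rw [htake] at ht
    intro j hj
    rw [trace_succ_of_takes C w q ht, Finset.mem_insert]
    exact ⟨fun h => h.resolve_left hj.ne, Or.inr⟩
  · intro s' hf
    simp [hf.1 15 (by simp), hf.1 16 (by simp), hf.1 14 (by simp), h15, h16, h14]
  · rw [htake] at ht
    rw [trace_succ_of_not_takes C w q ht]
    simp only [zero_ne_one, iff_false]
    exact fun h => lt_irrefl _ (lt_of_mem_trace C w q h)
  · rw [htake] at ht
    intro j hj
    rw [trace_succ_of_not_takes C w q ht]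
  · intro s' hf
    simp [hf.1 15 (by simp), h15]

/-- The knapsack approximation scheme for bin `10`. -/
def knapsackProg : Prog :=
  .seq largestProg (.seq (letReal 10 (.div (.mul accuracy (rvar 9)) (.ofNat (nvar 1))))
    (.seq roundProg (.seq tableProg (.seq bestLevelProg backtrackProg))))

/-- The cost of the knapsack approximation scheme for one bin. -/
def knapsackCost {R : Type*} [Semiring R] (L : R) : R :=
  1 + loopCost L (1 + 1) + 1 + (1 + (loopCost L (1 + (L * 2 + 1) + 1) +
    (loopCost L (1 + 1) + loopCost L (loopCost L (1 + 1)) + 1 + (1 + loopCost L (1 + 1) + 1 +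
      loopCost L (1 + (1 + 1 + 1 + 1) + 1) + 1) + 1) + 1) + 1) + 1

theorem le_storeSize_knapsack (n m : ℕ) {η : ℝ} (hη : 0 < η) (hn : 0 < n) :
    m / η ≤ storeSize n m η := by
  refine le_trans ?_ (PublicData.le_storeSize n m)
  refine div_le_div_of_nonneg_right ?_ hη.le
  have hn' : (1 : ℝ) ≤ n := by exact_mod_cast hn
  have hm' : (0 : ℝ) ≤ m := Nat.cast_nonneg m
  nlinarith [mul_nonneg hm' (show (0 : ℝ) ≤ n ^ 2 - 1 by nlinarith)]

theorem knapsackProg_spec {G : PublicData n m} {ε : ℝ} (hε : 0 < ε) (hε1 : ε ≤ 1) {v : Values n m}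
    {s : Memory} (h : HasInput G ε v s) {i : Fin n} {N L : ℕ} (hi : s.nat 10 0 0 0 = i)
    (hN : s.nat 5 0 0 0 = N) (hK : s.nat 3 0 0 0 = storeSize n m (ε / 4))
    (hP : s.nat 4 0 0 0 = m * storeSize n m (ε / 4) + 1) {u : Fin n → Fin m → ℝ}
    (hu : ∀ i j, s.real 6 i.1 j.1 0 = u i j) (hu0 : ∀ i j, 0 ≤ u i j) (hmL : m ≤ L)
    (hKL : storeSize n m (ε / 4) ≤ L) (hPL : m * storeSize n m (ε / 4) + 1 ≤ L) :
    Wp knapsackProg s (knapsackCost L) fun s' =>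
      Frame s s' [11, 12, 13, 14, 15, 16, 7] [9, 10, 11] ∧ SameRows s s' (N + 1) i ∧
      ∃ S : Finset (Fin m), (G.Fits i S ∧ ∀ S', G.Fits i S' →
        (1 - ε / 4) * ∑ j ∈ S', u i j ≤ ∑ j ∈ S, u i j) ∧
        ∀ j : Fin m, s'.nat 7 (N + 1) i j = if j ∈ S then 1 else 0 := by
  set K := storeSize n m (ε / 4) with hKdef
  refine Wp.seq (largestProg_spec h hi hu hmL) ?_
  rintro s₁ ⟨hf₁, hU, hU'⟩
  have i₁ := h.frame hf₁ (by simp) (by simp) (by simp; omega)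
  set U := s₁.real 9 0 0 0 with hUdef
  obtain ⟨θ, hθ⟩ : ∃ θ, θ = ε / 4 * U / m := ⟨_, rfl⟩
  refine Wp.seq (Q := fun s' => Frame s₁ s' [] [10] ∧ s'.real 10 0 0 0 = θ)
    (Wp.setReal ⟨Frame.writeReal _ _ _ _ _ (by simp), ?_⟩) ?_
  · simp [i₁.accuracy, i₁.nat_one, hθ, hUdef]
  rintro s₂ ⟨hf₂, hθ₂⟩
  have hf₂' : Frame s s₂ [11, 12, 13, 14, 15, 16, 7] [9, 10, 11] :=
    (hf₁.mono (by simp) (by simp)).trans (hf₂.mono (by simp) (by simp))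
  have i₂ := i₁.frame hf₂ (by simp) (by simp) (by simp; omega)
  refine Wp.seq (roundProg_spec i₂.nat_one (i := i) (u := u) (K := K) (by
    rw [hf₂'.1 10 (by simp), hi]) (fun i j => by rw [hf₂'.2 6 (by simp), hu]) hu0
    (by rw [hf₂'.1 3 (by simp), hK]) hθ₂ hmL hKL) ?_
  rintro s₃ ⟨hf₃, hq⟩
  have hf₃' := hf₂'.trans (hf₃.mono (by simp) (by simp))
  have i₃ := i₂.frame hf₃ (by simp) (by simp) (by simp)
  refine Wp.seq (tableProg_spec i₃.nat_one (i := i) (w := fun k => s₃.real 1 i k 0)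
    (q := fun k => s₃.nat 14 k 0 0) (by rw [hf₃'.1 10 (by simp), hi])
    (by rw [hf₃'.1 4 (by simp), hP]) (i₃.capacity i) (fun _ => rfl) (fun _ => rfl) hmL hPL) ?_
  rintro s₄ ⟨hf₄, hW⟩
  have hf₄' := hf₃'.trans (hf₄.mono (by simp) (by simp))
  have i₄ := i₃.frame hf₄ (by simp) (by simp) (by simp; omega)
  refine Wp.seq (bestLevelProg_spec i₄.nat_one (i := i) (by rw [hf₄'.1 10 (by simp), hi])
    (by rw [hf₄'.1 4 (by simp), hP]) (Nat.succ_pos _) (i₄.capacity i) (G.capacity_nonneg i)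
    (fun p hp => hW m le_rfl p hp) hPL) ?_
  rintro s₅ ⟨hf₅, hQP, hQ, hQ'⟩
  have hf₅' := hf₄'.trans (hf₅.mono (by simp) (by simp))
  have i₅ := i₄.frame hf₅ (by simp) (by simp) (by simp)
  refine (backtrackProg_spec i₅.nat_one (i := i) (N := N) (by rw [hf₅'.1 10 (by simp), hi])
    (by rw [hf₅'.1 5 (by simp), hN]) rfl hQP (w := fun k => s₃.real 1 i k 0)
    (q := fun k => s₃.nat 14 k 0 0) (fun k => by rw [hf₅.2 1 (by simp), hf₄.2 1 (by simp)])
    (fun k => by rw [hf₅.1 14 (by simp), hf₄.1 14 (by simp)])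
    (fun j hj p hp => by rw [hf₅.2 11 (by simp)]; exact hW j hj p hp) hmL).imp ?_
  rintro s₆ ⟨hf₆, hrows, hbits⟩
  refine ⟨hf₅'.trans (hf₆.mono (by simp) (by simp)), ?_, ?_⟩
  · refine SameRows.trans ?_ hrows
    intro l i' j _
    rw [hf₅.1 7 (by simp), hf₄.1 7 (by simp), hf₃.1 7 (by simp), hf₂.1 7 (by simp),
      hf₁.1 7 (by simp)]
  · have hu₃ : ∀ j : Fin m, s₃.real 6 i j 0 = u i j := fun j => by rw [hf₃'.2 6 (by simp), hu]
    obtain ⟨h1, h2⟩ := knapsack_approx G i (η := ε / 4) (U := U) (θ := θ) (K := K)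
      (w := fun k => s₃.real 1 i k 0) (u := fun k => s₃.real 6 i k 0)
      (q := fun k => s₃.nat 14 k 0 0) (P := s₅.nat 15 0 0 0) (by linarith) (by linarith)
      (fun k => i₃.weight_nonneg i k) (fun j => i₃.weight i j) (fun j => by rw [hu₃]; exact hu0 i j)
      (le_storeSize_knapsack n m (by linarith) i.pos) hθ (fun j hj => by rw [hu₃]; exact hU j hj)
      (by simpa only [hu₃] using hU') (fun j => (hq j).1)
      (fun j => by rw [hu₃]; exact (hq j).2.1) (fun j hj => by rw [hu₃]; exact (hq j).2.2 hj)
      hQ (fun p hp => hQ' p (Nat.lt_succ_of_le hp))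
    refine ⟨_, ⟨h1, fun S' hS' => ?_⟩, fun j => ?_⟩
    · simpa only [hu₃] using h2 S' hS'
    · rw [hbits j j.2]
      simp [itemsOf]

end

end GAP

namespace GAP

noncomputable section

open RealRAM

variable {n m : ℕ}

/-! ### The program: local search -/

/-- Find a candidate for all bins. -/
def candidateProg : Prog := forLoop 10 0 knapsackProg

/-- The data that stay fixed after the set-up. -/
structure SetUp (G : PublicData n m) (ε : ℝ) (v : Values n m) (s : Memory) : Prop
    extends HasInput G ε v s where
  size : s.nat 3 0 0 0 = storeSize n m (ε / 4)
  levels : s.nat 4 0 0 0 = m * storeSize n m (ε / 4) + 1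
  largest : s.real 7 0 0 0 = G.maxValue v

theorem SetUp.frame {G : PublicData n m} {ε : ℝ} {v : Values n m} {s s' : Memory}
    (h : SetUp G ε v s) {An Ar : List ℕ} (hf : Frame s s' An Ar)
    (hn : ∀ a ∈ [0, 1, 3, 4], a ∉ An) (hr : ∀ a ∈ [0, 1, 2, 3, 7], a ∉ Ar) : SetUp G ε v s' where
  toHasInput := h.toHasInput.frame hf (hn 0 (by simp)) (hn 1 (by simp)) fun a ha => hr a (by
    simp; omega)
  size := by rw [hf.1 3 (hn 3 (by simp)), h.size]
  levels := by rw [hf.1 4 (hn 4 (by simp)), h.levels]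
  largest := by rw [hf.2 7 (hr 7 (by simp)), h.largest]

theorem candidateProg_spec {G : PublicData n m} {ε : ℝ} (hε : 0 < ε) (hε1 : ε ≤ 1)
    {v : Values n m} {s : Memory} (h : SetUp G ε v s) {N L : ℕ} (hN : s.nat 5 0 0 0 = N)
    {u : Fin n → Fin m → ℝ} (hu : ∀ i j, s.real 6 i.1 j.1 0 = u i j) (hu0 : ∀ i j, 0 ≤ u i j)
    (hnL : n ≤ L) (hmL : m ≤ L) (hKL : storeSize n m (ε / 4) ≤ L)
    (hPL : m * storeSize n m (ε / 4) + 1 ≤ L) :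
    Wp candidateProg s (loopCost L (knapsackCost L)) fun s' =>
      Frame s s' [10, 11, 12, 13, 14, 15, 16, 7] [9, 10, 11] ∧
      (∀ l ≠ N + 1, s'.nat 7 l = s.nat 7 l) ∧
      ∃ z : Alloc n m, G.IsKnapsackApprox (ε / 4) u z ∧
        ∀ i j, s'.nat 7 (N + 1) i.1 j.1 = if j ∈ z i then 1 else 0 := by
  refine (Wp.forLoop (An := [11, 12, 13, 14, 15, 16, 7]) (Ar := [9, 10, 11]) (fun k s' =>
    (∀ l ≠ N + 1, s'.nat 7 l = s.nat 7 l) ∧ ∀ i : Fin n, i.1 < k → ∃ S : Finset (Fin m),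
      (G.Fits i S ∧ ∀ S', G.Fits i S' → (1 - ε / 4) * ∑ j ∈ S', u i j ≤ ∑ j ∈ S, u i j) ∧
        ∀ j : Fin m, s'.nat 7 (N + 1) i j = if j ∈ S then 1 else 0)
    h.nat_zero hnL (by simp) (by simp)
    ⟨fun _ _ => rfl, fun i hi => absurd hi (Nat.not_lt_zero _)⟩
    (fun k s' x h => ⟨fun l hl => by simpa using h.1 l hl, fun i hi => by simpa using h.2 i hi⟩)
    ?_).imp ?_
  · rintro k s₁ hk hf hc ⟨hJ₁, hJ₂⟩
    have i₁ := h.frame hf (by simp) (by simp)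
    refine (knapsackProg_spec hε hε1 i₁.toHasInput (i := ⟨k, hk⟩) hc
      (by rw [hf.1 5 (by simp), hN]) i₁.size i₁.levels
      (fun i j => by rw [hf.2 6 (by simp), hu]) hu0 hmL hKL hPL).imp ?_
    rintro s₂ ⟨hf₂, hrows, S, hS, hbits⟩
    refine ⟨hf₂, fun l hl => ?_, fun i hi => ?_⟩
    · rw [← hJ₁ l hl]
      funext i' j'
      exact hrows l i' j' fun h => hl h.1
    · by_cases he : i.1 = k
      · obtain rfl : i = ⟨k, hk⟩ := Fin.ext he
        exact ⟨S, hS, hbits⟩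
      · obtain ⟨S', hS', hb'⟩ := hJ₂ i (by omega)
        exact ⟨S', hS', fun j => by rw [hrows _ _ _ fun h => he h.2, hb']⟩
  · rintro s' ⟨hf, hsame, hall⟩
    choose z hz hb using fun i : Fin n => hall i i.2
    exact ⟨hf, hsame, z, hz, hb⟩

/-- The entry at the counters `10` and `11` of the vector in slot `l`. -/
def slotEntry (l : NExpr) : RExpr := .ofNat (.read 7 l (nvar 10) (nvar 11))

/-- Find a stored vector of least value with respect to the current gradient. -/
def argminProg : Prog :=
  forLoop 12 5 (.seq (sumLoop₂ (.mul (slotEntry (.add (nvar 12) (.const 1))) (entry 6 10 11)))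
    (.ite (.and (.natLt (.const 0) (nvar 12)) (.not (.realLt (rvar 8) (rvar 12))))
      (.seq (letReal 12 (rvar 12)) (letNat 17 (nvar 17)))
      (.seq (letReal 12 (rvar 8)) (letNat 17 (nvar 12)))))

theorem argminProg_spec {G : PublicData n m} {ε : ℝ} {v : Values n m} {s : Memory}
    (h : HasInput G ε v s) {N L : ℕ} (hN0 : 0 < N) {z : Fin N → Alloc n m} (hz : Holds N z s)
    {u : Fin n → Fin m → ℝ} (hu : ∀ i j, s.real 6 i.1 j.1 0 = u i j) (hnL : n ≤ L) (hmL : m ≤ L)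
    (hNL : N ≤ L) :
    Wp argminProg s
      (loopCost L (1 + loopCost L (loopCost L (1 + 1)) + 1 + (1 + 1 + 1 + 1) + 1)) fun s' =>
      Frame s s' [12, 10, 11, 17] [8, 12] ∧ ∃ l₀ : Fin N, s'.nat 17 0 0 0 = l₀ ∧
        ∀ l, dot (z l₀) u ≤ dot (z l) u := by
  refine (Wp.forLoop (An := [10, 11, 17]) (Ar := [8, 12]) (fun k s' => k = 0 ∨ ∃ l₀ : Fin N,
    s'.nat 17 0 0 0 = l₀ ∧ s'.real 12 0 0 0 = dot (z l₀) u ∧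
      ∀ l : Fin N, l.1 < k → dot (z l₀) u ≤ dot (z l) u) hz.1 hNL (by simp) (by simp) (Or.inl rfl)
    (fun k s x h => by simpa using h) ?_).imp ?_
  · intro k s₁ hk hf₁ hc hJ
    have i₁ := h.frame hf₁ (by simp) (by simp) (by simp; omega)
    refine Wp.seq (B := 1 + loopCost L (loopCost L (1 + 1)) + 1) (B' := 1 + 1 + 1 + 1)
      (Wp.sumLoop₂ (fun i j => indicator (z ⟨k, hk⟩) i j * u i j) i₁.nat_zero i₁.nat_one
      hnL hmL ?_) ?_
    · intro i j s₂ hf₂ hi hj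
      have h7 : s₂.nat 7 = s.nat 7 := by rw [hf₂.1 7 (by simp), hf₁.1 7 (by simp)]
      have h6 : s₂.real 6 = s.real 6 := by rw [hf₂.2 6 (by simp), hf₁.2 6 (by simp)]
      have h12 : s₂.nat 12 0 0 0 = k := by rw [hf₂.1 12 (by simp), hc]
      have hb := hz.2 ⟨k, hk⟩ i j
      simp only at hb
      simp [slotEntry, hi, hj, h7, h6, h12, hb, hu, indicator]
    rintro s₂ ⟨hf₂, h8⟩
    rw [← dot_eq] at h8
    have h12 : s₂.nat 12 0 0 0 = k := by rw [hf₂.1 12 (by simp), hc]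
    have h12r : s₂.real 12 = s₁.real 12 := hf₂.2 12 (by simp)
    have h17 : s₂.nat 17 = s₁.nat 17 := hf₂.1 17 (by simp)
    have hf₂' : Frame s₁ s₂ [10, 11, 17] [8, 12] := hf₂.mono (by simp) (by simp)
    refine Wp.ite (fun ht => Wp.seq (Q := fun s' => Frame s₁ s' [10, 11, 17] [8, 12] ∧
        s'.real 12 0 0 0 = s₁.real 12 0 0 0 ∧ s'.nat 17 = s₁.nat 17) (Wp.setReal ⟨?_, ?_, ?_⟩) ?_)
      fun ht => Wp.seq (Q := fun s' => Frame s₁ s' [10, 11, 17] [8, 12] ∧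
        s'.real 12 0 0 0 = dot (z ⟨k, hk⟩) u ∧ s'.nat 12 0 0 0 = k) (Wp.setReal ⟨?_, ?_, ?_⟩) ?_
    · exact hf₂'.trans (Frame.writeReal _ _ _ _ _ (by simp))
    · simp [h12r]
    · exact h17
    · rintro s₃ ⟨hf₃, h12', h17'⟩
      refine Wp.setNat ⟨hf₃.trans (Frame.writeNat _ _ _ _ _ (by simp)), Or.inr ?_⟩
      simp only [Test.Holds, NExpr.eval, eval_nvar, eval_rvar, h12, h8, h12r, not_lt] at ht
      rcases hJ with h0 | ⟨l₀, g1, g2, g3⟩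
      · omega
      refine ⟨l₀, by simp [h17', g1], by simp [h12', g2], fun l hl => ?_⟩
      by_cases he : l.1 = k
      · obtain rfl : l = ⟨k, hk⟩ := Fin.ext he
        rw [← g2]
        exact ht.2
      · exact g3 l (by omega)
    · exact hf₂'.trans (Frame.writeReal _ _ _ _ _ (by simp))
    · simp [h8]
    · exact h12
    · rintro s₃ ⟨hf₃, h12', hk'⟩
      refine Wp.setNat ⟨hf₃.trans (Frame.writeNat _ _ _ _ _ (by simp)), Or.inr ?_⟩
      refine ⟨⟨k, hk⟩, by simp [hk'], by simp [h12'], fun l hl => ?_⟩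
      by_cases he : l.1 = k
      · obtain rfl : l = ⟨k, hk⟩ := Fin.ext he
        exact le_rfl
      · simp only [Test.Holds, NExpr.eval, eval_nvar, eval_rvar, h12, h8, h12r, not_and,
          not_not] at ht
        rcases hJ with h0 | ⟨l₀, g1, g2, g3⟩
        · omega
        · have := ht (by omega)
          rw [g2] at this
          exact this.le.trans (g3 l (by omega))
  · rintro s' ⟨hf, h0 | ⟨l₀, g1, g2, g3⟩⟩
    · omega
    · exact ⟨hf, l₀, g1, fun l => g3 l l.2⟩

/-- Copy the candidate to the slot of the vector to be removed. -/
def copyProg : Prog :=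
  forLoop₂ 10 0 11 1 (.setNat 7 (.add (nvar 17) (.const 1)) (nvar 10) (nvar 11)
    (.read 7 (.add (nvar 5) (.const 1)) (nvar 10) (nvar 11)))

theorem copyProg_spec {G : PublicData n m} {ε : ℝ} {v : Values n m} {s : Memory}
    (h : HasInput G ε v s) {N l₀ L : ℕ} (hN : s.nat 5 0 0 0 = N) (hl₀ : s.nat 17 0 0 0 = l₀)
    (hlt : l₀ < N) (hnL : n ≤ L) (hmL : m ≤ L) :
    Wp copyProg s (loopCost L (loopCost L 1)) fun s' =>
      Frame s s' [10, 11, 7] [] ∧ (∀ l ≠ l₀ + 1, s'.nat 7 l = s.nat 7 l) ∧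
        ∀ (i : Fin n) (j : Fin m), s'.nat 7 (l₀ + 1) i j = s.nat 7 (N + 1) i j := by
  refine Wp.forLoop₂_invariant (fun s' => ∀ l ≠ l₀ + 1, s'.nat 7 l = s.nat 7 l)
    (fun (i : Fin n) (j : Fin m) s' => s'.nat 7 (l₀ + 1) i j = s.nat 7 (N + 1) i j) h.nat_zero
    h.nat_one hnL hmL (by simp) (by simp) (by simp) (by simp) (fun _ _ => rfl) ?_ ?_ ?_
  · rintro s' c x (rfl | rfl) hI l hl <;> simpa using hI l hl
  · rintro i j s' c x (rfl | rfl) hI <;> simpa using hI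
  · intro i j s₁ hf hi hj hI
    have h17 : s₁.nat 17 0 0 0 = l₀ := by rw [hf.1 17 (by simp), hl₀]
    have h5 : s₁.nat 5 0 0 0 = N := by rw [hf.1 5 (by simp), hN]
    refine Wp.setNat ⟨Frame.writeNat _ _ _ _ _ (by simp), fun l hl => ?_, ?_, fun i' j' hne h => ?_⟩
    · simp [h17, hl, hI l hl]
    · simp [h17, h5, hi, hj, hI (N + 1) (by omega)]
    · simp only [Memory.writeNat, NExpr.eval, eval_nvar, h17, hi, hj]
      rw [if_neg (by tauto), h]

/-- Store the candidate; if the store is full, it replaces a vector of least value. -/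
def insertProg : Prog :=
  .ite (.natLt (nvar 5) (nvar 3)) (letNat 5 (.add (nvar 5) (.const 1))) (.seq argminProg copyProg)

/-- One iteration of the local search. -/
def iterationProg : Prog :=
  .seq marginalProg (.seq survivalProg (.seq gradientProg (.seq candidateProg
    (.seq (sumLoop₂ (.mul (.sub (slotEntry (.add (nvar 5) (.const 1))) (entry 4 10 11))
      (entry 6 10 11)))
      (.ite (.realLt (.mul accuracy (rvar 7)) (rvar 8)) insertProg (letNat 6 (.const 0)))))))

/-- The cost of one iteration of the local search. -/
def iterationCost {R : Type*} [Semiring R] (L : R) : R :=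
  loopCost L (loopCost L (1 + (loopCost L (1 + 1) + 1 + 1) + 1)) +
  (loopCost L (loopCost L (1 + (loopCost L (1 + 1) + 1 + 1) + 1)) +
  (loopCost L (loopCost L (1 + (loopCost L (1 + 1) + 1 + 1) + 1)) +
  (loopCost L (knapsackCost L) + (1 + loopCost L (loopCost L (1 + 1)) + 1 +
    (loopCost L (1 + loopCost L (loopCost L (1 + 1)) + 1 + (1 + 1 + 1 + 1) + 1) +
      loopCost L (loopCost L 1) + 1 + 1 + 1) + 1) + 1) + 1) + 1) + 1

/-- The state of the local search between two iterations: `N` vectors `z` are stored, and slot `0`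
is the zero vector. -/
structure SearchState (G : PublicData n m) (ε : ℝ) (v : Values n m) (N : ℕ)
    (z : Fin N → Alloc n m) (s : Memory) : Prop extends SetUp G ε v s where
  holds : Holds N z s
  zero : ∀ (i : Fin n) (j : Fin m), s.nat 7 0 i j = 0

theorem storeOf_snoc {N : ℕ} (z : Fin N → Alloc n m) (z' : Alloc n m) :
    storeOf (Fin.snoc (α := fun _ => Alloc n m) z z') = z' ::ₘ storeOf z := by
  simp [storeOf, Fin.univ_castSuccEmb, Function.comp_def]

theorem storeOf_eq_cons {N : ℕ} (z : Fin N → Alloc n m) (l : Fin N) :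
    storeOf z = z l ::ₘ (Finset.univ.erase l).val.map z := by
  rw [storeOf, ← Finset.insert_erase (Finset.mem_univ l), Finset.insert_val_of_notMem (by simp),
    Multiset.map_cons, Finset.insert_erase (Finset.mem_univ l)]

theorem storeOf_update {N : ℕ} (z : Fin N → Alloc n m) (l : Fin N) (z' : Alloc n m) :
    storeOf (Function.update z l z') = z' ::ₘ (storeOf z).erase (z l) := by
  rw [storeOf_eq_cons _ l, storeOf_eq_cons z l, Multiset.erase_cons_head, Function.update_self]
  congr 1
  refine Multiset.map_congr rfl fun k hk => ?_
  have : k ≠ l := (Finset.mem_erase.1 (Finset.mem_def.2 hk)).1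
  rw [Function.update_of_ne this]

theorem card_storeOf {N : ℕ} (z : Fin N → Alloc n m) : (storeOf z).card = N := by simp [storeOf]

theorem mem_storeOf {N : ℕ} (z : Fin N → Alloc n m) (z' : Alloc n m) :
    z' ∈ storeOf z ↔ ∃ l, z l = z' := by simp [storeOf]

theorem iterationProg_spec {G : PublicData n m} {ε : ℝ} (hε : 0 < ε) (hε1 : ε ≤ 1)
    {v : Values n m} (hv : 0 ≤ v) {s : Memory} {N : ℕ} {z : Fin N → Alloc n m}
    (h : SearchState G ε v N z s) (hNK : N ≤ storeSize n m (ε / 4)) (hrun : s.nat 6 0 0 0 = 1)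
    {L : ℕ} (hnL : n ≤ L) (hmL : m ≤ L) (hKL : storeSize n m (ε / 4) ≤ L)
    (hPL : m * storeSize n m (ε / 4) + 1 ≤ L) :
    Wp iterationProg s (iterationCost L) fun s' =>
      ∃ N' z', SearchState G ε v N' z' s' ∧
        ((s'.nat 6 0 0 0 = 1 ∧ G.SearchStep (ε / 4) v (storeOf z) (storeOf z')) ∨
          (s'.nat 6 0 0 0 = 0 ∧ storeOf z' = storeOf z ∧
            G.SearchStops (ε / 4) v (storeOf z))) := by
  set y := marginal (storePoint (ε / 4) (storeOf z)) with hy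
  have hy0 : 0 ≤ y := marginal_nonneg (storePoint_nonneg _ _)
  refine Wp.seq (marginalProg_spec h.toHasInput h.holds h.size hnL hmL (hNK.trans hKL)) ?_
  rintro s₁ ⟨hf₁, hy₁⟩
  have i₁ := h.toSetUp.frame hf₁ (by simp) (by simp)
  refine Wp.seq (survivalProg_spec i₁.toHasInput hy₁ hnL hmL) ?_
  rintro s₂ ⟨hf₂, hE₂⟩
  have i₂ := i₁.frame hf₂ (by simp) (by simp)
  have hy₂ : ∀ i j, s₂.real 4 i.1 j.1 0 = y i j := fun i j => by rw [hf₂.2 4 (by simp), hy₁]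
  refine Wp.seq (gradientProg_spec i₂.toHasInput hy₂ hE₂ hnL hmL) ?_
  rintro s₃ ⟨hf₃, hu₃⟩
  have i₃ := i₂.frame hf₃ (by simp) (by simp)
  have hy₃ : ∀ i j, s₃.real 4 i.1 j.1 0 = y i j := fun i j => by rw [hf₃.2 4 (by simp), hy₂]
  have h7₃ : s₃.nat 7 = s.nat 7 := by
    rw [hf₃.1 7 (by simp), hf₂.1 7 (by simp), hf₁.1 7 (by simp)]
  have h5₃ : s₃.nat 5 0 0 0 = N := by
    rw [hf₃.1 5 (by simp), hf₂.1 5 (by simp), hf₁.1 5 (by simp), h.holds.1]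
  have h6₃ : s₃.nat 6 0 0 0 = 1 := by
    rw [hf₃.1 6 (by simp), hf₂.1 6 (by simp), hf₁.1 6 (by simp), hrun]
  refine Wp.seq (candidateProg_spec hε hε1 i₃ h5₃ hu₃ (gradient_nonneg hv y) hnL hmL hKL hPL) ?_
  rintro s₄ ⟨hf₄, hsame, z₁, hz₁, hb₁⟩
  have i₄ := i₃.frame hf₄ (by simp) (by simp)
  have h5₄ : s₄.nat 5 0 0 0 = N := by rw [hf₄.1 5 (by simp), h5₃]
  refine Wp.seq (Wp.sumLoop₂ (fun i j => (indicator z₁ i j - y i j) * gradient v y i j)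
    i₄.nat_zero i₄.nat_one hnL hmL ?_) ?_
  · intro i j s₅ hf₅ hi hj
    have h7 : s₅.nat 7 = s₄.nat 7 := hf₅.1 7 (by simp)
    have h4 : s₅.real 4 = s₃.real 4 := by rw [hf₅.2 4 (by simp), hf₄.2 4 (by simp)]
    have h6 : s₅.real 6 = s₃.real 6 := by rw [hf₅.2 6 (by simp), hf₄.2 6 (by simp)]
    have h5 : s₅.nat 5 0 0 0 = N := by rw [hf₅.1 5 (by simp), h5₄]
    simp [slotEntry, hi, hj, h7, h6, h4, h5, hb₁, hu₃, hy₃, indicator]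
  rintro s₅ ⟨hf₅, h8⟩
  have i₅ := i₄.frame hf₅ (by simp) (by simp)
  have h5₅ : s₅.nat 5 0 0 0 = N := by rw [hf₅.1 5 (by simp), h5₄]
  have h6₅ : s₅.nat 6 0 0 0 = 1 := by rw [hf₅.1 6 (by simp), hf₄.1 6 (by simp), h6₃]
  have h7₅ : ∀ l ≠ N + 1, s₅.nat 7 l = s.nat 7 l := fun l hl => by
    rw [hf₅.1 7 (by simp), hsame l hl, h7₃]
  have hb₅ : ∀ i j, s₅.nat 7 (N + 1) i.1 j.1 = if j ∈ z₁ i then 1 else 0 := fun i j => by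
    rw [hf₅.1 7 (by simp), hb₁]
  have hz₅ : Holds N z s₅ := ⟨h5₅, fun l i j => by
    rw [h7₅ _ (by have := l.2; omega), h.holds.2]⟩
  have hzero₅ : ∀ (i : Fin n) (j : Fin m), s₅.nat 7 0 i j = 0 := fun i j => by
    rw [h7₅ 0 (by omega), h.zero]
  have hu₅ : ∀ i j, s₅.real 6 i.1 j.1 0 = gradient v y i j := fun i j => by
    rw [hf₅.2 6 (by simp), hf₄.2 6 (by simp), hu₃]
  have himp : (Test.realLt (.mul accuracy (rvar 7)) (rvar 8)).Holds s₅ ↔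
      G.Improves (ε / 4) v (storeOf z) z₁ := by
    unfold PublicData.Improves
    rw [dot_eq, ← Finset.sum_sub_distrib]
    simp only [← Finset.sum_sub_distrib, ← sub_mul]
    simp only [Test.Holds, RExpr.eval, eval_accuracy, eval_rvar, i₅.accuracy, i₅.largest, h8, hy]
  refine Wp.ite (fun ht => ?_) fun ht => ?_
  · rw [himp] at ht
    have hM := G.maxValue_pos_of_improves hv (fun i => (hz₁ i).1) ht
    refine Wp.ite (fun hlt => ?_) fun hge => ?_
    · -- The store is not full: the candidate already is in the right slot.
      simp only [Test.Holds, eval_nvar, h5₅, i₅.size] at hlt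
      refine Wp.mono (B := 1) (Wp.setNat ⟨N + 1,
        Fin.snoc (α := fun _ => Alloc n m) z z₁, ?_,
        Or.inl ⟨by simpa using h6₅, z₁, hz₁, ht, Or.inl ⟨?_, storeOf_snoc z z₁⟩⟩⟩) (by omega)
        fun _ h => h
      · refine ⟨i₅.frame (Frame.writeNat _ _ _ _ _ (An := [5]) (Ar := []) (by simp)) (by simp)
          (by simp), ⟨by simp [h5₅], fun l i j => ?_⟩, fun i j => ?_⟩
        · refine Fin.lastCases ?_ (fun l => ?_) l
          · simpa using hb₅ i j
          · simpa using hz₅.2 l i j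
        · simpa using hzero₅ i j
      · rw [card_storeOf]; exact hlt
    · simp only [Test.Holds, eval_nvar, h5₅, i₅.size, not_lt] at hge
      have hNK' : N = storeSize n m (ε / 4) := le_antisymm hNK hge
      have hN0 : 0 < N := by
        obtain ⟨hn, hm⟩ := G.pos_of_maxValue_pos hM
        have hn' : (1 : ℝ) ≤ n := by exact_mod_cast hn
        have hm' : (1 : ℝ) ≤ m := by exact_mod_cast hm
        have hKpos : (0 : ℝ) < storeSize n m (ε / 4) :=
          lt_of_lt_of_le (by positivity) (PublicData.le_storeSize n m (η := ε / 4))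
        rw [hNK']
        exact_mod_cast hKpos
      refine Wp.seq (argminProg_spec i₅.toHasInput hN0 hz₅ hu₅ hnL hmL (hNK.trans hKL)) ?_
      rintro s₆ ⟨hf₆, l₀, hl₀, hmin⟩
      have i₆ := i₅.frame hf₆ (by simp) (by simp)
      have h7₆ : s₆.nat 7 = s₅.nat 7 := hf₆.1 7 (by simp)
      refine (copyProg_spec i₆.toHasInput (by rw [hf₆.1 5 (by simp), h5₅]) hl₀ l₀.2 hnL hmL).imp ?_
      rintro s₇ ⟨hf₇, hsame₇, hb₇⟩
      refine ⟨N, Function.update z l₀ z₁, ?_, Or.inl ⟨?_, z₁, hz₁, ht, Or.inr ⟨?_, z l₀, ?_, ?_,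
          storeOf_update z l₀ z₁⟩⟩⟩
      · refine ⟨i₆.frame hf₇ (by simp) (by simp), ⟨?_, fun l i j => ?_⟩, fun i j => ?_⟩
        · rw [hf₇.1 5 (by simp), hf₆.1 5 (by simp), h5₅]
        · by_cases hl : l = l₀
          · rw [hl, Function.update_self, hb₇, h7₆, hb₅]
          · rw [Function.update_of_ne hl, hsame₇ _ (by simpa [Fin.ext_iff] using hl), h7₆, hz₅.2]
        · rw [hsame₇ 0 (by omega), h7₆, hzero₅]
      · rw [hf₇.1 6 (by simp), hf₆.1 6 (by simp), h6₅]
      · rw [card_storeOf, hNK']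
      · rw [mem_storeOf]; exact ⟨l₀, rfl⟩
      · intro z' hz'
        obtain ⟨l, rfl⟩ := (mem_storeOf z z').1 hz'
        exact hmin l
  · rw [himp] at ht
    refine Wp.mono (B := 1) (Wp.setNat ⟨N, z, ?_,
      Or.inr ⟨by simp, rfl, z₁, hz₁, ht⟩⟩) (by omega) fun _ h => h
    refine ⟨i₅.frame (Frame.writeNat _ _ _ _ _ (An := [6]) (Ar := []) (by simp)) (by simp)
      (by simp), ⟨by simp [h5₅], fun l i j => ?_⟩, fun i j => ?_⟩
    · simpa using hz₅.2 l i j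
    · simpa using hzero₅ i j

/-- The whole local search. -/
def searchProg : Prog :=
  .seq storeSizeProg (.seq levelsProg (.seq maxValueProg (.seq (letNat 5 (.const 0))
    (.seq (letNat 6 (.const 1)) (.while (.natLt (.const 0) (nvar 6)) iterationProg)))))

/-- The cost of the local search with at most `L` iterations. -/
def searchCost {R : Type*} [Semiring R] (L : R) : R :=
  1 + (L * 2 + 1) + 1 + (1 + loopCost L 1 + 1 + (1 + loopCost L (loopCost L (1 + 1)) + 1 +
    (1 + (1 + (L * (iterationCost L + 1) + 1) + 1) + 1) + 1) + 1) + 1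

theorem searchProg_spec {G : PublicData n m} {ε : ℝ} (hε : 0 < ε) (hε1 : ε ≤ 1)
    {v : Values n m} (hv : 0 ≤ v) {L : ℕ} (hnL : n ≤ L) (hmL : m ≤ L)
    (hKL : storeSize n m (ε / 4) ≤ L) (hPL : m * storeSize n m (ε / 4) + 1 ≤ L)
    (hTL : 5 * m * storeSize n m (ε / 4) * ⌈1 / ε⌉₊ + 1 ≤ L) :
    Wp searchProg (G.input ε v) (searchCost L) fun s' => ∃ t N z, SearchState G ε v N z s' ∧
      G.SearchRun (ε / 4) v t (storeOf z) ∧ G.SearchStops (ε / 4) v (storeOf z) ∧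
      N ≤ storeSize n m (ε / 4) := by
  have i₀ : HasInput G ε v (G.input ε v) := ⟨rfl, rfl, fun _ _ => rfl⟩
  refine Wp.seq (storeSizeProg_spec i₀ hKL) ?_
  rintro s₁ ⟨hf₁, hK₁⟩
  have i₁ := i₀.frame hf₁ (by simp) (by simp) (by simp)
  refine Wp.seq (levelsProg_spec i₁.nat_one hK₁ hmL) ?_
  rintro s₂ ⟨hf₂, hP₂⟩
  have i₂ := i₁.frame hf₂ (by simp) (by simp) (by simp)
  refine Wp.seq (maxValueProg_spec hv i₂ hnL hmL) ?_
  rintro s₃ ⟨hf₃, hM₃⟩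
  have i₃ : SetUp G ε v s₃ := ⟨i₂.frame hf₃ (by simp) (by simp) (by simp; omega),
    by rw [hf₃.1 3 (by simp), hf₂.1 3 (by simp), hK₁], by rw [hf₃.1 4 (by simp), hP₂], hM₃⟩
  have hf₃' : Frame (G.input ε v) s₃ [3, 4, 10, 11] [7] :=
    ((hf₁.mono (by simp) (by simp)).trans (hf₂.mono (by simp) (by simp))).trans
      (hf₃.mono (by simp) (by simp))
  refine Wp.seq (Q := fun s' => Frame s₃ s' [5] [] ∧ s'.nat 5 0 0 0 = 0)
    (Wp.setNat ⟨Frame.writeNat _ _ _ _ _ (by simp), by simp⟩) ?_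
  rintro s₄ ⟨hf₄, h5₄⟩
  refine Wp.seq (Q := fun s' => Frame s₄ s' [6] [] ∧ s'.nat 6 0 0 0 = 1)
    (Wp.setNat ⟨Frame.writeNat _ _ _ _ _ (by simp), by simp⟩) ?_
  rintro s₅ ⟨hf₅, h6₅⟩
  have i₅ := (i₃.frame hf₄ (by simp) (by simp)).frame hf₅ (by simp) (by simp)
  have h7₅ : ∀ l i j, s₅.nat 7 l i j = 0 := fun l i j => by
    rw [hf₅.1 7 (by simp), hf₄.1 7 (by simp), hf₃'.1 7 (by simp)]
    simp [PublicData.input]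
  have start : SearchState G ε v 0 Fin.elim0 s₅ := ⟨i₅, ⟨by rw [hf₅.1 5 (by simp), h5₄],
    fun l => l.elim0⟩, fun i j => h7₅ _ _ _⟩
  refine (Wp.while (B := iterationCost L) (N := L) (I := fun k s' => ∃ t N z,
    SearchState G ε v N z s' ∧ G.SearchRun (ε / 4) v t (storeOf z) ∧
      ((s'.nat 6 0 0 0 = 1 ∧ k = t) ∨
        (s'.nat 6 0 0 0 = 0 ∧ G.SearchStops (ε / 4) v (storeOf z)))) ?_
    ⟨0, 0, Fin.elim0, start, .start, Or.inl ⟨h6₅, rfl⟩⟩).imp ?_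
  · rintro k s' ⟨t, N, z, hs, hrun, ⟨h6, rfl⟩ | ⟨h6, -⟩⟩ ht
    · have hle := G.searchRun_le hε hε1 hv hrun
      have hcard := (G.searchRun_invariant (by linarith) (by linarith) hv hrun).2.1
      rw [card_storeOf] at hcard
      refine ⟨by omega, (iterationProg_spec hε hε1 hv hs hcard h6 hnL hmL hKL hPL).imp ?_⟩
      rintro s'' ⟨N', z', hs', ⟨h6', hstep⟩ | ⟨h6', heq, hterm⟩⟩
      · exact ⟨k + 1, N', z', hs', hrun.next hstep, Or.inl ⟨h6', rfl⟩⟩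
      · exact ⟨k, N', z', hs', by rwa [heq], Or.inr ⟨h6', by rwa [heq]⟩⟩
    · simp [h6] at ht
  · rintro s' ⟨k, ⟨t, N, z, hs, hrun, ⟨h6, -⟩ | ⟨h6, hterm⟩⟩, ht⟩
    · simp [h6] at ht
    · have hcard := (G.searchRun_invariant (by linarith) (by linarith) hv hrun).2.1
      rw [card_storeOf] at hcard
      exact ⟨t, N, z, hs, hrun, hterm, hcard⟩

end

end GAP

namespace GAP

noncomputable section

open RealRAM

variable {n m : ℕ}

/-! ### Drawing a stored vector -/

/-- Reservoir sampling: each of the first `k` sets `z l` is drawn with probability `1 / (M + k)`,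
and the empty set with the remaining probability. -/
def reservoir {N : ℕ} (M : ℕ) (z : Fin N → Finset (Fin m)) : ℕ → PMF (Finset (Fin m))
  | 0 => PMF.pure ∅
  | k + 1 => (reservoir M z k).bind fun S =>
      if h : k < N then
        (coin (1 / (M + (k + 1) : ℕ))).map fun b => if b then z ⟨k, h⟩ else S
      else PMF.pure S

theorem mem_support_reservoir {N M : ℕ} {z : Fin N → Finset (Fin m)} {k : ℕ} {S : Finset (Fin m)}
    (hS : S ∈ (reservoir M z k).support) : S = ∅ ∨ ∃ l, S = z l := by
  induction k generalizing S with
  | zero =>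
    rw [reservoir, PMF.mem_support_pure_iff] at hS
    exact Or.inl hS
  | succ k ih =>
    rw [reservoir, PMF.mem_support_bind_iff] at hS
    obtain ⟨S', hS', hS⟩ := hS
    split_ifs at hS with hk
    · rw [PMF.mem_support_map_iff] at hS
      obtain ⟨b, -, rfl⟩ := hS
      cases b
      · exact ih hS'
      · exact Or.inr ⟨_, rfl⟩
    · rw [PMF.mem_support_pure_iff] at hS
      exact ih (hS ▸ hS')

theorem inclusion_reservoir {N M : ℕ} (z : Fin N → Finset (Fin m)) (j : Fin m) {k : ℕ}
    (hk : k ≤ N) : inclusion (reservoir M z k) j =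
      (∑ l : Fin N, if l.1 < k then if j ∈ z l then (1 : ℝ) else 0 else 0) / (M + k : ℕ) := by
  induction k with
  | zero => simp [inclusion, reservoir, expect_pure]
  | succ k ih =>
    have hkN : k < N := hk
    have h0 : (0 : ℝ) ≤ 1 / (M + (k + 1) : ℕ) := by positivity
    have h1 : (1 : ℝ) / (M + (k + 1) : ℕ) ≤ 1 := by
      refine div_le_one_of_le₀ ?_ (by positivity)
      exact_mod_cast (by omega : 1 ≤ M + (k + 1))
    rw [sum_ite_lt_succ hkN fun l => if j ∈ z l then (1 : ℝ) else 0, inclusion, reservoir,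
      expect_bind]
    have h2 : ∀ S : Finset (Fin m), expect (if h : k < N then
        (coin (1 / (M + (k + 1) : ℕ))).map fun b => if b then z ⟨k, h⟩ else S
        else PMF.pure S) (fun S => if j ∈ S then (1 : ℝ) else 0) =
        1 / (M + (k + 1) : ℕ) * (if j ∈ z ⟨k, hkN⟩ then 1 else 0) -
          (1 / (M + (k + 1) : ℕ) - 1) * (if j ∈ S then 1 else 0) := by
      intro S
      rw [dif_pos hkN, expect_map, expect_coin h0 h1]
      simp only [if_true, Bool.false_eq_true, if_false]
      ring
    simp only [h2]
    rw [expect_sub, expect_const, expect_mul_left, ← inclusion, ih hkN.le]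
    set c : ℝ := if j ∈ z ⟨k, hkN⟩ then 1 else 0
    set a := ∑ l : Fin N, if l.1 < k then if j ∈ z l then (1 : ℝ) else 0 else 0 with ha
    have hpos : (0 : ℝ) < M + (k + 1) := by positivity
    rcases Nat.eq_zero_or_pos (M + k) with hz | hz
    · have : a = 0 := Finset.sum_eq_zero fun l _ => if_neg (by omega)
      rw [this]
      push_cast
      field_simp
      ring
    · have hz' : (0 : ℝ) < M + k := by exact_mod_cast hz
      push_cast
      field_simp
      ring

/-- The law of the set that bin `i` draws at the point represented by the store: each of the `N`
stored sets has probability `1 / K`. The reservoir starts with the `K - N` unused places. -/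
def drawLaw (η : ℝ) {N : ℕ} (z : Fin N → Alloc n m) (i : Fin n) : PMF (Finset (Fin m)) :=
  reservoir (storeSize n m η - N) (fun l => z l i) N

theorem inclusion_drawLaw {η : ℝ} {N : ℕ} {z : Fin N → Alloc n m} (hN : N ≤ storeSize n m η)
    (i : Fin n) (j : Fin m) :
    inclusion (drawLaw η z i) j = marginal (storePoint η (storeOf z)) i j := by
  rw [drawLaw, inclusion_reservoir _ _ le_rfl, marginal_storeOf, Nat.sub_add_cancel hN]
  simp

/-! ### The program: rounding -/

/-- Draw the slot of a stored vector; slot `0` stands for no vector. -/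
def slotProg : Prog :=
  .seq (letNat 20 (.const 0)) (forLoop 12 5
    (.seq (.flip 21 (.const 0) (.const 0) (.const 0) (.div (lit 1) (.ofNat
        (.add (.sub (nvar 3) (nvar 5)) (.add (nvar 12) (.const 1))))))
      (.ite (.natLt (.const 0) (nvar 21)) (letNat 20 (.add (nvar 12) (.const 1)))
        (letNat 20 (nvar 20)))))

theorem slotProg_spec {G : PublicData n m} {ε : ℝ} {v : Values n m} {N : ℕ}
    {z : Fin N → Alloc n m} {s : Memory} (h : SearchState G ε v N z s) {L : ℕ} (hNL : N ≤ L)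
    (i : Fin n) :
    Samples slotProg s (1 + loopCost L (1 + (1 + 1) + 1) + 1) (drawLaw (ε / 4) z i) fun S s' =>
      Frame s s' [12, 20, 21] [] ∧
        ∀ j : Fin m, s'.nat 7 (s'.nat 20 0 0 0) i j = if j ∈ S then 1 else 0 := by
  refine Wp.seq_samples (Q := fun s' => Frame s s' [12, 20, 21] [] ∧ s'.nat 20 0 0 0 = 0)
    (Wp.setNat ⟨Frame.writeNat _ _ _ _ _ (by simp), by simp⟩) ?_
  rintro s₁ ⟨hf₁, h20⟩
  refine (Samples.forLoop (An := [20, 21]) (Ar := []) (fun k S s' => ∀ j : Fin m,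
      s'.nat 7 (s'.nat 20 0 0 0) i j = if j ∈ S then 1 else 0)
    (reservoir (storeSize n m (ε / 4) - N) fun l => z l i) _ ∅ rfl (fun k _ => rfl)
    (N := N) (by rw [hf₁.1 5 (by simp), h.holds.1]) hNL (by simp) (by simp) ?_ ?_ ?_).mono le_rfl
    fun S s' hs => ⟨hf₁.trans hs.1, hs.2⟩
  · intro j
    rw [h20, hf₁.1 7 (by simp), h.zero]
    simp
  · intro k S s' x hJ j
    simpa using hJ j
  · intro k S s₂ hk hf₂ hc hJ
    have hf : Frame s s₂ [12, 20, 21] [] := hf₁.trans hf₂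
    have h3 : s₂.nat 3 0 0 0 = storeSize n m (ε / 4) := by rw [hf.1 3 (by simp), h.size]
    have h5 : s₂.nat 5 0 0 0 = N := by rw [hf.1 5 (by simp), h.holds.1]
    have h7 : s₂.nat 7 = s.nat 7 := hf.1 7 (by simp)
    rw [dif_pos hk, ← PMF.bind_pure_comp]
    refine Samples.seq (R := fun b s' => Frame s₂ s' [20, 21] [] ∧ s'.nat 21 0 0 0 =
      (if b then 1 else 0) ∧ s'.nat 20 = s₂.nat 20) ?_ ?_
    · have := Samples.flip (a := 21) (i := .const 0) (j := .const 0) (k := .const 0) (s := s₂)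
        (p := .div (lit 1) (.ofNat (.add (.sub (nvar 3) (nvar 5)) (.add (nvar 12) (.const 1)))))
        (R := fun b s' => Frame s₂ s' [20, 21] [] ∧ s'.nat 21 0 0 0 = (if b then 1 else 0) ∧
          s'.nat 20 = s₂.nat 20)
        fun b => ⟨Frame.writeNat _ _ _ _ _ (by simp), by simp, by simp⟩
      simpa only [RExpr.eval, NExpr.eval, eval_lit, eval_nvar, h3, h5, hc, Nat.cast_one] using this
    · rintro b s₃ ⟨hf₃, h21, h20'⟩
      have h12 : s₃.nat 12 0 0 0 = k := by rw [hf₃.1 12 (by simp), hc]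
      have h7' : s₃.nat 7 = s.nat 7 := by rw [hf₃.1 7 (by simp), h7]
      refine Wp.samples (Wp.ite (fun ht => Wp.setNat
        ⟨hf₃.trans (Frame.writeNat _ _ _ _ _ (by simp)), fun j => ?_⟩) fun ht => Wp.setNat
        ⟨hf₃.trans (Frame.writeNat _ _ _ _ _ (by simp)), fun j => ?_⟩)
      · cases b
        · simp [h21] at ht
        · simpa [h12, h7'] using h.holds.2 ⟨k, hk⟩ i j
      · cases b
        · simpa [h20', h7', h7] using hJ j
        · simp [h21] at ht

/-- Draw the set of one bin: draw a stored vector, and keep each item of its set with the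
probability that damps the marginal. If a marginal is `0`, the bias is `0 / 0 = 0`; no stored vector
then gives the item to the bin. -/
def drawBinProg : Prog :=
  .seq slotProg (forLoop 11 1 (.flip 22 (nvar 10) (nvar 11) (.const 0)
    (.mul (.ofNat (.read 7 (nvar 20) (nvar 10) (nvar 11)))
      (.div (.sub (lit 1) (.exp (.sub (lit 0) (entry 4 10 11)))) (entry 4 10 11)))))

theorem drawBinProg_spec {G : PublicData n m} {ε : ℝ} {v : Values n m} {N : ℕ}
    {z : Fin N → Alloc n m} {s : Memory} (h : SearchState G ε v N z s) {y : Fin n → Fin m → ℝ}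
    (hy : ∀ i j, s.real 4 i.1 j.1 0 = y i j) {i : Fin n} (hi : s.nat 10 0 0 0 = i) {L : ℕ}
    (hmL : m ≤ L) (hNL : N ≤ L) :
    Samples drawBinProg s (1 + loopCost L (1 + (1 + 1) + 1) + 1 + loopCost L 1 + 1)
      (thinLaw (drawLaw (ε / 4) z i) fun j => dampFactor (y i j)) fun S s' =>
        Frame s s' [11, 12, 20, 21, 22] [] ∧ (∀ i' ≠ i.1, s'.nat 22 i' = s.nat 22 i') ∧
          ∀ j : Fin m, s'.nat 22 i j 0 = if j ∈ S then 1 else 0 := by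
  refine Samples.seq (slotProg_spec h hNL i) ?_
  rintro T s₁ ⟨hf₁, hT⟩
  refine (Samples.forLoop (An := [22]) (Ar := []) (fun k S s' => (∀ j ∈ S, j.1 < k) ∧
      (∀ i' ≠ i.1, s'.nat 22 i' = s₁.nat 22 i') ∧
      ∀ j : Fin m, j.1 < k → s'.nat 22 i j 0 = if j ∈ S then 1 else 0)
    (coinSet fun j => (if j ∈ T then 1 else 0) * dampFactor (y i j)) _ ∅ rfl (fun k _ => rfl)
    (N := m) (by rw [hf₁.1 1 (by simp), h.nat_one]) hmL (by simp) (by simp)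
    ⟨by simp, fun _ _ => rfl, fun j hj => absurd hj (Nat.not_lt_zero _)⟩ ?_ ?_).mono le_rfl ?_
  · rintro k S s' x ⟨h1, h2, h3⟩
    exact ⟨h1, fun i' hi' => by simpa using h2 i' hi', fun j hj => by simpa using h3 j hj⟩
  · rintro k S s₂ hk hf₂ hc ⟨h1, h2, h3⟩
    have h20 : s₂.nat 20 = s₁.nat 20 := hf₂.1 20 (by simp)
    have h7 : s₂.nat 7 = s₁.nat 7 := hf₂.1 7 (by simp)
    have h4 : s₂.real 4 = s.real 4 := by rw [hf₂.2 4 (by simp), hf₁.2 4 (by simp)]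
    have h10 : s₂.nat 10 0 0 0 = i := by rw [hf₂.1 10 (by simp), hf₁.1 10 (by simp), hi]
    have hbit := hT ⟨k, hk⟩
    have hyk := hy i ⟨k, hk⟩
    simp only at hbit hyk
    have hp : RExpr.eval s₂ (.mul (.ofNat (.read 7 (nvar 20) (nvar 10) (nvar 11)))
        (.div (.sub (lit 1) (.exp (.sub (lit 0) (entry 4 10 11)))) (entry 4 10 11))) =
        (if (⟨k, hk⟩ : Fin m) ∈ T then 1 else 0) * dampFactor (y i ⟨k, hk⟩) := by
      simp [h10, hc, h20, h7, h4, hyk, hbit, dampFactor]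
    rw [addCoin, dif_pos hk, ← hp]
    refine Samples.map (Samples.flip fun b => ⟨Frame.writeNat _ _ _ _ _ (by simp), ?_, ?_, ?_⟩)
    · intro j hj
      cases b
      · exact (h1 j (by simpa using hj)).trans (Nat.lt_succ_self _)
      · rcases Finset.mem_insert.1 (by simpa using hj) with rfl | hj
        · exact Nat.lt_succ_self _
        · exact (h1 j hj).trans (Nat.lt_succ_self _)
    · intro i' hi'
      rw [← h2 i' hi']
      funext j' k'
      simp [h10, hi']
    · intro j hj
      by_cases he : j.1 = k
      · obtain rfl : j = ⟨k, hk⟩ := Fin.ext he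
        have hnot : (⟨k, hk⟩ : Fin m) ∉ S := fun hS => lt_irrefl _ (h1 _ hS)
        cases b <;> simp [h10, hc, hnot]
      · have hne : j ≠ ⟨k, hk⟩ := fun h => he (congrArg Fin.val h)
        have := h3 j (by omega)
        cases b <;> simp [hc, he, this, hne]
  · rintro S s' ⟨hf, -, h2, h3⟩
    refine ⟨(hf₁.mono (by simp) (by simp)).trans (hf.mono (by simp) (by simp)), fun i' hi' => ?_,
      fun j => h3 j j.2⟩
    rw [h2 i' hi', hf₁.1 22 (by simp)]

/-- Draw the sets of all bins. -/
def drawProg : Prog := forLoop 10 0 drawBinProg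

theorem SearchState.frame {G : PublicData n m} {ε : ℝ} {v : Values n m} {N : ℕ}
    {z : Fin N → Alloc n m} {s s' : Memory} (h : SearchState G ε v N z s) {An Ar : List ℕ}
    (hf : Frame s s' An Ar) (hn : ∀ a ∈ [0, 1, 3, 4, 5, 7], a ∉ An)
    (hr : ∀ a ∈ [0, 1, 2, 3, 7], a ∉ Ar) : SearchState G ε v N z s' where
  toSetUp := h.toSetUp.frame hf (fun a ha => hn a (by simp at ha ⊢; omega)) hr
  holds := ⟨by rw [hf.1 5 (hn 5 (by simp)), h.holds.1], fun l i j => by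
    rw [hf.1 7 (hn 7 (by simp)), h.holds.2]⟩
  zero i j := by rw [hf.1 7 (hn 7 (by simp)), h.zero]

theorem drawProg_spec {G : PublicData n m} {ε : ℝ} {v : Values n m} {N : ℕ}
    {z : Fin N → Alloc n m} {s : Memory} (h : SearchState G ε v N z s) {y : Fin n → Fin m → ℝ}
    (hy : ∀ i j, s.real 4 i.1 j.1 0 = y i j) {L : ℕ} (hnL : n ≤ L) (hmL : m ≤ L) (hNL : N ≤ L) :
    Samples drawProg s
      (loopCost L (1 + loopCost L (1 + (1 + 1) + 1) + 1 + loopCost L 1 + 1))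
      (drawBins (fun i => thinLaw (drawLaw (ε / 4) z i) fun j => dampFactor (y i j)) n) fun T s' =>
        Frame s s' [10, 11, 12, 20, 21, 22] [] ∧
          ∀ (i : Fin n) (j : Fin m), s'.nat 22 i j 0 = if j ∈ T i then 1 else 0 := by
  refine (Samples.forLoop (An := [11, 12, 20, 21, 22]) (Ar := []) (fun k T s' =>
      ∀ (i : Fin n) (j : Fin m), i.1 < k → s'.nat 22 i j 0 = if j ∈ T i then 1 else 0)
    (drawBins fun i => thinLaw (drawLaw (ε / 4) z i) fun j => dampFactor (y i j)) _ (fun _ => ∅) rfl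
    (fun k _ => rfl) h.nat_zero hnL (by simp) (by simp)
    (fun i j hi => absurd hi (Nat.not_lt_zero _))
    (fun k T s' x hJ i j hi => by simpa using hJ i j hi) ?_).mono le_rfl
    fun T s' hs => ⟨hs.1, fun i j => hs.2 i j i.2⟩
  intro k T s₁ hk hf₁ hc hJ
  have h₁ := h.frame hf₁ (by simp) (by simp)
  rw [dif_pos hk]
  refine Samples.map ((drawBinProg_spec h₁ (i := ⟨k, hk⟩) (y := y)
    (fun i j => by rw [hf₁.2 4 (by simp), hy]) hc hmL hNL).mono le_rfl ?_)
  rintro S s₂ ⟨hf₂, hsame, hS⟩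
  refine ⟨hf₂, fun i j hi => ?_⟩
  by_cases he : i.1 = k
  · obtain rfl : i = ⟨k, hk⟩ := Fin.ext he
    rw [Function.update_self, hS]
  · have hne : i ≠ ⟨k, hk⟩ := fun h => he (congrArg Fin.val h)
    rw [Function.update_of_ne hne, hsame _ he, hJ i j (by omega)]

/-- Give each item to the first bin in the greedy order whose set contains it. -/
def resolveProg : Prog :=
  forLoop₂ 10 0 11 1 (.seq (.setNat 2 (nvar 10) (nvar 11) (.const 0)
      (.read 22 (nvar 10) (nvar 11) (.const 0)))
    (forLoop 12 0 (.ite (.and (.natLt (.const 0) (.read 22 (nvar 12) (nvar 11) (.const 0)))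
        (.not (precedesTest 10 12)))
      (.setNat 2 (nvar 10) (nvar 11) (.const 0) (.const 0))
      (.setNat 2 (nvar 10) (nvar 11) (.const 0) (.read 2 (nvar 10) (nvar 11) (.const 0))))))

theorem resolveProg_spec {G : PublicData n m} {ε : ℝ} {v : Values n m} {s : Memory}
    (h : HasInput G ε v s) {T : Alloc n m}
    (hT : ∀ (i : Fin n) (j : Fin m), s.nat 22 i j 0 = if j ∈ T i then 1 else 0) {L : ℕ}
    (hnL : n ≤ L) (hmL : m ≤ L) :
    Wp resolveProg s (loopCost L (loopCost L (1 + loopCost L (1 + 1) + 1))) fun s' =>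
      PublicData.output s' = resolve (greedyOrder v) T := by
  refine (Wp.forLoop₂ (An := [12, 2]) (Ar := [])
    (fun (i : Fin n) (j : Fin m) s' => s'.nat 2 i j 0 = 1 ↔ j ∈ resolve (greedyOrder v) T i)
    h.nat_zero h.nat_one hnL hmL (by simp) (by simp) (by simp) (by simp) ?_ ?_).imp ?_
  · rintro i j s' c x (rfl | rfl) hs <;> simpa using hs
  · intro i j s₁ hf₁ hi hj
    have h22 : s₁.nat 22 = s.nat 22 := hf₁.1 22 (by simp)
    refine Wp.seq (Q := fun s' => Frame s₁ s' [12, 2] [] ∧ (s'.nat 2 i j 0 = 1 ↔ j ∈ T i) ∧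
      ∀ i' j', ¬ (i' = i.1 ∧ j' = j.1) → s'.nat 2 i' j' 0 = s₁.nat 2 i' j' 0)
      (Wp.setNat ⟨Frame.writeNat _ _ _ _ _ (by simp), ?_, fun i' j' hne => ?_⟩) ?_
    · simp [hi, hj, h22, hT]
    · simp only [Memory.writeNat, eval_nvar, hi, hj]
      rw [if_neg (by tauto)]
    rintro s₂ ⟨hf₂, hin, hsame⟩
    have i₂ := (h.frame hf₁ (by simp) (by simp) (by simp)).frame hf₂ (by simp) (by simp) (by simp)
    refine (Wp.forLoop (An := [2]) (Ar := []) (fun k s' =>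
      (s'.nat 2 i j 0 = 1 ↔ j ∈ T i ∧ ∀ k' : Fin n, k'.1 < k → j ∈ T k' → Precedes v j i k') ∧
      ∀ i' j', ¬ (i' = i.1 ∧ j' = j.1) → s'.nat 2 i' j' 0 = s₁.nat 2 i' j' 0) i₂.nat_zero hnL
      (by simp) (by simp) ⟨by simpa using hin, hsame⟩ ?_ ?_).imp ?_
    · rintro k s' x ⟨h1, h2⟩
      exact ⟨by simpa using h1, fun i' j' hne => by simpa using h2 i' j' hne⟩
    · rintro k s₃ hk hf₃ hc ⟨hJ, hsame₃⟩
      have i₃ := i₂.frame hf₃ (by simp) (by simp) (by simp)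
      have h10 : s₃.nat 10 0 0 0 = i := by rw [hf₃.1 10 (by simp), hf₂.1 10 (by simp), hi]
      have h11 : s₃.nat 11 0 0 0 = j := by rw [hf₃.1 11 (by simp), hf₂.1 11 (by simp), hj]
      have h22' : s₃.nat 22 = s.nat 22 := by
        rw [hf₃.1 22 (by simp), hf₂.1 22 (by simp), h22]
      have hbit := hT ⟨k, hk⟩ j
      simp only at hbit
      have htest : (Test.and (.natLt (.const 0) (.read 22 (nvar 12) (nvar 11) (.const 0)))
          (.not (precedesTest 10 12))).Holds s₃ ↔
          j ∈ T ⟨k, hk⟩ ∧ ¬ Precedes v j i ⟨k, hk⟩ := by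
        rw [Test.Holds, Test.Holds, Test.Holds, precedesTest_holds i₃ h10 (i := ⟨k, hk⟩) hc h11]
        simp only [NExpr.eval, eval_nvar, hc, h11, h22', hbit]
        by_cases hjT : j ∈ T ⟨k, hk⟩ <;> simp [hjT]
      have hother : ∀ x i' j', ¬ (i' = i.1 ∧ j' = j.1) →
          (s₃.writeNat 2 ((nvar 10).eval s₃) ((nvar 11).eval s₃) (NExpr.eval s₃ (.const 0)) x).nat
            2 i' j' 0 = s₁.nat 2 i' j' 0 := by
        intro x i' j' hne
        rw [← hsame₃ i' j' hne]
        simp only [Memory.writeNat, eval_nvar, h10, h11]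
        rw [if_neg (by tauto)]
      refine Wp.ite (fun ht => Wp.setNat ⟨Frame.writeNat _ _ _ _ _ (by simp), ?_, hother _⟩)
        fun ht => Wp.setNat ⟨Frame.writeNat _ _ _ _ _ (by simp), ?_, hother _⟩
      · rw [htest] at ht
        simp only [Memory.writeNat, NExpr.eval, eval_nvar, h10, h11, and_self, if_true, zero_ne_one,
          false_iff, not_and]
        exact fun _ hall => ht.2 (hall ⟨k, hk⟩ (Nat.lt_succ_self k) ht.1)
      · rw [htest, not_and, not_not] at ht
        simp only [Memory.writeNat, NExpr.eval, eval_nvar, h10, h11, and_self, if_true]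
        rw [hJ]
        refine and_congr_right fun _ => ⟨fun hall k' hk' hj' => ?_, fun hall k' hk' hj' =>
          hall k' (by omega) hj'⟩
        by_cases he : k'.1 = k
        · obtain rfl : k' = ⟨k, hk⟩ := Fin.ext he
          exact ht hj'
        · exact hall k' (by omega) hj'
    · rintro s₃ ⟨hf₃, hJ, hsame₃⟩
      refine ⟨(hf₂.mono (by simp) (by simp)).trans (hf₃.mono (by simp) (by simp)), ?_, ?_⟩
      · rw [hJ, PublicData.mem_resolve]
        exact and_congr_right fun _ => forall_congr' fun k' => ⟨fun h => h k'.2, fun h _ => h⟩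
      · intro i' j' hne hs
        rw [hsame₃ _ _ hne, hs]
  · rintro s' ⟨-, hs⟩
    funext i
    ext j
    rw [← hs]
    simp [PublicData.output]

/-- The whole program: local search, then greedy rounding of its outcome. -/
def allocationProg : Prog :=
  .seq searchProg (.seq marginalProg (.seq drawProg resolveProg))

/-- The cost of the whole program. -/
def allocationCost {R : Type*} [Semiring R] (L : R) : R :=
  searchCost L + (loopCost L (loopCost L (1 + (loopCost L (1 + 1) + 1 + 1) + 1)) +
    (loopCost L (1 + loopCost L (1 + (1 + 1) + 1) + 1 + loopCost L 1 + 1) +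
      loopCost L (loopCost L (1 + loopCost L (1 + 1) + 1)) + 1) + 1) + 1

/-- The program halts in time and its output has the law of the greedy rounding of the outcome of a
run of the local search. -/
theorem allocationProg_spec {G : PublicData n m} {ε : ℝ} (hε : 0 < ε) (hε1 : ε ≤ 1)
    {v : Values n m} (hv : 0 ≤ v) {L T : ℕ} (hnL : n ≤ L) (hmL : m ≤ L)
    (hKL : storeSize n m (ε / 4) ≤ L) (hPL : m * storeSize n m (ε / 4) + 1 ≤ L)
    (hTL : 5 * m * storeSize n m (ε / 4) * ⌈1 / ε⌉₊ + 1 ≤ L) (hT : allocationCost L ≤ T) :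
    HaltsWithin allocationProg (G.input ε v) T ∧ ∃ t Z, G.SearchRun (ε / 4) v t Z ∧
      G.SearchStops (ε / 4) v Z ∧
      G.IsRounding (storePoint (ε / 4) Z) (greedyOrder v) (G.ruleOf allocationProg T ε v) := by
  -- The local search is deterministic, so its outcome can be fixed before the coins are tossed.
  obtain ⟨s₁, ⟨t, N, z, hs, hrun, hterm, hNK⟩, hk⟩ :=
    searchProg_spec hε hε1 hv hnL hmL hKL hPL hTL (G := G)
  have hsearch : Wp searchProg (G.input ε v) (searchCost L) fun s' => s' = s₁ := ⟨s₁, rfl, hk⟩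
  set x := storePoint (ε / 4) (storeOf z) with hx
  have key : Samples allocationProg (G.input ε v) (allocationCost L)
      (drawBins (fun i => thinLaw (drawLaw (ε / 4) z i) fun j => dampFactor (marginal x i j)) n)
      fun T s' => PublicData.output s' = resolve (greedyOrder v) T := by
    refine Wp.seq_samples hsearch ?_
    rintro _ rfl
    refine Wp.seq_samples (marginalProg_spec hs.toHasInput hs.holds hs.size hnL hmL
      (hNK.trans hKL)) ?_
    rintro s₂ ⟨hf₂, hy⟩
    have h₂ := hs.frame hf₂ (by simp) (by simp)
    have := Samples.seq (E := PMF.pure) (R' := fun T s' =>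
      PublicData.output s' = resolve (greedyOrder v) T)
      (drawProg_spec h₂ hy hnL hmL (hNK.trans hKL)) fun T s₃ hs₃ => Wp.samples
        (resolveProg_spec (h₂.toHasInput.frame hs₃.1 (by simp) (by simp) (by simp)) hs₃.2 hnL hmL)
    rwa [PMF.bind_pure] at this
  obtain ⟨h1, h2⟩ := key.runFor_map hT
  refine ⟨h1, t, storeOf z, hrun, hterm, ?_⟩
  rw [PublicData.ruleOf, h2]
  have hfits := (G.searchRun_invariant (by linarith) (by linarith) hv hrun).2.2.1
  refine G.isRounding_of_thinLaw (storePoint_nonneg _ _) ?_ (inclusion_drawLaw hNK) _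
  intro i S hS
  rcases mem_support_reservoir hS with rfl | ⟨l, rfl⟩
  · exact G.fits_empty i
  · exact hfits _ ((mem_storeOf z _).2 ⟨l, rfl⟩) i

end

end GAP

namespace GAP

noncomputable section

open RealRAM

variable {n m : ℕ}

/-! ### The polynomial time bound -/

/-- A bound for all loops of the program, in terms of `X = n + m + ⌈1 / ε⌉`. -/
def sizeBound : Polynomial ℕ := 120 * Polynomial.X ^ 6 + Polynomial.X + 1

/-- The time bound. The second summand makes it exceed the number of iterations of the local
search as well. -/
def timeBound : Polynomial ℕ := allocationCost sizeBound + sizeBound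

theorem map_allocationCost {R S : Type*} [Semiring R] [Semiring S] (f : R →+* S) (x : R) :
    f (allocationCost x) = allocationCost (f x) := by
  simp [allocationCost, searchCost, iterationCost, knapsackCost, loopCost, map_ofNat]

theorem eval_timeBound (X : ℕ) :
    timeBound.eval X = allocationCost (sizeBound.eval X) + sizeBound.eval X := by
  rw [timeBound, Polynomial.eval_add]
  exact congrArg (· + _) (map_allocationCost (Polynomial.evalRingHom X) sizeBound)

theorem le_sizeBound (n m : ℕ) {ε : ℝ} (hε : 0 < ε) :
    let L := sizeBound.eval (n + m + ⌈1 / ε⌉₊)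
    n ≤ L ∧ m ≤ L ∧ storeSize n m (ε / 4) ≤ L ∧ m * storeSize n m (ε / 4) + 1 ≤ L ∧
      5 * m * storeSize n m (ε / 4) * ⌈1 / ε⌉₊ + 1 ≤ L := by
  have hK := PublicData.storeSize_le n m hε
  have hc : 1 ≤ ⌈1 / ε⌉₊ := Nat.ceil_pos.2 (by positivity)
  generalize storeSize n m (ε / 4) = K at *
  generalize ⌈1 / ε⌉₊ = c at *
  set X := n + m + c with hX
  have hnX : n ≤ X := by omega
  have hmX : m ≤ X := by omega
  have hcX : c ≤ X := by omega
  have hX1 : 1 ≤ X := by omega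
  have h4 : K ≤ 24 * X ^ 4 := hK.trans (by
    calc 24 * m * n ^ 2 * c ≤ 24 * X * X ^ 2 * X := by gcongr
      _ = 24 * X ^ 4 := by ring)
  have h5 : m * K ≤ 24 * X ^ 5 := by
    calc m * K ≤ X * (24 * X ^ 4) := by gcongr
      _ = 24 * X ^ 5 := by ring
  have h6 : 5 * m * K * c ≤ 120 * X ^ 6 := by
    calc 5 * m * K * c = 5 * (m * K) * c := by ring
      _ ≤ 5 * (24 * X ^ 5) * X := by gcongr
      _ = 120 * X ^ 6 := by ring
  have h46 : X ^ 4 ≤ X ^ 6 := Nat.pow_le_pow_right hX1 (by norm_num)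
  have h56 : X ^ 5 ≤ X ^ 6 := Nat.pow_le_pow_right hX1 (by norm_num)
  have heval : sizeBound.eval X = 120 * X ^ 6 + X + 1 := by simp [sizeBound]
  simp only [heval]
  refine ⟨by omega, by omega, by omega, by omega, by omega⟩

end

end GAP

theorem theorem1 :
    ∃ (P : RealRAM.Prog) (p : Polynomial ℕ),
      ∀ (n m : ℕ) (G : PublicData n m) (ε : ℝ), 0 < ε → ε ≤ 1 →
        -- `P` runs in time polynomial in `n`, `m` and `1/ε`
        (∀ v : Values n m, 0 ≤ v →
          RealRAM.HaltsWithin P (G.input ε v) (p.eval (n + m + ⌈1 / ε⌉₊))) ∧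
        -- `P` computes a `(1 - ε)`-MIDR allocation rule
        G.IsApproxMIDR ε G.roundingRange (G.ruleOf P (p.eval (n + m + ⌈1 / ε⌉₊)) ε) ∧
        -- the rule is a `(1 - 1/e - ε)`-approximation to the optimal social welfare
        (∀ v : Values n m, 0 ≤ v → ∀ S : Alloc n m, G.Feasible S →
          (1 - 1 / Real.exp 1 - ε) * G.welfare v S ≤
            G.expWelfare v (G.ruleOf P (p.eval (n + m + ⌈1 / ε⌉₊)) ε v)) ∧
        -- rounding is possible at every point of the polytope
        (∀ x ∈ G.polytope, ∃ x' ∈ G.polytope, IsDamping x x') ∧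
        -- the objective is concave and is the exact expected welfare of the greedy rounding
        (∀ v : Values n m, 0 ≤ v → ConcaveOn ℝ Set.univ (objective v)) ∧
        (∀ v : Values n m, 0 ≤ v → ∀ x ∈ G.polytope, ∀ π, IsGreedyOrder v π →
          ∀ D, G.IsRounding x π D → G.expWelfare v D = objective v (marginal x)) ∧
        -- every run of the local search has polynomially many iterations, and its outcome is a
        -- `(1 - ε)`-approximate maximizer of the objective over the polytope
        (∀ v : Values n m, 0 ≤ v → ∀ t Z, G.SearchRun (ε / 4) v t Z →
          t ≤ p.eval (n + m + ⌈1 / ε⌉₊) ∧ storePoint (ε / 4) Z ∈ G.polytope ∧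
          (G.SearchStops (ε / 4) v Z → ∀ x ∈ G.polytope,
            (1 - ε) * objective v (marginal x) ≤
              objective v (marginal (storePoint (ε / 4) Z)))) ∧
        -- the rule is the greedy rounding of the outcome of the local search
        (∀ v : Values n m, 0 ≤ v → ∃ t Z, G.SearchRun (ε / 4) v t Z ∧ G.SearchStops (ε / 4) v Z ∧
          ∃ π, IsGreedyOrder v π ∧
            G.IsRounding (storePoint (ε / 4) Z) π
              (G.ruleOf P (p.eval (n + m + ⌈1 / ε⌉₊)) ε v)) := by
  refine ⟨allocationProg, timeBound, fun n m G ε hε hε1 => ?_⟩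
  obtain ⟨hnL, hmL, hKL, hPL, hTL⟩ := le_sizeBound n m hε
  have heval := eval_timeBound (n + m + ⌈1 / ε⌉₊)
  set L := sizeBound.eval (n + m + ⌈1 / ε⌉₊)
  set T := timeBound.eval (n + m + ⌈1 / ε⌉₊)
  have hη : 0 < ε / 4 := by linarith
  have hη1 : ε / 4 ≤ 1 := by linarith
  have hrule : ∀ v : Values n m, 0 ≤ v → _ := fun v hv =>
    allocationProg_spec (G := G) hε hε1 hv hnL hmL hKL hPL hTL
      (heval ▸ Nat.le_add_right _ _ : _ ≤ T)
  -- The expected welfare of the rule is the objective at the outcome, which is almost optimal.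
  have hopt : ∀ v : Values n m, 0 ≤ v → ∀ x ∈ G.polytope, (1 - ε) * objective v (marginal x) ≤
      G.expWelfare v (G.ruleOf allocationProg T ε v) := by
    intro v hv x hx
    obtain ⟨-, t, Z, hrun, hterm, hround⟩ := hrule v hv
    rw [G.expWelfare_eq_objective (isGreedyOrder_greedyOrder v) hround]
    exact G.objective_le_of_searchStops hε hε1 hv hterm hx
  refine ⟨fun v hv => (hrule v hv).1, ⟨fun D hD S hS => G.feasible_of_mem_roundingRange hD hS,
    fun v hv => ⟨?_, ?_⟩⟩, fun v hv S hS => ?_, fun x hx => G.exists_isDamping hx,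
    fun v hv => concaveOn_objective hv, fun v _ x _ π hπ D hD =>
      G.expWelfare_eq_objective hπ hD,
    fun v hv t Z hrun => ⟨?_, G.searchRun_mem_polytope hη hη1 hv hrun,
      fun hterm x hx => G.objective_le_of_searchStops hε hε1 hv hterm hx⟩, fun v hv => ?_⟩
  · obtain ⟨-, t, Z, hrun, -, hround⟩ := hrule v hv
    exact ⟨_, G.searchRun_mem_polytope hη hη1 hv hrun, _, hround⟩
  · rintro D ⟨x, hx, π, hD⟩
    exact (mul_le_mul_of_nonneg_left (G.expWelfare_le_objective hD) (by linarith)).trans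
      (hopt v hv x hx)
  · have h1 := G.welfare_le_objective hv hS
    have h2 := hopt v hv _ (G.allocPoint_mem_polytope hS.1)
    rw [PublicData.marginal_allocPoint] at h2
    have h3 := G.welfare_nonneg hv S
    have h4 := mul_le_mul_of_nonneg_left h1 (by linarith : (0 : ℝ) ≤ 1 - ε)
    -- `(1 - ε) (1 - 1/e)` exceeds `1 - 1/e - ε` by `ε / e`.
    have h5 : 0 ≤ ε * (1 / Real.exp 1) * G.welfare v S := by positivity
    linarith
  · have := G.searchRun_le hε hε1 hv hrun
    omega
  · obtain ⟨-, t, Z, hrun, hterm, hround⟩ := hrule v hv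
    exact ⟨t, Z, hrun, hterm, _, isGreedyOrder_greedyOrder v, hround⟩
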